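/- Let $N$ be a smooth (not necessarily complete) Riemannian manifold with boundary, of dimension $n$. Let $\nu_N$ be the unit normal to $\partial N$ that points into $N$, and let $0\le m\le n-1$. Let $p\in\partial N$, let $\kappa_1\le\dots\le\kappa_{n-1}$ be the principal curvatures of $\partial N$ at $p$ with respect to $\nu_N$ (with the sign for which the boundary of a Euclidean ball of radius $r$ has all $\kappa_i=1/r$), and let $\eta<\kappa_1+\dots+\kappa_m$. Then there is a compactly supported $C^\infty$ tangent vector field $X$ on $N$ such that $X(p)$ is a nonzero normal to $\partial N$, such that $X\cdot\nu_N\ge 0$ at all points of $\partial N$, and such that $$\delta V(X)\le-\eta\int|X|\,d\mu_V$$ for every $m$-dimensional varifold $V$ in $N$. Here an $m$-dimensional varifold is a Radon measure on the bundle $G_m(N)$ of pairs $(x,P)$ with $x\in N$ and $P$ an $m$-dimensional linear subspace of $T_xN$, and $\mu_V$ is its image measure on $N$. The first variation $\delta V(X)$ is the derivative at $t=0$ (over $t\ge0$) of the area of $\phi_t(V\cap W)$, where $(\phi_t)_{t\ge0}$ is the family of maps of $N$ into itself generated by $X$ ($\phi_0=\mathrm{id}$, $\frac{d}{dt}\phi_t=X\circ\phi_t$),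 $W$ is any open set with compact closure that contains the support of $X$, and the area of $f(V\cap W)$ is the integral over $\{(x,P)\in G_m(N):x\in W\}$, with respect to $V$, of the $m$-dimensional Jacobian of $df_x|_P$. -/

import Mathlib

open Set MeasureTheory Bundle
open scoped Manifold ContDiff Topology ENNReal Bundle

noncomputable section

namespace RiemannianBoundary

section

-- `N` is a smooth `(n+1)`-dimensional Riemannian manifold with boundary.
variable {n : ℕ} {N : Type*} [TopologicalSpace N]
  [ChartedSpace (EuclideanHalfSpace (n + 1)) N]

instance instFiniteDimensionalTangentSpace (x : N) :
    FiniteDimensional ℝ (TangentSpace (𝓡∂ (n + 1)) x) :=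
  inferInstanceAs (FiniteDimensional ℝ (EuclideanSpace ℝ (Fin (n + 1))))

/-- The differential at `p` of the zeroth coordinate of the preferred chart at `p`.  (In Mathlib the
tangent space at `p` is the model space, the identification being the differential at `p` of the
preferred chart at `p`.)  This chart takes values in the half-space `{y | 0 ≤ y 0}`; at a boundary
point its zeroth coordinate is a boundary defining function. -/
def boundaryCoord (p : N) : TangentSpace (𝓡∂ (n + 1)) p →ₗ[ℝ] ℝ :=
  (EuclideanSpace.proj (0 : Fin (n + 1)) : EuclideanSpace ℝ (Fin (n + 1)) →L[ℝ] ℝ).toLinearMap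

/-- The tangent space to the boundary `∂N` at a point `p ∈ ∂N`. -/
def boundaryTangent (p : N) : Submodule ℝ (TangentSpace (𝓡∂ (n + 1)) p) :=
  LinearMap.ker (boundaryCoord p)

theorem boundaryCoord_surjective (p : N) :
    Function.Surjective (boundaryCoord (n := n) p) := fun c =>
  ⟨(EuclideanSpace.single (0 : Fin (n + 1)) c : EuclideanSpace ℝ (Fin (n + 1))), by
    change (EuclideanSpace.single (0 : Fin (n + 1)) c : EuclideanSpace ℝ (Fin (n + 1))) 0 = c
    simp⟩

theorem finrank_boundaryTangent (p : N) :
    Module.finrank ℝ (boundaryTangent (n := n) p) = n := by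
  have h := LinearMap.finrank_range_add_finrank_ker (boundaryCoord (n := n) p)
  rw [LinearMap.range_eq_top.2 (boundaryCoord_surjective p), finrank_top,
    Module.finrank_self] at h
  have h2 : Module.finrank ℝ (TangentSpace (𝓡∂ (n + 1)) p) = n + 1 :=
    finrank_euclideanSpace_fin (𝕜 := ℝ) (n := n + 1)
  rw [h2] at h
  change Module.finrank ℝ (LinearMap.ker (boundaryCoord (n := n) p)) = n
  omega

variable [RiemannianBundle (fun x : N => TangentSpace (𝓡∂ (n + 1)) x)]

/-! ### The inward unit normal -/

/-- `ν` is a unit normal to `∂N` at `q ∈ ∂N` pointing into `N`. -/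
structure IsInwardUnitNormal (q : N) (ν : TangentSpace (𝓡∂ (n + 1)) q) : Prop where
  norm_eq_one : ‖ν‖ = 1
  normal : ∀ v ∈ boundaryTangent q, inner ℝ ν v = 0
  inward : 0 < boundaryCoord q ν

theorem existsUnique_isInwardUnitNormal (q : N) :
    ∃! ν : TangentSpace (𝓡∂ (n + 1)) q, IsInwardUnitNormal q ν := by
  obtain ⟨e, he⟩ : ∃ e : TangentSpace (𝓡∂ (n + 1)) q,
      ∀ v, inner ℝ e v = boundaryCoord q v := by
    refine ⟨(InnerProductSpace.toDual ℝ (TangentSpace (𝓡∂ (n + 1)) q)).symm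
      (LinearMap.toContinuousLinearMap (boundaryCoord q)), fun v => ?_⟩
    rw [InnerProductSpace.toDual_symm_apply]
    rfl
  obtain ⟨w, hw⟩ := boundaryCoord_surjective (n := n) q 1
  have hpos : 0 < ‖e‖ := by
    rw [norm_pos_iff]
    rintro rfl
    have := he w
    rw [inner_zero_left, hw] at this
    exact zero_ne_one this
  have hee : boundaryCoord q e = ‖e‖ ^ 2 := by rw [← he e, real_inner_self_eq_norm_sq]
  refine ⟨‖e‖⁻¹ • e, ⟨?_, ?_, ?_⟩, ?_⟩
  · rw [norm_smul, norm_inv, norm_norm, inv_mul_cancel₀ hpos.ne']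
  · intro v hv
    rw [inner_smul_left, he v, LinearMap.mem_ker.1 hv, mul_zero]
  · rw [map_smul, hee, smul_eq_mul]
    positivity
  · rintro ν ⟨h1, h2, h3⟩
    have hd : ν - (boundaryCoord q ν / ‖e‖ ^ 2) • e ∈ boundaryTangent (n := n) q := by
      refine LinearMap.mem_ker.2 ?_
      rw [map_sub, map_smul, hee, smul_eq_mul, div_mul_cancel₀ _ (by positivity), sub_self]
    have h4 : ν = (boundaryCoord q ν / ‖e‖ ^ 2) • e := by
      rw [← sub_eq_zero, ← inner_self_eq_zero (𝕜 := ℝ)]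
      conv_lhs => rw [inner_sub_left, inner_smul_left]
      rw [h2 _ hd, he, LinearMap.mem_ker.1 hd]
      simp
    have h5 : boundaryCoord q ν / ‖e‖ ^ 2 = ‖e‖⁻¹ := by
      have h6 := congrArg norm h4
      rw [h1, norm_smul, Real.norm_of_nonneg (by positivity)] at h6
      field_simp at h6 ⊢
      linarith
    rw [h5] at h4
    exact h4

/-- The unit normal `ν_N` to `∂N` at `q ∈ ∂N` that points into `N`. -/
def inwardNormal (q : N) : TangentSpace (𝓡∂ (n + 1)) q :=
  (existsUnique_isInwardUnitNormal q).choose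

theorem isInwardUnitNormal_inwardNormal (q : N) :
    IsInwardUnitNormal (n := n) q (inwardNormal q) :=
  (existsUnique_isInwardUnitNormal q).choose_spec.1

/-! ### Principal curvatures of the boundary -/

variable [IsManifold (𝓡∂ (n + 1)) ∞ N]

/-- The metric in the preferred chart at `p`, evaluated on the constant coordinate vector fields
`u` and `v`: the function `y ↦ ∑ i j, g_ij(y) u_i v_j`. -/
def chartMetric (p : N) (u v : EuclideanSpace ℝ (Fin (n + 1)))
    (y : EuclideanSpace ℝ (Fin (n + 1))) : ℝ :=
  let x : N := (extChartAt (𝓡∂ (n + 1)) p).symm y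
  let T := trivializationAt (EuclideanSpace ℝ (Fin (n + 1)))
    (fun x : N => TangentSpace (𝓡∂ (n + 1)) x) p
  inner ℝ (T.symmL ℝ x u) (T.symmL ℝ x v)

/-- The derivative at `p`, in the direction `w`, of the coordinate metric `g(u, v)` of the
preferred chart at `p`. -/
def chartMetricDeriv (p : N) (w u v : EuclideanSpace ℝ (Fin (n + 1))) : ℝ :=
  fderivWithin ℝ (chartMetric p u v) (range (𝓡∂ (n + 1))) (extChartAt (𝓡∂ (n + 1)) p p) w

/-- The Christoffel symbols of the first kind of the Levi-Civita connection at `p`, in the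
preferred chart at `p`: `⟪∇_u v, w⟫`, where `u` and `v` are extended to vector fields with constant
coordinates. -/
def christoffel (p : N) (u v w : EuclideanSpace ℝ (Fin (n + 1))) : ℝ :=
  (chartMetricDeriv p u v w + chartMetricDeriv p v u w - chartMetricDeriv p w u v) / 2

/-- The second fundamental form of `∂N` at `p ∈ ∂N` with respect to the inward unit normal:
`B(u, v) = ⟪∇_u v, ν_N⟫` for `u`, `v` tangent to `∂N`.  (Since the preferred chart straightens the
boundary, the extension of `v` with constant coordinates is tangent to `∂N`.)  The boundary of a
Euclidean ball of radius `r` has `B(u, u) = |u|² / r`. -/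
def secondFundamentalForm (p : N) (u v : boundaryTangent (n := n) p) : ℝ :=
  christoffel p u.1 v.1 (inwardNormal p)

/-- The matrix of the second fundamental form in an orthonormal basis of the tangent space of
`∂N` at `p`. -/
def secondFundamentalMatrix (p : N) : Matrix (Fin n) (Fin n) ℝ :=
  let e := (stdOrthonormalBasis ℝ (boundaryTangent (n := n) p)).reindex
    (finCongr (finrank_boundaryTangent p))
  Matrix.of fun i j => secondFundamentalForm p (e i) (e j)

theorem christoffel_comm (p : N) (u v w : EuclideanSpace ℝ (Fin (n + 1))) :
    christoffel p u v w = christoffel p v u w := by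
  have h : chartMetric p u v = chartMetric p v u := by
    funext y
    exact real_inner_comm _ _
  rw [christoffel, christoffel, chartMetricDeriv, chartMetricDeriv, chartMetricDeriv,
    chartMetricDeriv, h]
  ring

theorem secondFundamentalMatrix_isHermitian (p : N) :
    (secondFundamentalMatrix (n := n) p).IsHermitian :=
  Matrix.IsHermitian.ext fun _ _ => christoffel_comm p _ _ _

/-- The principal curvatures `κ_1 ≤ … ≤ κ_n` of `∂N` at `p ∈ ∂N` with respect to the inward unit
normal, in increasing order and with multiplicity. -/
def principalCurvature (p : N) : Fin n → ℝ :=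
  let lam := (secondFundamentalMatrix_isHermitian (n := n) p).eigenvalues
  lam ∘ Tuple.sort lam

theorem principalCurvature_monotone (p : N) : Monotone (principalCurvature (n := n) p) :=
  Tuple.monotone_sort _

/-! ### The Grassmann bundle and varifolds -/

end

section

variable (n : ℕ) (N : Type*) [TopologicalSpace N]
  [ChartedSpace (EuclideanHalfSpace (n + 1)) N]

/-- The Grassmann bundle `G_m(N)`: pairs `(x, P)` of a point `x` of `N` and an `m`-dimensional
linear subspace `P` of the tangent space at `x`. -/
structure GrassmannBundle (m : ℕ) where
  base : N
  plane : Submodule ℝ (TangentSpace (𝓡∂ (n + 1)) base)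
  finrank_plane : Module.finrank ℝ plane = m

end

section

variable {n : ℕ} {N : Type*} [TopologicalSpace N]
  [ChartedSpace (EuclideanHalfSpace (n + 1)) N] [IsManifold (𝓡∂ (n + 1)) ∞ N]
  [RiemannianBundle (fun x : N => TangentSpace (𝓡∂ (n + 1)) x)] {m : ℕ}

/-- `(x, P)` viewed as the endomorphism "orthogonal projection onto `P`" of the tangent space
at `x`. -/
def GrassmannBundle.toHom (S : GrassmannBundle n N m) :
    Bundle.TotalSpace (EuclideanSpace ℝ (Fin (n + 1)) →L[ℝ] EuclideanSpace ℝ (Fin (n + 1)))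
      (fun x : N => TangentSpace (𝓡∂ (n + 1)) x →L[ℝ] TangentSpace (𝓡∂ (n + 1)) x) :=
  ⟨S.base, S.plane.starProjection⟩

/-- The usual topology of the Grassmann bundle, as a subspace of the bundle of endomorphisms of the
tangent spaces (a plane being identified with the orthogonal projection onto it). -/
instance : TopologicalSpace (GrassmannBundle n N m) :=
  TopologicalSpace.induced GrassmannBundle.toHom inferInstance

instance : MeasurableSpace (GrassmannBundle n N m) := borel _

instance : BorelSpace (GrassmannBundle n N m) := ⟨rfl⟩

theorem GrassmannBundle.continuous_base :
    Continuous (GrassmannBundle.base : GrassmannBundle n N m → N) := by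
  have h1 : Continuous (GrassmannBundle.toHom : GrassmannBundle n N m → _) :=
    continuous_induced_dom
  have h2 := FiberBundle.continuous_proj
    (EuclideanSpace ℝ (Fin (n + 1)) →L[ℝ] EuclideanSpace ℝ (Fin (n + 1)))
    (fun x : N => TangentSpace (𝓡∂ (n + 1)) x →L[ℝ] TangentSpace (𝓡∂ (n + 1)) x)
  exact h2.comp h1

variable (n N m) in
/-- An `m`-dimensional varifold in `N`: a Radon measure on the Grassmann bundle `G_m(N)`, i.e. a
Borel measure which is finite over every compact subset of `N` (the fibers of `G_m(N)` are compact,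
so this says exactly that it is finite on compact subsets of `G_m(N)`). -/
structure Varifold where
  measure : Measure (GrassmannBundle n N m)
  finite_of_isCompact : ∀ K : Set N, IsCompact K → measure (GrassmannBundle.base ⁻¹' K) < ⊤

/-- The weight measure `μ_V` of a varifold: its image under the projection of `G_m(N)` to `N`. -/
def Varifold.weight [MeasurableSpace N] (V : Varifold n N m) : Measure N :=
  V.measure.map GrassmannBundle.base

/-! ### First variation of area -/

/-- The `m`-dimensional Jacobian of a linear map `L : T_xN → T_yN` on an `m`-plane `P ⊆ T_xN`: the
factor `√(det ⟪L e_i, L e_j⟫)`, with `e` an orthonormal basis of `P`, by which `L` multiplies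
`m`-dimensional area in `P`. -/
def jacobian (S : GrassmannBundle n N m) {y : N}
    (L : TangentSpace (𝓡∂ (n + 1)) S.base →L[ℝ] TangentSpace (𝓡∂ (n + 1)) y) : ℝ :=
  let e := stdOrthonormalBasis ℝ S.plane
  Real.sqrt (Matrix.gram ℝ fun i => L (e i)).det

/-- The area of `f(V ∩ W)`, that is, the mass of the image under `f : N → N` of the restriction of
the varifold `V` to the set `W`. -/
def imageArea (f : N → N) (V : Varifold n N m) (W : Set N) : ℝ≥0∞ :=
  ∫⁻ S in GrassmannBundle.base ⁻¹' W,
    ENNReal.ofReal (jacobian S (mfderiv (𝓡∂ (n + 1)) (𝓡∂ (n + 1)) f S.base)) ∂V.measure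

/-- The support of a vector field. -/
def fieldSupport (X : (x : N) → TangentSpace (𝓡∂ (n + 1)) x) : Set N :=
  closure {x | X x ≠ 0}

/-- `φ` is the one-parameter family `t ∈ [0, ∞) ↦ φ_t` of maps of `N` into itself generated by `X`:
`φ_0` is the identity and `d/dt φ_t = X(φ_t)` for `t ≥ 0`.  (Values at `t < 0` are irrelevant.) -/
structure IsForwardFlow (X : (x : N) → TangentSpace (𝓡∂ (n + 1)) x) (φ : ℝ → N → N) : Prop where
  zero : φ 0 = id
  integralCurve : ∀ x, IsMIntegralCurveOn (I := 𝓡∂ (n + 1)) (fun t => φ t x) X (Ici 0)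

/-- `δ` is the first variation `δV(X)`: with `φ` the flow generated by `X`, it is the derivative at
`t = 0` (over `t ≥ 0`) of the area of `φ_t(V ∩ W)`, where `W` is any open set with compact closure
that contains the support of the compactly supported vector field `X`. -/
def HasFirstVariation (V : Varifold n N m) (X : (x : N) → TangentSpace (𝓡∂ (n + 1)) x)
    (δ : ℝ) : Prop :=
  ∃ φ : ℝ → N → N, IsForwardFlow X φ ∧
    ∀ W : Set N, IsOpen W → IsCompact (closure W) → fieldSupport X ⊆ W →
      HasDerivWithinAt (fun t => (imageArea (φ t) V W).toReal) δ (Ici 0) 0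

end

end RiemannianBoundary

end

open RiemannianBoundary

/-!
# A barrier field at a boundary point

The field is the gradient of a strictly convexified boundary coordinate, cut off near `p`.  In the
preferred chart at `p`, let `x₀` be the boundary coordinate and `u = x₀ + c |x - p|²`.  At `p` the
Hessian of `x₀`, restricted to the tangent space of the boundary, is `-|∇x₀|` times the second
fundamental form.  By Ky Fan's inequality (`sum_eigenvalues_le_sum_apply`) its trace on an `m`-plane
tangent to the boundary is therefore at most `-(κ₁ + ⋯ + κₘ) |∇x₀|`
(`sum_principalCurvature_mul_le`), which leaves room to choose `c > 0` and still have the trace of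
`∇²u` less than `-η |∇u|` on these planes.  The other `m`-planes are dealt with by a penalty: by
compactness of the set of orthonormal frames, `∇²u - k du²` has trace less than `-η |∇u|` on all
`m`-planes at points near `p`, for some `k` (`exists_penalized_trace_lt`).

Now let `X = φ(s₀ - u) ∇u` with `φ(s) = exp (-1 / s)` for `s > 0` and `φ = 0` otherwise.  The
covariant derivative of `X` is `φ ∇²u - φ' du²`, and `φ' ≥ k φ` on `(0, s₀]` once `s₀` is small.  So
the divergence of `X` on every `m`-plane is at most `-η |X|`.  As `u ≥ c |x - p|²` in the
half-space of the chart, the support of `X` is a small compact set (`exists_barrierField`).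

The rest of the argument shows that `X` generates a flow of `N` into itself and that the first
variation is the integral of the divergence of `X` on the planes.  In the half-space of the chart,
`X` is extended across the boundary by a retraction; the flow preserves the half-space since `X`
points inwards, and it is `C¹` in space up to the boundary, its derivative being the solution of the
linearized equation (`exists_isDifferentiableFlow`).  The Jacobian of the flow on an orthonormal
frame is the square root of a Gram determinant, so its derivative at time zero is half the trace of
the Lie derivative of the metric (`IsDifferentiableFlow.hasDerivWithinAt_sqrt_det_imageGram`).  The
Jacobians are continuous on the Grassmann bundle (`continuous_jacobian_chartFlow`) and Lipschitz in
time at zero, uniformly (`exists_abs_jacobian_chartFlow_sub_one_le`); hence dominated convergence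
gives the derivative of the area (`hasFirstVariation_integral`), and integration of the pointwise
bound gives the theorem.
-/

open Set MeasureTheory Bundle
open scoped Manifold ContDiff Topology ENNReal Bundle NNReal

noncomputable section

namespace RiemannianBoundary

/-! ### Flows on a half-space -/

section Flow

variable {E : Type*} [NormedAddCommGroup E] [NormedSpace ℝ E]

/-- A bounded Lipschitz vector field on a Banach space is complete. -/
theorem exists_globalFlow [CompleteSpace E] {X : E → E} {K : ℝ≥0} (hX : LipschitzWith K X) {C : ℝ}
    (hC : ∀ y, ‖X y‖ ≤ C) :
    ∃ Φ : ℝ → E → E, (∀ y, Φ 0 y = y) ∧ ∀ y t, HasDerivAt (fun s => Φ s y) (X (Φ t y)) t := by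
  have hex : ∀ (y : E) (k : ℕ), ∃ α : ℝ → E, α 0 = y ∧
      ∀ t ∈ Ioo (-((k : ℝ) + 1)) ((k : ℝ) + 1), HasDerivAt α (X (α t)) t := by
    intro y k
    have hk : (0 : ℝ) ≤ (k : ℝ) + 1 := by positivity
    have h0 : (0 : ℝ) ∈ Icc (-((k : ℝ) + 1)) ((k : ℝ) + 1) := ⟨by linarith, hk⟩
    have hP : IsPicardLindelof (fun _ => X) (⟨0, h0⟩ : Icc (-((k : ℝ) + 1)) ((k : ℝ) + 1)) y
        (C.toNNReal * ⟨(k : ℝ) + 1, hk⟩) 0 C.toNNReal K := by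
      refine IsPicardLindelof.of_time_independent (fun x _ => ?_) hX.lipschitzOnWith ?_
      · exact (hC x).trans (Real.le_coe_toNNReal C)
      · simp only [sub_zero, zero_sub, neg_neg, max_self, NNReal.coe_zero]
        exact le_rfl
    obtain ⟨α, h1, h2⟩ := hP.exists_eq_forall_mem_Icc_hasDerivWithinAt₀
    exact ⟨α, h1, fun t ht => (h2 t (Ioo_subset_Icc_self ht)).hasDerivAt (Icc_mem_nhds ht.1 ht.2)⟩
  choose α hα0 hα using hex
  have huniq : ∀ (y : E) (j k : ℕ), j ≤ k →
      EqOn (α y j) (α y k) (Ioo (-((j : ℝ) + 1)) ((j : ℝ) + 1)) := by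
    intro y j k hjk
    have hjk' : (j : ℝ) ≤ k := by exact_mod_cast hjk
    have hj : (0 : ℝ) ≤ j := by positivity
    refine ODE_solution_unique_of_mem_Ioo (v := fun _ => X) (s := fun _ => univ) (t₀ := 0)
      (fun _ _ => hX.lipschitzOnWith) ⟨by linarith, by linarith⟩
      (fun t ht => ⟨hα y j t ht, trivial⟩)
      (fun t ht => ⟨hα y k t ⟨by linarith [ht.1], by linarith [ht.2]⟩, trivial⟩) ?_
    rw [hα0, hα0]
  refine ⟨fun t y => α y ⌈|t|⌉₊ t, fun y => hα0 _ _, fun y t => ?_⟩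
  have hmem : ∀ s : ℝ, s ∈ Ioo (-((⌈|s|⌉₊ : ℝ) + 1)) ((⌈|s|⌉₊ : ℝ) + 1) := by
    intro s
    have h1 := Nat.le_ceil |s|
    constructor <;> linarith [neg_abs_le s, le_abs_self s]
  have hev : (fun s => α y ⌈|s|⌉₊ s) =ᶠ[𝓝 t] α y (⌈|t|⌉₊ + 1) := by
    have h1 : ∀ᶠ s : ℝ in 𝓝 t, |s| < |t| + 1 :=
      continuous_abs.continuousAt.eventually_lt continuousAt_const (by linarith)
    filter_upwards [h1] with s hs
    refine huniq y _ _ ?_ (hmem s)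
    rw [Nat.ceil_le]
    push_cast
    linarith [Nat.le_ceil |t|]
  have h2 : HasDerivAt (α y (⌈|t|⌉₊ + 1)) (X (α y (⌈|t|⌉₊ + 1) t)) t := by
    refine hα _ _ _ ?_
    have := hmem t
    push_cast
    constructor <;> linarith [this.1, this.2]
  have h3 := hev.eq_of_nhds
  simp only at h3 ⊢
  rw [h3]
  exact h2.congr_of_eventuallyEq hev

/-- A half-space is forward invariant under a field which points into it at all the points of the
complementary closed half-space. -/
theorem nonneg_of_integralCurve {X : E → E} {ℓ : E →L[ℝ] ℝ} (hX : ∀ y, ℓ y ≤ 0 → 0 ≤ ℓ (X y))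
    {γ : ℝ → E} (hγ : ∀ t, HasDerivAt γ (X (γ t)) t) (h0 : 0 ≤ ℓ (γ 0)) {t : ℝ} (ht : 0 ≤ t) :
    0 ≤ ℓ (γ t) := by
  have hd : ∀ s, HasDerivAt (fun s => ℓ (γ s)) (ℓ (X (γ s))) s := fun s =>
    ℓ.hasFDerivAt.comp_hasDerivAt s (hγ s)
  have hc : Continuous fun s => ℓ (γ s) :=
    continuous_iff_continuousAt.2 fun s => (hd s).continuousAt
  by_contra! hneg
  have hcpt : IsCompact (Icc 0 t ∩ {s | 0 ≤ ℓ (γ s)}) :=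
    isCompact_Icc.inter_right (isClosed_le continuous_const hc)
  obtain ⟨s, ⟨hs, hs0⟩, hmax⟩ := hcpt.exists_isGreatest ⟨0, ⟨le_rfl, ht⟩, h0⟩
  have hmono : MonotoneOn (fun s => ℓ (γ s)) (Icc s t) := by
    refine monotoneOn_of_deriv_nonneg (convex_Icc _ _) hc.continuousOn
      (fun r _ => (hd r).differentiableAt.differentiableWithinAt) fun r hr => ?_
    rw [interior_Icc] at hr
    rw [(hd r).deriv]
    refine hX _ ?_
    by_contra! hpos
    exact absurd (hmax ⟨⟨hs.1.trans hr.1.le, hr.2.le⟩, hpos.le⟩) (not_le.2 hr.1)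
  have := hmono (left_mem_Icc.2 hs.2) (right_mem_Icc.2 hs.2) hs.2
  exact absurd (hs0.out.trans this) (not_le.2 hneg)

variable {F : Type*} [NormedAddCommGroup F] [NormedSpace ℝ F]

theorem fderivWithin_eq_zero_of_support {f : E → F} {H K : Set E} (hK : IsCompact K)
    (h0 : ∀ y ∈ H \ K, f y = 0) {y : E} (hy : y ∈ H \ K) : fderivWithin ℝ f H y = 0 := by
  have h1 : f =ᶠ[𝓝[H] y] fun _ => 0 := by
    filter_upwards [self_mem_nhdsWithin,
      mem_nhdsWithin_of_mem_nhds (hK.isClosed.isOpen_compl.mem_nhds hy.2)] with z hz hz'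
    exact h0 z ⟨hz, hz'⟩
  rw [h1.fderivWithin_eq (h0 y hy)]
  simp

theorem exists_bound_of_support {E F : Type*} [TopologicalSpace E] [NormedAddCommGroup F]
    {f : E → F} {H K : Set E} (hK : IsCompact K) (hKH : K ⊆ H)
    (h0 : ∀ y ∈ H \ K, f y = 0) (hf : ContinuousOn f H) : ∃ C : ℝ≥0, ∀ y ∈ H, ‖f y‖ ≤ C := by
  obtain ⟨C, hC⟩ := hK.exists_bound_of_continuousOn (hf.mono hKH)
  refine ⟨C.toNNReal, fun y hy => ?_⟩
  by_cases hyK : y ∈ K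
  · exact (hC y hyK).trans (Real.le_coe_toNNReal C)
  · rw [h0 y ⟨hy, hyK⟩, norm_zero]
    positivity

theorem exists_lipschitzOnWith_of_support {f : E → F} {H K : Set E} (hK : IsCompact K)
    (hKH : K ⊆ H) (hH : Convex ℝ H) (hu : UniqueDiffOn ℝ H) (h0 : ∀ y ∈ H \ K, f y = 0)
    (hf : ContDiffOn ℝ 1 f H) :
    ∃ C : ℝ≥0, LipschitzOnWith C f H ∧ ∀ y ∈ H, ‖fderivWithin ℝ f H y‖ ≤ C := by
  obtain ⟨C, hC⟩ := exists_bound_of_support hK hKH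
    (fun y hy => fderivWithin_eq_zero_of_support hK h0 hy)
    (hf.continuousOn_fderivWithin hu le_rfl)
  exact ⟨C, hH.lipschitzOnWith_of_nnnorm_fderivWithin_le (hf.differentiableOn one_ne_zero)
    (fun y hy => hC y hy), hC⟩

/-- Taylor's estimate for a map with Lipschitz derivative on a convex set. -/
theorem norm_sub_sub_fderivWithin_le {X : E → F} {H : Set E} (hH : Convex ℝ H)
    (hX : DifferentiableOn ℝ X H) {M : ℝ≥0} (hM : LipschitzOnWith M (fderivWithin ℝ X H) H)
    {y z : E} (hy : y ∈ H) (hz : z ∈ H) :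
    ‖X z - X y - fderivWithin ℝ X H y (z - y)‖ ≤ M * ‖z - y‖ * ‖z - y‖ := by
  have hsub : segment ℝ y z ⊆ H := hH.segment_subset hy hz
  refine (convex_segment y z).norm_image_sub_le_of_norm_hasFDerivWithin_le'
    (fun x hx => ((hX x (hsub hx)).hasFDerivWithinAt).mono hsub) (fun x hx => ?_)
    (left_mem_segment ℝ y z) (right_mem_segment ℝ y z)
  refine (hM.norm_sub_le (hsub hx) hy).trans ?_
  gcongr
  have h1 : x ∈ Metric.closedBall y ‖z - y‖ := by
    refine (convex_closedBall y ‖z - y‖).segment_subset (by simp) ?_ hx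
    simp [dist_eq_norm]
  simpa [dist_eq_norm] using h1

/-- A version of Grönwall's inequality for curves starting at `0`, with a bound that is linear in
the error term. -/
theorem norm_le_mul_of_norm_deriv_le {f f' : ℝ → F} {K ε T : ℝ} (hK : 0 < K) (hε : 0 ≤ ε)
    (hf : ∀ t ∈ Icc 0 T, HasDerivWithinAt f (f' t) (Icc 0 T) t) (h0 : f 0 = 0)
    (bound : ∀ t ∈ Icc 0 T, ‖f' t‖ ≤ K * ‖f t‖ + ε) :
    ∀ t ∈ Icc 0 T, ‖f t‖ ≤ Real.exp (K * T) / K * ε := by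
  intro t ht
  have h1 := norm_le_gronwallBound_of_norm_deriv_right_le (δ := 0) (K := K) (ε := ε)
    (fun t ht => (hf t ht).continuousWithinAt)
    (fun t ht => ((hf t (Ico_subset_Icc_self ht)).mono_of_mem_nhdsWithin
      (Icc_mem_nhdsGE_of_mem ht)))
    (by rw [h0, norm_zero]) (fun t ht => bound t (Ico_subset_Icc_self ht)) t ht
  refine h1.trans ?_
  rw [gronwallBound_of_K_ne_0 hK.ne']
  simp only [zero_mul, zero_add, sub_zero]
  have h2 : Real.exp (K * t) ≤ Real.exp (K * T) :=
    Real.exp_le_exp.2 (mul_le_mul_of_nonneg_left ht.2 hK.le)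
  calc ε / K * (Real.exp (K * t) - 1) ≤ ε / K * Real.exp (K * T) := by gcongr; linarith
    _ = _ := by ring

/-- Existence, for a short time that depends only on the bound on the coefficients, of the
fundamental solution of a linear differential equation. -/
theorem exists_fundamentalSolution [CompleteSpace F] {L : ℝ≥0} {T : ℝ} (hT : 0 ≤ T)
    (hLT : 2 * L * T ≤ 1)
    {b : ℝ → F →L[ℝ] F} (hb : ContinuousOn b (Icc 0 T)) (hbL : ∀ t ∈ Icc 0 T, ‖b t‖ ≤ L) :
    ∃ A : ℝ → F →L[ℝ] F, A 0 = 1 ∧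
      ∀ t ∈ Icc 0 T, HasDerivWithinAt A (b t ∘L A t) (Icc 0 T) t := by
  have h0 : (0 : ℝ) ∈ Icc 0 T := ⟨le_rfl, hT⟩
  have hP : IsPicardLindelof (fun t (A : F →L[ℝ] F) => b t ∘L A) (⟨0, h0⟩ : Icc 0 T) 1
      1 0 (2 * L) L := by
    refine ⟨fun t ht => ?_, fun A _ => hb.clm_comp continuousOn_const, fun t ht A hA => ?_, ?_⟩
    · refine LipschitzOnWith.of_dist_le_mul fun A _ B _ => ?_
      rw [dist_eq_norm, dist_eq_norm, ← ContinuousLinearMap.comp_sub]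
      exact (ContinuousLinearMap.opNorm_comp_le _ _).trans (by gcongr; exact hbL t ht)
    · refine (ContinuousLinearMap.opNorm_comp_le _ _).trans ?_
      have h1 : ‖A‖ ≤ 2 := by
        have h2 : ‖A - 1‖ ≤ 1 := by simpa [dist_eq_norm] using hA
        have h3 : ‖(1 : F →L[ℝ] F)‖ ≤ 1 := ContinuousLinearMap.norm_id_le
        calc ‖A‖ = ‖(A - 1) + 1‖ := by rw [sub_add_cancel]
          _ ≤ ‖A - 1‖ + ‖(1 : F →L[ℝ] F)‖ := norm_add_le _ _
          _ ≤ 2 := by linarith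
      have h2 := hbL t ht
      push_cast
      rw [mul_comm (2 : ℝ)]
      gcongr
    · simp [max_eq_left hT]
      linarith
  exact hP.exists_eq_forall_mem_Icc_hasDerivWithinAt₀

/-- `Φ` is a forward flow of the vector field `X` in `H` which is stationary at the zeros of `X`
and preserves `K`, and its space derivative `A` exists and is continuous up to the time `T`.  All
derivatives in space are one-sided at the boundary of `H`, and `C` bounds the speed of `A`. -/
structure IsDifferentiableFlow (X : E → E) (H K : Set E) (T C : ℝ) (Φ : ℝ → E → E)
    (A : ℝ → E → E →L[ℝ] E) : Prop where
  zero : ∀ y, Φ 0 y = y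
  mem : ∀ y ∈ H, ∀ t, 0 ≤ t → Φ t y ∈ H
  hasDerivAt : ∀ y ∈ H, ∀ t, 0 ≤ t → HasDerivAt (fun s => Φ s y) (X (Φ t y)) t
  fixed : ∀ y ∈ H, X y = 0 → ∀ t, Φ t y = y
  mem_support : ∀ y ∈ K, ∀ t, 0 ≤ t → Φ t y ∈ K
  pos : 0 < T
  hasFDerivWithinAt : ∀ t ∈ Icc 0 T, ∀ y ∈ H, HasFDerivWithinAt (Φ t) (A t y) H y
  continuousOn_fderiv : ∀ t ∈ Icc 0 T, ContinuousOn (A t) H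
  fderiv_zero : ∀ y ∈ H, A 0 y = 1
  hasDerivWithinAt_fderiv : ∀ y ∈ H,
    HasDerivWithinAt (fun t => A t y) (fderivWithin ℝ X H y) (Ici 0) 0
  norm_fderiv_sub_le : ∀ t ∈ Icc 0 T, ∀ y ∈ H, ‖A t y - 1‖ ≤ C * t

/-- A compactly supported `C²` vector field on a closed half-space which points into the half-space
at the boundary generates a forward flow that is `C¹` in space, up to the boundary. -/
theorem exists_isDifferentiableFlow [CompleteSpace E] {X : E → E} (ℓ : E →L[ℝ] ℝ) {e : E}
    (he : ℓ e = 1) {K : Set E} (hK : IsCompact K) (hKH : K ⊆ {y | 0 ≤ ℓ y})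
    (hX : ContDiffOn ℝ 2 X {y | 0 ≤ ℓ y}) (h0 : ∀ y ∈ {y | 0 ≤ ℓ y} \ K, X y = 0)
    (hin : ∀ y, ℓ y = 0 → 0 ≤ ℓ (X y)) :
    ∃ T C Φ A, IsDifferentiableFlow X {y | 0 ≤ ℓ y} K T C Φ A := by
  set H : Set E := {y | 0 ≤ ℓ y} with hHdef
  have hH : Convex ℝ H := convex_halfSpace_ge ℓ.isLinear 0
  have hu : UniqueDiffOn ℝ H := by
    refine uniqueDiffOn_convex hH ⟨e, mem_interior.2 ⟨{y | 0 < ℓ y},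
      fun y hy => (show 0 ≤ ℓ y from hy.out.le), isOpen_lt continuous_const ℓ.continuous, ?_⟩⟩
    simp [he]
  -- `X` and its derivative `B` are bounded and Lipschitz, being supported in the compact set `K`
  obtain ⟨C₀, hC₀⟩ := exists_bound_of_support hK hKH h0 hX.continuousOn
  obtain ⟨L₀, hL₀, hB₀⟩ := exists_lipschitzOnWith_of_support hK hKH hH hu h0
    (hX.of_le (by norm_num))
  obtain ⟨M, hM, -⟩ := exists_lipschitzOnWith_of_support hK hKH hH hu
    (fun y hy => fderivWithin_eq_zero_of_support hK h0 hy)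
    (hX.fderivWithin hu (m := 1) (by norm_num))
  set B : E → E →L[ℝ] E := fderivWithin ℝ X H with hBdef
  obtain ⟨L, hLpos, hL, hB⟩ : ∃ L : ℝ≥0, 0 < L ∧ LipschitzOnWith L X H ∧ ∀ y ∈ H, ‖B y‖ ≤ L :=
    ⟨L₀ + 1, by positivity, hL₀.weaken (by simp), fun y hy => (hB₀ y hy).trans (by simp)⟩
  -- the retraction along `e` onto `H` extends `X` to a bounded Lipschitz field on `E`, which on
  -- the complement of `H` takes the values of `X` at boundary points and so points towards `H`
  set retr : E → E := fun y => y + (max (-ℓ y) 0) • e with hr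
  have hrid : ∀ y ∈ H, retr y = y := by
    intro y hy
    simp [hr, max_eq_right (neg_nonpos.2 hy.out)]
  have hrℓ : ∀ y, ℓ (retr y) = max (ℓ y) 0 := by
    intro y
    simp only [hr, map_add, map_smul, he, smul_eq_mul, mul_one]
    rcases le_total (ℓ y) 0 with h | h
    · rw [max_eq_left (by linarith), max_eq_right h]; ring
    · rw [max_eq_right (by linarith), max_eq_left h]; ring
  have hrH : ∀ y, retr y ∈ H := fun y => by
    change 0 ≤ ℓ (retr y)
    rw [hrℓ]
    exact le_max_right _ _
  have hrlip : ∃ Kr : ℝ≥0, LipschitzWith Kr retr := by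
    have h1 : LipschitzWith _ fun y : E => max (-ℓ y) 0 := (ℓ.lipschitz.neg).max_const 0
    have h2 : LipschitzWith _ fun y : E => (max (-ℓ y) 0) • e :=
      ((ContinuousLinearMap.toSpanSingleton ℝ e).lipschitz).comp h1
    exact ⟨_, LipschitzWith.id.add h2⟩
  obtain ⟨Kr, hrlip⟩ := hrlip
  have hXr : LipschitzWith (L * Kr) (X ∘ retr) := by
    have := hL.comp (hrlip.lipschitzOnWith (s := univ)) (fun y _ => hrH y)
    exact lipschitzOnWith_univ.1 this
  obtain ⟨Φ, hΦ0, hΦ⟩ := exists_globalFlow hXr (C := C₀) fun y => hC₀ _ (hrH y)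
  have hmem : ∀ y ∈ H, ∀ t, 0 ≤ t → Φ t y ∈ H := by
    intro y hy t ht
    refine nonneg_of_integralCurve (X := X ∘ retr) (fun z hz => hin _ ?_) (hΦ y) ?_ ht
    · rw [hrℓ, max_eq_right hz]
    · rw [hΦ0]; exact hy
  have hΦd : ∀ y ∈ H, ∀ t, 0 ≤ t → HasDerivAt (fun s => Φ s y) (X (Φ t y)) t := by
    intro y hy t ht
    have := hΦ y t
    rwa [Function.comp_apply, hrid _ (hmem y hy t ht)] at this
  -- by uniqueness, a zero of `X` is never reached from another point
  have hconst : ∀ y, ∀ z ∈ H, X z = 0 → ∀ t, Φ t y = z → ∀ s, Φ s y = z := by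
    intro y z hz hz0 t htz s
    refine congrFun (ODE_solution_unique_univ (v := fun _ => X ∘ retr) (s := fun _ => univ)
      (t₀ := t) (fun _ => hXr.lipschitzOnWith) (fun r => ⟨hΦ y r, trivial⟩) (g := fun _ => z)
      (fun r => ⟨?_, trivial⟩) htz) s
    rw [Function.comp_apply, hrid z hz, hz0]
    exact hasDerivAt_const r z
  -- the space derivative solves the linearized equation `A' = B(Φ) A`; the time `T` is so short
  -- that the solution stays within distance `1` of the identity
  set T : ℝ := 1 / (2 * L) with hT
  have hLpos' : (0 : ℝ) < L := by exact_mod_cast hLpos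
  have hTpos : 0 < T := by positivity
  have hLT : 2 * L * T ≤ 1 := by rw [hT]; field_simp; exact le_rfl
  have hΦc : ∀ y ∈ H, ContinuousOn (fun t => Φ t y) (Icc 0 T) := fun y hy t ht =>
    (hΦd y hy t ht.1).continuousAt.continuousWithinAt
  have hAex : ∀ y : E, ∃ A : ℝ → E →L[ℝ] E, y ∈ H → A 0 = 1 ∧
      ∀ t ∈ Icc 0 T, HasDerivWithinAt A (B (Φ t y) ∘L A t) (Icc 0 T) t := by
    intro y
    by_cases hy : y ∈ H
    · obtain ⟨A, hA⟩ := exists_fundamentalSolution (b := fun t => B (Φ t y)) hTpos.le hLT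
        (hM.continuousOn.comp (hΦc y hy) fun t ht => hmem y hy t ht.1)
        fun t ht => hB _ (hmem y hy t ht.1)
      exact ⟨A, fun _ => hA⟩
    · exact ⟨0, fun h => absurd h hy⟩
  choose A' hA' using hAex
  set G : ℝ := Real.exp (L * T) with hG
  have hAnorm : ∀ y ∈ H, ∀ t ∈ Icc 0 T, ‖A' y t‖ ≤ G := by
    intro y hy t ht
    obtain ⟨hA0, hA⟩ := hA' y hy
    have h1 := norm_le_gronwallBound_of_norm_deriv_right_le (δ := 1) (K := L) (ε := 0)
      (fun t ht => (hA t ht).continuousWithinAt)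
      (fun t ht => ((hA t (Ico_subset_Icc_self ht)).mono_of_mem_nhdsWithin
        (Icc_mem_nhdsGE_of_mem ht)))
      (by rw [hA0]; exact ContinuousLinearMap.norm_id_le)
      (fun t ht => by
        rw [add_zero]
        exact (ContinuousLinearMap.opNorm_comp_le _ _).trans
          (by gcongr; exact hB _ (hmem y hy t ht.1))) t ht
    refine h1.trans ?_
    rw [gronwallBound_ε0, one_mul, sub_zero, hG]
    exact Real.exp_le_exp.2 (mul_le_mul_of_nonneg_left ht.2 hLpos'.le)
  have hG0 : 0 < G := Real.exp_pos _
  have hdist : ∀ y ∈ H, ∀ z ∈ H, ∀ t ∈ Icc 0 T, ‖Φ t z - Φ t y‖ ≤ G * ‖z - y‖ := by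
    intro y hy z hz t ht
    have h1 := dist_le_of_trajectories_ODE_of_mem (v := fun _ => X) (s := fun _ => H) (K := L)
      (fun _ _ => hL) (hΦc z hz) (fun s hs => (hΦd z hz s hs.1).hasDerivWithinAt)
      (fun s hs => hmem z hz s hs.1) (hΦc y hy)
      (fun s hs => (hΦd y hy s hs.1).hasDerivWithinAt) (fun s hs => hmem y hy s hs.1) le_rfl t ht
    rw [dist_eq_norm, dist_eq_norm, hΦ0, hΦ0, sub_zero, mul_comm] at h1
    refine h1.trans ?_
    gcongr
    exact Real.exp_le_exp.2 (mul_le_mul_of_nonneg_left ht.2 hLpos'.le)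
  have hderiv : ∀ t ∈ Icc 0 T, ∀ y ∈ H, HasFDerivWithinAt (Φ t) (A' y t) H y := by
    intro t ht y hy
    obtain ⟨hA0, hA⟩ := hA' y hy
    -- the error of the linear approximation solves the linearized equation up to a quadratic term
    have hquad : ∀ z ∈ H, ‖Φ t z - Φ t y - A' y t (z - y)‖ ≤
        (G / L * (M * G * G)) * (‖z - y‖ * ‖z - y‖) := by
      intro z hz
      have h1 := norm_le_mul_of_norm_deriv_le (K := L) (T := T)
        (ε := M * (G * ‖z - y‖) * (G * ‖z - y‖))
        (f := fun t => Φ t z - Φ t y - A' y t (z - y))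
        (f' := fun t => X (Φ t z) - X (Φ t y) - (B (Φ t y) ∘L A' y t) (z - y))
        hLpos' (by positivity)
        (fun t ht => (((hΦd z hz t ht.1).hasDerivWithinAt).sub
          ((hΦd y hy t ht.1).hasDerivWithinAt)).sub
            ((hA t ht).clm_apply (hasDerivWithinAt_const _ _ _) |>.congr_deriv (by simp)))
        (by simp [hΦ0, hA0])
        (fun t ht => by
          have h2 : X (Φ t z) - X (Φ t y) - (B (Φ t y) ∘L A' y t) (z - y) =
              B (Φ t y) (Φ t z - Φ t y - A' y t (z - y)) +
              (X (Φ t z) - X (Φ t y) - B (Φ t y) (Φ t z - Φ t y)) := by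
            simp only [map_sub, ContinuousLinearMap.comp_apply]
            abel
          rw [h2]
          refine (norm_add_le _ _).trans (add_le_add ?_ ?_)
          · exact (B (Φ t y)).le_of_opNorm_le (hB _ (hmem y hy t ht.1)) _
          · refine (norm_sub_sub_fderivWithin_le hH (hX.differentiableOn (by norm_num)) hM
              (hmem y hy t ht.1) (hmem z hz t ht.1)).trans ?_
            gcongr <;> exact hdist y hy z hz t ht) t ht
      refine h1.trans (le_of_eq ?_)
      ring
    refine HasFDerivWithinAt.of_isLittleO ?_
    refine Asymptotics.IsBigO.trans_isLittleO (g := fun z => ‖z - y‖ * ‖z - y‖)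
      (Asymptotics.IsBigO.of_bound (G / L * (M * G * G)) ?_) ?_
    · filter_upwards [self_mem_nhdsWithin] with z hz
      rw [Real.norm_of_nonneg (by positivity)]
      exact hquad z hz
    · have h1 : Filter.Tendsto (fun z : E => ‖z - y‖) (𝓝[H] y) (𝓝 0) := by
        have : ContinuousAt (fun z : E => ‖z - y‖) y := by fun_prop
        simpa using this.tendsto.mono_left (nhdsWithin_le_nhds (s := H))
      have h2 := ((Asymptotics.isLittleO_one_iff ℝ).2 h1).mul_isBigO
        (Asymptotics.isBigO_refl (fun z : E => ‖z - y‖) (𝓝[H] y))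
      simp only [one_mul] at h2
      exact h2.of_norm_right
  have hcont : ∀ t ∈ Icc 0 T, ContinuousOn (fun y => A' y t) H := by
    intro t ht
    refine LipschitzOnWith.continuousOn (K := ⟨G / L * (M * G * G), by positivity⟩)
      (LipschitzOnWith.of_dist_le_mul fun z hz y hy => ?_)
    obtain ⟨hA0, hA⟩ := hA' y hy
    obtain ⟨hA0z, hAz⟩ := hA' z hz
    have h1 := norm_le_mul_of_norm_deriv_le (K := L) (T := T) (ε := M * (G * ‖z - y‖) * G)
      (f := fun t => A' z t - A' y t)
      (f' := fun t => B (Φ t z) ∘L A' z t - B (Φ t y) ∘L A' y t)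
      hLpos' (by positivity) (fun t ht => (hAz t ht).sub (hA t ht)) (by simp [hA0, hA0z])
      (fun t ht => by
        have h2 : B (Φ t z) ∘L A' z t - B (Φ t y) ∘L A' y t =
            B (Φ t z) ∘L (A' z t - A' y t) + (B (Φ t z) - B (Φ t y)) ∘L A' y t := by
          rw [ContinuousLinearMap.comp_sub, ContinuousLinearMap.sub_comp]
          abel
        rw [h2]
        refine (norm_add_le _ _).trans (add_le_add ?_ ?_)
        · exact (ContinuousLinearMap.opNorm_comp_le _ _).trans
            (by gcongr; exact hB _ (hmem z hz t ht.1))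
        · refine (ContinuousLinearMap.opNorm_comp_le _ _).trans ?_
          gcongr
          · exact (hM.norm_sub_le (hmem z hz t ht.1) (hmem y hy t ht.1)).trans
              (by gcongr; exact hdist y hy z hz t ht)
          · exact hAnorm y hy t ht) t ht
    rw [dist_eq_norm, dist_eq_norm]
    refine h1.trans (le_of_eq ?_)
    change _ = G / L * (M * G * G) * ‖z - y‖
    ring
  refine ⟨T, L * G, Φ, fun t y => A' y t, hΦ0, hmem, hΦd,
    fun y hy hy0 t => hconst y y hy hy0 0 (hΦ0 y) t, fun y hy t ht => ?_, hTpos, hderiv, hcont,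
    fun y hy => (hA' y hy).1, fun y hy => ?_, fun t ht y hy => ?_⟩
  · by_contra hn
    have h1 := hconst y _ (hmem y (hKH hy) t ht) (h0 _ ⟨hmem y (hKH hy) t ht, hn⟩) t rfl 0
    rw [hΦ0] at h1
    exact hn (h1 ▸ hy)
  · obtain ⟨hA0, hA⟩ := hA' y hy
    have h1 := hA 0 ⟨le_rfl, hTpos.le⟩
    rw [hA0, hΦ0] at h1
    exact h1.mono_of_mem_nhdsWithin (Icc_mem_nhdsGE hTpos)
  · obtain ⟨hA0, hA⟩ := hA' y hy
    have h1 := norm_image_sub_le_of_norm_deriv_le_segment' (f := fun t => A' y t) (a := 0)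
      (b := T) (C := L * G) hA
      (fun s hs => by
        refine (ContinuousLinearMap.opNorm_comp_le _ _).trans ?_
        gcongr
        · exact hB _ (hmem y hy s hs.1)
        · exact hAnorm y hy s (Ico_subset_Icc_self hs)) t ht
    simpa [hA0] using h1

end Flow

/-! ### Volume factors of linear maps -/

section LinearAlgebra

variable {ι : Type*} [Fintype ι] [DecidableEq ι]

theorem of_ite_eq_one {ι : Type*} [DecidableEq ι] :
    Matrix.of (fun i j : ι => if i = j then (1 : ℝ) else 0) = 1 := by
  ext i j
  simp [Matrix.one_apply]

/-- The derivative at the identity of the volume factor `M ↦ √(det M)` is half the trace. -/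
theorem hasFDerivAt_sqrt_det_one :
    HasFDerivAt (fun M : ι → ι → ℝ => √(Matrix.of M).det)
      ((1 / 2 : ℝ) • ∑ i, (ContinuousLinearMap.proj i : (ι → ℝ) →L[ℝ] ℝ) ∘L
        (ContinuousLinearMap.proj i : (ι → ι → ℝ) →L[ℝ] (ι → ℝ)))
      (fun i j => if i = j then 1 else 0) := by
  set I₀ : ι → ι → ℝ := fun i j => if i = j then 1 else 0 with hI₀
  have hI : Matrix.of I₀ = 1 := of_ite_eq_one
  have hdiff : DifferentiableAt ℝ (fun M : ι → ι → ℝ => (Matrix.of M).det) I₀ := by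
    simp only [Matrix.det_apply, Matrix.of_apply]
    fun_prop
  have hdet : HasFDerivAt (fun M : ι → ι → ℝ => (Matrix.of M).det)
      (∑ i, (ContinuousLinearMap.proj i : (ι → ℝ) →L[ℝ] ℝ) ∘L
        (ContinuousLinearMap.proj i : (ι → ι → ℝ) →L[ℝ] (ι → ℝ))) I₀ := by
    refine hdiff.hasFDerivAt.congr_fderiv ?_
    ext1 N
    -- compare the two derivatives along the line `r ↦ 1 + r N`
    have h1 : HasDerivAt (fun r : ℝ => I₀ + r • N) N 0 := by
      have := ((hasDerivAt_id (0 : ℝ)).smul_const N).const_add I₀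
      simpa using this
    have h2 := HasFDerivAt.comp_hasDerivAt (0 : ℝ) (f := fun r : ℝ => I₀ + r • N)
      (l := fun M : ι → ι → ℝ => (Matrix.of M).det)
      (l' := fderiv ℝ (fun M : ι → ι → ℝ => (Matrix.of M).det) I₀)
      (by simpa using hdiff.hasFDerivAt) h1
    have h3 : HasDerivAt ((fun M : ι → ι → ℝ => (Matrix.of M).det) ∘ fun r : ℝ => I₀ + r • N)
        (Matrix.of N).trace 0 := by
      have h4 : ((fun M : ι → ι → ℝ => (Matrix.of M).det) ∘ fun r : ℝ => I₀ + r • N) =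
          fun r : ℝ => Polynomial.eval r
            (1 + (Polynomial.X : Polynomial ℝ) • (Matrix.of N).map Polynomial.C).det := by
        funext r
        have h5 : Matrix.of (I₀ + r • N) = 1 + r • Matrix.of N := by
          rw [← hI]; rfl
        simp only [Function.comp_apply, h5]
        rw [← Polynomial.coe_evalRingHom, RingHom.map_det]
        congr 1
        ext i j
        rcases eq_or_ne i j with rfl | hij
        · simp [mul_comm (N i i)]
        · simp [hij, mul_comm (N i j)]
      rw [h4, ← Matrix.derivative_det_one_add_X_smul]
      exact Polynomial.hasDerivAt _ _
    rw [h2.unique h3]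
    simp [Matrix.trace]
  refine (hdet.sqrt (by rw [hI]; simp)).congr_fderiv ?_
  rw [hI]
  simp

/-- The derivative of the volume factor along a curve of Gram matrices issuing from the
identity. -/
theorem hasDerivWithinAt_sqrt_det {M : ℝ → ι → ι → ℝ} {N : ι → ι → ℝ} {s : Set ℝ}
    (h0 : M 0 = fun i j => if i = j then 1 else 0)
    (hM : ∀ i j, HasDerivWithinAt (fun t => M t i j) (N i j) s 0) :
    HasDerivWithinAt (fun t => √(Matrix.of (M t)).det) ((1 / 2) * ∑ i, N i i) s 0 := by
  have h1 : HasDerivWithinAt M N s 0 :=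
    hasDerivWithinAt_pi.2 fun i => hasDerivWithinAt_pi.2 fun j => hM i j
  have h2 := hasFDerivAt_sqrt_det_one (ι := ι)
  rw [← h0] at h2
  refine (h2.comp_hasDerivWithinAt 0 h1).congr_deriv ?_
  simp

variable (ι) in
theorem exists_abs_sqrt_det_sub_one_le :
    ∃ ρ > 0, ∃ c : ℝ, ∀ ε, 0 ≤ ε → ε < ρ → ∀ M : ι → ι → ℝ,
      (∀ i j, |M i j - if i = j then 1 else 0| ≤ ε) → |√(Matrix.of M).det - 1| ≤ c * ε := by
  obtain ⟨c, hc⟩ := (hasFDerivAt_sqrt_det_one (ι := ι)).isBigO_sub.bound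
  obtain ⟨ρ, hρ, h⟩ := Metric.eventually_nhds_iff.1 hc
  refine ⟨ρ, hρ, max c 0, fun ε h0 hε M hM => ?_⟩
  have h1 : ‖M - fun i j => if i = j then 1 else 0‖ ≤ ε :=
    (pi_norm_le_iff_of_nonneg h0).2 fun i => (pi_norm_le_iff_of_nonneg h0).2 fun j => hM i j
  have h2 := h (y := M) (by rw [dist_eq_norm]; exact h1.trans_lt hε)
  rw [of_ite_eq_one, Matrix.det_one, Real.sqrt_one, Real.norm_eq_abs] at h2
  refine h2.trans ?_
  calc c * _ ≤ max c 0 * ‖M - fun i j => if i = j then 1 else 0‖ := by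
        gcongr; exact le_max_left _ _
    _ ≤ _ := by gcongr

/-- The Gram determinant of the image of a family in a subspace, in terms of the image of an
orthonormal basis. -/
theorem det_gram_map {V W : Type*} [NormedAddCommGroup V] [InnerProductSpace ℝ V]
    [NormedAddCommGroup W] [InnerProductSpace ℝ W] {P : Submodule ℝ V}
    (e : OrthonormalBasis ι ℝ P) (L : V →ₗ[ℝ] W) (f : ι → P) :
    (Matrix.gram ℝ fun i => L (f i)).det =
      (Matrix.gram ℝ f).det * (Matrix.gram ℝ fun i => L (e i)).det := by
  set A : Matrix ι ι ℝ := Matrix.of fun i k => inner ℝ (e k) (f i) with hA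
  have hf : ∀ i, f i = ∑ k, A i k • e k := fun i => (e.sum_repr' (f i)).symm
  have h1 : Matrix.gram ℝ (fun i => L (f i)) =
      A * Matrix.gram ℝ (fun i => L (e i)) * A.transpose := by
    ext i j
    have h2 : ∀ i, L (f i) = ∑ k, A i k • L (e k) := by
      intro i
      conv_lhs => rw [hf i]
      simp
    rw [Matrix.gram_apply, h2 i, h2 j]
    simp only [Matrix.mul_apply, Matrix.transpose_apply, Matrix.gram_apply, sum_inner, inner_sum,
      real_inner_smul_left, real_inner_smul_right, Finset.sum_mul]
    refine Finset.sum_congr rfl fun k _ => Finset.sum_congr rfl fun l _ => ?_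
    ring
  have h3 : Matrix.gram ℝ f = A * A.transpose := by
    ext i j
    rw [Matrix.gram_apply, ← e.sum_inner_mul_inner]
    simp only [Matrix.mul_apply, Matrix.transpose_apply, hA, Matrix.of_apply]
    refine Finset.sum_congr rfl fun k _ => ?_
    rw [real_inner_comm]
  rw [h1, h3]
  simp only [Matrix.det_mul, Matrix.det_transpose]
  ring

/-! ### Sums of eigenvalues -/

/-- Among all weights in `[0, 1]` of total mass `m`, the weighted sum of an increasing sequence is
least when the weights are concentrated on the first `m` terms. -/
theorem sum_castLE_le_sum_mul {n m : ℕ} (hm : m ≤ n) {lam : Fin n → ℝ} (hlam : Monotone lam)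
    {w : Fin n → ℝ} (h0 : ∀ j, 0 ≤ w j) (h1 : ∀ j, w j ≤ 1) (hw : ∑ j, w j = m) :
    ∑ i : Fin m, lam (Fin.castLE hm i) ≤ ∑ j, lam j * w j := by
  have hsum : ∀ f : Fin n → ℝ, ∑ i : Fin m, f (Fin.castLE hm i) =
      ∑ j, f j * if (j : ℕ) < m then 1 else 0 := by
    intro f
    simp only [mul_ite, mul_one, mul_zero]
    rw [← Finset.sum_filter]
    have h2 : (Finset.univ.filter fun j : Fin n => (j : ℕ) < m) =
        Finset.univ.map (Fin.castLEEmb hm) := by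
      ext j
      simp only [Finset.mem_filter, Finset.mem_univ, true_and, Finset.mem_map]
      exact ⟨fun h => ⟨⟨j, h⟩, by ext; simp⟩, fun ⟨i, hi⟩ => by rw [← hi]; exact i.2⟩
    rw [h2, Finset.sum_map]
    rfl
  rcases Nat.eq_zero_or_pos m with rfl | hmpos
  · have h2 : ∀ j ∈ Finset.univ, w j = 0 :=
      (Finset.sum_eq_zero_iff_of_nonneg fun j _ => h0 j).1 (by simpa using hw)
    simp [fun j => h2 j (Finset.mem_univ j)]
  -- compare both sides with the last term of the left-hand side
  set a := lam ⟨m - 1, by omega⟩ with ha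
  have h2 : ∀ j, 0 ≤ (lam j - a) * (w j - if (j : ℕ) < m then 1 else 0) := by
    intro j
    by_cases hj : (j : ℕ) < m
    · rw [if_pos hj]
      have h3 : lam j ≤ a := hlam (Fin.le_def.2 (by simp; omega))
      nlinarith [h1 j]
    · rw [if_neg hj, sub_zero]
      have h3 : a ≤ lam j := hlam (Fin.le_def.2 (by simp; omega))
      exact mul_nonneg (by linarith) (h0 j)
  have h3 := Finset.sum_nonneg fun j (_ : j ∈ Finset.univ) => h2 j
  have h4 : ∑ j : Fin n, (if (j : ℕ) < m then (1 : ℝ) else 0) = m := by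
    have := hsum fun _ => 1
    simpa using this.symm
  have h5 : ∑ j, (lam j - a) * (w j - if (j : ℕ) < m then (1 : ℝ) else 0) =
      (∑ j, lam j * w j - ∑ j, lam j * if (j : ℕ) < m then (1 : ℝ) else 0) -
        a * (∑ j, w j - ∑ j : Fin n, (if (j : ℕ) < m then (1 : ℝ) else 0)) := by
    rw [← Finset.sum_sub_distrib, ← Finset.sum_sub_distrib, Finset.mul_sum,
      ← Finset.sum_sub_distrib]
    exact Finset.sum_congr rfl fun j _ => by ring
  rw [h5, hw, h4] at h3
  rw [hsum]
  linarith

/-- Ky Fan's inequality: the trace of a quadratic form on an `m`-dimensional subspace is at least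
the sum of its `m` smallest eigenvalues. -/
theorem sum_eigenvalues_le_sum_apply {n m : ℕ} (hm : m ≤ n) {V : Type*} [NormedAddCommGroup V]
    [InnerProductSpace ℝ V] (b : OrthonormalBasis (Fin n) ℝ V) (B : V →ₗ[ℝ] V →ₗ[ℝ] ℝ)
    {S : Matrix (Fin n) (Fin n) ℝ} (hS : S.IsHermitian) (hSB : ∀ i j, S i j = B (b i) (b j))
    {v : Fin m → V} (hv : Orthonormal ℝ v) :
    ∑ i : Fin m, (hS.eigenvalues ∘ Tuple.sort hS.eigenvalues) (Fin.castLE hm i) ≤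
      ∑ i, B (v i) (v i) := by
  set u := hS.eigenvectorBasis with hu
  set c : Fin m → EuclideanSpace ℝ (Fin n) := fun i => b.repr (v i) with hc
  have hcorth : Orthonormal ℝ c := hv.comp_linearIsometry b.repr.toLinearIsometry
  -- `w j` is the squared length of the projection of the `j`-th eigenvector to the span of `c`
  set w : Fin n → ℝ := fun j => ∑ i, inner ℝ (u j) (c i) ^ 2 with hw
  have hdot : ∀ x y : EuclideanSpace ℝ (Fin n),
      B (b.repr.symm x) (b.repr.symm y) = x.ofLp ⬝ᵥ S.mulVec y.ofLp := by
    intro x y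
    rw [← b.sum_repr_symm x, ← b.sum_repr_symm y]
    simp only [map_sum, LinearMap.sum_apply, map_smul, LinearMap.smul_apply, smul_eq_mul,
      Matrix.mulVec, dotProduct, hSB, Finset.mul_sum]
    rw [Finset.sum_comm]
    exact Finset.sum_congr rfl fun k _ => Finset.sum_congr rfl fun l _ => by ring
  have hinner : ∀ x y : EuclideanSpace ℝ (Fin n), x.ofLp ⬝ᵥ y.ofLp = inner ℝ y x := by
    intro x y
    simp [PiLp.inner_apply, dotProduct]
  have hBu : ∀ j k, B (b.repr.symm (u j)) (b.repr.symm (u k)) =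
      if j = k then hS.eigenvalues k else 0 := by
    intro j k
    rw [hdot, hS.mulVec_eigenvectorBasis, dotProduct_smul, hinner,
      orthonormal_iff_ite.1 u.orthonormal]
    by_cases hjk : j = k <;> simp [hjk, eq_comm]
  have hB : ∀ i, B (v i) (v i) = ∑ j, hS.eigenvalues j * inner ℝ (u j) (c i) ^ 2 := by
    intro i
    have h1 : v i = ∑ j, inner ℝ (u j) (c i) • b.repr.symm (u j) := by
      have h2 := congrArg b.repr.symm (u.sum_repr' (c i))
      simpa [hc] using h2.symm
    rw [h1]
    simp only [map_sum, LinearMap.sum_apply, map_smul, LinearMap.smul_apply, smul_eq_mul, hBu]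
    refine Finset.sum_congr rfl fun k _ => ?_
    simp
    ring
  have hle : ∀ j, w j ≤ 1 := by
    intro j
    have h1 := hcorth.sum_inner_products_le (x := u j) (s := Finset.univ)
    rw [u.norm_eq_one] at h1
    refine le_trans (le_of_eq ?_) (h1.trans_eq (one_pow 2))
    refine Finset.sum_congr rfl fun i _ => ?_
    rw [Real.norm_eq_abs, sq_abs, real_inner_comm]
  have hsum : ∑ j, w j = m := by
    rw [Finset.sum_comm]
    have h1 : ∀ i, ∑ j, inner ℝ (u j) (c i) ^ 2 = 1 := by
      intro i
      have h2 := u.sum_sq_norm_inner_right (c i)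
      simpa [hcorth.1 i] using h2
    simp [h1]
  set σ := Tuple.sort hS.eigenvalues with hσ
  have h1 := sum_castLE_le_sum_mul hm (lam := hS.eigenvalues ∘ σ) (Tuple.monotone_sort _)
    (w := w ∘ σ) (fun j => Finset.sum_nonneg fun i _ => sq_nonneg _) (fun j => hle _)
    (by rw [← hsum]; exact Equiv.sum_comp σ w)
  refine h1.trans (le_of_eq ?_)
  have h2 : ∑ j, (hS.eigenvalues ∘ σ) j * (w ∘ σ) j = ∑ j, hS.eigenvalues j * w j :=
    Equiv.sum_comp σ fun j => hS.eigenvalues j * w j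
  rw [h2, Finset.sum_congr rfl fun i _ => hB i, Finset.sum_comm]
  exact Finset.sum_congr rfl fun j _ => Finset.mul_sum _ _ _

end LinearAlgebra

/-! ### Metrics in coordinates -/

section Coordinates

set_option maxSynthPendingDepth 3

variable {E : Type*} [NormedAddCommGroup E]

/-- `g` is a field of inner products on `E`, defined over `D`. -/
structure IsMetricOn [NormedSpace ℝ E] (g : E → E →L[ℝ] E →L[ℝ] ℝ) (D : Set E) : Prop where
  symm : ∀ y ∈ D, ∀ u v, g y u v = g y v u
  pos : ∀ y ∈ D, ∀ v, v ≠ 0 → 0 < g y v v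

/-- The family `e` is orthonormal for the bilinear form `b`. -/
def IsOrthonormalFor [NormedSpace ℝ E] {m : ℕ} (b : E →L[ℝ] E →L[ℝ] ℝ) (e : Fin m → E) : Prop :=
  ∀ i j, b (e i) (e j) = if i = j then 1 else 0

/-- The diagonal of the Christoffel symbols of the first kind: `⟪∇_e e, w⟫` for the constant field
`e`, where `Dg` is the derivative of the metric. -/
def christoffelDiag [NormedSpace ℝ E] (Dg : E →L[ℝ] E →L[ℝ] E →L[ℝ] ℝ) (e w : E) : ℝ :=
  Dg e w e - 1 / 2 * Dg w e e

section

variable [NormedSpace ℝ E] {g : E → E →L[ℝ] E →L[ℝ] ℝ} {D : Set E}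

theorem IsMetricOn.isInvertible [FiniteDimensional ℝ E] (hg : IsMetricOn g D) {y : E}
    (hy : y ∈ D) : (g y).IsInvertible := by
  have hinj : Function.Injective (g y : E →ₗ[ℝ] E →L[ℝ] ℝ) := by
    refine (injective_iff_map_eq_zero _).2 fun v hv => ?_
    by_contra hne
    have h1 := hg.pos y hy v hne
    have h2 : g y v = 0 := hv
    simp [h2] at h1
  have hdim : Module.finrank ℝ E = Module.finrank ℝ (E →L[ℝ] ℝ) := by
    rw [← (LinearMap.toContinuousLinearMap (𝕜 := ℝ) (E := E) (F' := ℝ)).finrank_eq]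
    exact Subspace.dual_finrank_eq.symm
  refine ⟨(LinearMap.linearEquivOfInjective (g y : E →ₗ[ℝ] E →L[ℝ] ℝ) hinj
    hdim).toContinuousLinearEquiv, ?_⟩
  ext v w
  rfl

/-- On a compact set, the norm is controlled by the metric. -/
theorem IsMetricOn.exists_sq_norm_le [FiniteDimensional ℝ E] (hg : IsMetricOn g D)
    (hgc : ContinuousOn g D) {K : Set E} (hK : IsCompact K) (hKD : K ⊆ D) :
    ∃ C > 0, ∀ y ∈ K, ∀ v, ‖v‖ ^ 2 ≤ C * g y v v := by
  have hcpt : IsCompact (K ×ˢ Metric.sphere (0 : E) 1) := hK.prod (isCompact_sphere 0 1)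
  have hcont : ContinuousOn (fun z : E × E => g z.1 z.2 z.2) (K ×ˢ Metric.sphere (0 : E) 1) :=
    ((((hgc.mono hKD).comp continuousOn_fst fun z hz => hz.1).clm_apply continuousOn_snd).clm_apply
      continuousOn_snd)
  obtain ⟨c, hc, hcle⟩ := hcpt.exists_forall_le' hcont (a := 0) (fun z hz => hg.pos _ (hKD hz.1) _
    (by rintro h; simpa [h] using hz.2))
  refine ⟨c⁻¹, by positivity, fun y hy v => ?_⟩
  by_cases hv : v = 0
  · simp [hv]
  have hn : 0 < ‖v‖ := norm_pos_iff.2 hv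
  have h1 := hcle (y, ‖v‖⁻¹ • v) ⟨hy, by simp [norm_smul, hn.ne']⟩
  simp only [map_smul, _root_.smul_apply, smul_eq_mul] at h1
  rw [inv_mul_eq_div, le_div_iff₀ hc]
  have h2 : ‖v‖⁻¹ * (‖v‖⁻¹ * g y v v) * ‖v‖ ^ 2 = g y v v := by field_simp
  nlinarith [mul_le_mul_of_nonneg_right h1 (sq_nonneg ‖v‖)]

/-- The frames which are orthonormal at the points of a compact set form a compact set. -/
theorem IsMetricOn.isCompact_frames [FiniteDimensional ℝ E] (hg : IsMetricOn g D)
    (hgc : ContinuousOn g D) {K : Set E} (hK : IsCompact K) (hKD : K ⊆ D) (m : ℕ) :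
    IsCompact {z : E × (Fin m → E) | z.1 ∈ K ∧ IsOrthonormalFor (g z.1) z.2} := by
  obtain ⟨C, hC, hle⟩ := hg.exists_sq_norm_le hgc hK hKD
  have hcpt : IsCompact (K ×ˢ Set.pi univ fun _ : Fin m => Metric.closedBall (0 : E) √C) :=
    hK.prod (isCompact_univ_pi fun _ => isCompact_closedBall _ _)
  have hsub : ∀ z : E × (Fin m → E), z.1 ∈ K ∧ IsOrthonormalFor (g z.1) z.2 →
      z ∈ K ×ˢ Set.pi univ fun _ : Fin m => Metric.closedBall (0 : E) √C := by
    intro z hz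
    refine ⟨hz.1, fun i _ => ?_⟩
    have h1 := hle z.1 hz.1 (z.2 i)
    rw [hz.2 i i, if_pos rfl, mul_one] at h1
    simpa using Real.le_sqrt_of_sq_le h1
  have hcont : ContinuousOn (fun (z : E × (Fin m → E)) (i j : Fin m) => g z.1 (z.2 i) (z.2 j))
      (K ×ˢ Set.pi univ fun _ : Fin m => Metric.closedBall (0 : E) √C) :=
    continuousOn_pi.2 fun i => continuousOn_pi.2 fun j =>
      ((((hgc.mono hKD).comp continuousOn_fst fun z hz => hz.1).clm_apply
        (by fun_prop)).clm_apply (by fun_prop))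
  refine hcpt.of_isClosed_subset ?_ hsub
  convert hcont.preimage_isClosed_of_isClosed hcpt.isClosed
      (isClosed_singleton (x := fun i j : Fin m => if i = j then (1 : ℝ) else 0)) using 1
  ext z
  constructor
  · exact fun hz => ⟨hsub z hz, funext fun i => funext fun j => hz.2 i j⟩
  · exact fun hz => ⟨hz.1.1, fun i j => congrFun (congrFun hz.2 i) j⟩

end

/-- If a continuous function is negative on a compact set wherever a continuous penalty vanishes,
then it is negative everywhere after a large multiple of the penalty is subtracted. -/
theorem exists_penalty {α : Type*} [TopologicalSpace α] [T2Space α] {S : Set α} (hS : IsCompact S)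
    {a b : α → ℝ} (ha : ContinuousOn a S) (hb : ContinuousOn b S) (hb0 : ∀ x ∈ S, 0 ≤ b x)
    (h : ∀ x ∈ S, b x = 0 → a x < 0) : ∃ k : ℕ, ∀ x ∈ S, a x - k * b x < 0 := by
  -- otherwise the decreasing compact sets where `a - k b ≥ 0` have a common point
  by_contra! hcon
  have hcl : ∀ k : ℕ, IsCompact (S ∩ {x | 0 ≤ a x - k * b x}) := by
    intro k
    have hc : ContinuousOn (fun x => a x - k * b x) S := ha.sub (continuousOn_const.mul hb)
    exact hS.of_isClosed_subset (hc.preimage_isClosed_of_isClosed hS.isClosed isClosed_Ici)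
      inter_subset_left
  obtain ⟨x, hx⟩ := IsCompact.nonempty_iInter_of_sequence_nonempty_isCompact_isClosed
    (fun k : ℕ => S ∩ {x | 0 ≤ a x - k * b x})
    (fun k x hx => ⟨hx.1, by
      have h1 := hx.2.out
      have h2 := hb0 x hx.1
      push_cast at h1
      refine (show 0 ≤ a x - k * b x from ?_)
      nlinarith⟩)
    (fun k => (hcon k).imp fun x hx => hx) (hcl 0) fun k => (hcl k).isClosed
  have hx' : ∀ k : ℕ, x ∈ S ∧ 0 ≤ a x - k * b x := fun k => mem_iInter.1 hx k
  have hxS := (hx' 0).1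
  rcases (hb0 x hxS).eq_or_lt with hbx | hbx
  · have h1 := (hx' 0).2
    have h2 := h x hxS hbx.symm
    simp at h1
    linarith
  · obtain ⟨k, hk⟩ := exists_nat_gt (a x / b x)
    rw [div_lt_iff₀ hbx] at hk
    linarith [(hx' k).2]

/-! ### Gradient fields cut off at a level -/

/-- The logarithmic derivative of the cutoff `s ↦ exp (-1 / s)` is as large as desired on a short
interval `(0, s₀]`.  This is what lets the term `φ' du²` in the Lie derivative of the metric along
`φ(s₀ - u) ∇u` absorb any multiple of `φ du²`. -/
theorem le_deriv_expNegInvGlue {s₀ κ s : ℝ} (hs : s ≤ s₀) (hκ : 0 ≤ κ) (h : κ * s₀ ^ 2 ≤ 1) :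
    κ * expNegInvGlue s ≤ deriv expNegInvGlue s := by
  rcases le_or_gt s 0 with h0 | h0
  · have hmin : IsLocalMin expNegInvGlue s := Filter.Eventually.of_forall fun r => by
      rw [expNegInvGlue.zero_of_nonpos h0]; exact expNegInvGlue.nonneg r
    rw [hmin.deriv_eq_zero, expNegInvGlue.zero_of_nonpos h0, mul_zero]
  · have heq : expNegInvGlue =ᶠ[𝓝 s] fun r => Real.exp (-r⁻¹) := by
      filter_upwards [lt_mem_nhds h0] with r hr
      rw [expNegInvGlue, if_neg (not_le.2 hr)]
    have hd : HasDerivAt (fun r : ℝ => Real.exp (-r⁻¹)) (Real.exp (-s⁻¹) * (s ^ 2)⁻¹) s := by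
      have := ((hasDerivAt_inv h0.ne').neg).exp
      simpa using this
    rw [heq.deriv_eq, hd.deriv, heq.eq_of_nhds, mul_comm]
    gcongr
    rw [← one_div, le_div_iff₀ (by positivity)]
    exact le_trans (by gcongr) h

section Field

variable [InnerProductSpace ℝ E]

/-- The function `y ↦ ℓ y + c |y - q|²`. -/
def bump (ℓ : E →L[ℝ] ℝ) (c : ℝ) (q y : E) : ℝ := ℓ y + c * ‖y - q‖ ^ 2

/-- The differential of `bump`. -/
def bumpDeriv (ℓ : E →L[ℝ] ℝ) (c : ℝ) (q y : E) : E →L[ℝ] ℝ := ℓ + (2 * c) • innerSL ℝ (y - q)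

theorem hasFDerivAt_bump (ℓ : E →L[ℝ] ℝ) (c : ℝ) (q y : E) :
    HasFDerivAt (bump ℓ c q) (bumpDeriv ℓ c q y) y := by
  have h1 : HasFDerivAt (fun y : E => ‖y - q‖ ^ 2) _ y :=
    ((hasFDerivAt_id y).sub_const q).norm_sq
  refine (ℓ.hasFDerivAt.add (h1.const_mul c)).congr_fderiv ?_
  ext v
  simp [bumpDeriv]
  ring

theorem contDiff_bumpDeriv (ℓ : E →L[ℝ] ℝ) (c : ℝ) (q : E) : ContDiff ℝ ∞ (bumpDeriv ℓ c q) :=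
  contDiff_const.add (((innerSL ℝ).contDiff.comp (contDiff_id.sub contDiff_const)).const_smul _)

theorem hasFDerivAt_bumpDeriv (ℓ : E →L[ℝ] ℝ) (c : ℝ) (q y : E) :
    HasFDerivAt (bumpDeriv ℓ c q) ((2 * c) • innerSL ℝ) y := by
  have h1 := ((innerSL ℝ (E := E)).hasFDerivAt (x := y - q)).comp y
    ((hasFDerivAt_id y).sub_const q)
  exact (h1.const_smul (2 * c)).const_add ℓ

/-- The gradient of `bump` with respect to the metric `g`. -/
def bumpGrad (g : E → E →L[ℝ] E →L[ℝ] ℝ) (ℓ : E →L[ℝ] ℝ) (c : ℝ) (q y : E) : E :=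
  (g y).inverse (bumpDeriv ℓ c q y)

/-- The vector field `φ(s₀ - u) ∇u` for the function `u = bump` and the smooth cutoff
`φ(s) = exp (-1 / s)` for `s > 0`, `φ(s) = 0` for `s ≤ 0`.  It vanishes where `u ≥ s₀`. -/
def bumpField (g : E → E →L[ℝ] E →L[ℝ] ℝ) (ℓ : E →L[ℝ] ℝ) (c : ℝ) (q : E) (s₀ : ℝ) (y : E) : E :=
  expNegInvGlue (s₀ - bump ℓ c q y) • bumpGrad g ℓ c q y

variable {g : E → E →L[ℝ] E →L[ℝ] ℝ} {D H : Set E} {ℓ : E →L[ℝ] ℝ} {c : ℝ} {q : E}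

theorem apply_bumpGrad [FiniteDimensional ℝ E] (hg : IsMetricOn g D) {y : E} (hy : y ∈ D) :
    g y (bumpGrad g ℓ c q y) = bumpDeriv ℓ c q y :=
  congrArg (fun L => L (bumpDeriv ℓ c q y)) (hg.isInvertible hy).self_comp_inverse

theorem contDiffWithinAt_bumpGrad [FiniteDimensional ℝ E] (hg : IsMetricOn g D) {y : E}
    (hy : y ∈ D) (hgs : ContDiffWithinAt ℝ ∞ g H y) :
    ContDiffWithinAt ℝ ∞ (bumpGrad g ℓ c q) H y :=
  (((hg.isInvertible hy).contDiffAt_map_inverse).comp_contDiffWithinAt y hgs).clm_apply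
    (contDiff_bumpDeriv ℓ c q).contDiffAt.contDiffWithinAt

theorem contDiff_bump : ContDiff ℝ ∞ (bump ℓ c q) :=
  ℓ.contDiff.add (contDiff_const.mul ((contDiff_id.sub contDiff_const).norm_sq ℝ))

/-- The identity obtained by differentiating `g(∇u, ·) = du`. -/
theorem fderivWithin_bumpGrad_identity [FiniteDimensional ℝ E] (hg : IsMetricOn g D) {y : E}
    (hy : y ∈ D) (hDH : D ∈ 𝓝[H] y) (hu : UniqueDiffWithinAt ℝ H y)
    (hgs : ContDiffWithinAt ℝ ∞ g H y) (e : E) :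
    fderivWithin ℝ g H y e (bumpGrad g ℓ c q y) e +
      g y (fderivWithin ℝ (bumpGrad g ℓ c q) H y e) e = 2 * c * ‖e‖ ^ 2 := by
  have hgd := (hgs.differentiableWithinAt (by simp)).hasFDerivWithinAt
  have hVd := ((contDiffWithinAt_bumpGrad (ℓ := ℓ) (c := c) (q := q) hg hy
    hgs).differentiableWithinAt (by simp)).hasFDerivWithinAt
  have h2 := (hgd.clm_apply hVd).congr_of_eventuallyEq (f₁ := bumpDeriv ℓ c q) (by
    filter_upwards [hDH] with z hz
    exact (apply_bumpGrad hg hz).symm) (apply_bumpGrad hg hy).symm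
  have h3 := hu.eq h2 (hasFDerivAt_bumpDeriv ℓ c q y).hasFDerivWithinAt
  have h4 : (g y (fderivWithin ℝ (bumpGrad g ℓ c q) H y e) +
      fderivWithin ℝ g H y e (bumpGrad g ℓ c q y)) e = 2 * c * innerSL ℝ e e :=
    DFunLike.congr_fun (DFunLike.congr_fun h3 e) e
  rw [innerSL_apply_apply, real_inner_self_eq_norm_sq] at h4
  rw [← h4, add_comm]
  rfl

theorem hasFDerivWithinAt_bumpField [FiniteDimensional ℝ E] (hg : IsMetricOn g D) {y : E}
    (hy : y ∈ D) (hgs : ContDiffWithinAt ℝ ∞ g H y) (s₀ : ℝ) :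
    HasFDerivWithinAt (bumpField g ℓ c q s₀)
      (expNegInvGlue (s₀ - bump ℓ c q y) • fderivWithin ℝ (bumpGrad g ℓ c q) H y +
        (deriv expNegInvGlue (s₀ - bump ℓ c q y) • (-bumpDeriv ℓ c q y)).smulRight
          (bumpGrad g ℓ c q y)) H y := by
  have hVd := ((contDiffWithinAt_bumpGrad (ℓ := ℓ) (c := c) (q := q) hg hy
    hgs).differentiableWithinAt (by simp)).hasFDerivWithinAt
  have h2 : HasDerivAt expNegInvGlue (deriv expNegInvGlue (s₀ - bump ℓ c q y))
      (s₀ - bump ℓ c q y) :=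
    ((expNegInvGlue.contDiff (n := ⊤)).differentiable (by simp) _).hasDerivAt
  have h3 := h2.comp_hasFDerivAt y ((hasFDerivAt_bump ℓ c q y).const_sub s₀)
  exact h3.hasFDerivWithinAt.smul hVd

/-- Half the Lie derivative of the metric along `bumpField`, on the diagonal: it is
`φ ∇²u(e, e) - φ' du(e)²`, with the Hessian of `u` written out in coordinates. -/
theorem lieDeriv_bumpField [FiniteDimensional ℝ E] (hg : IsMetricOn g D) {y : E} (hy : y ∈ D)
    (hDH : D ∈ 𝓝[H] y) (hu : UniqueDiffWithinAt ℝ H y)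
    (hgs : ContDiffWithinAt ℝ ∞ g H y) (s₀ : ℝ) (e : E) :
    1 / 2 * (fderivWithin ℝ g H y (bumpField g ℓ c q s₀ y) e e +
        g y (fderivWithin ℝ (bumpField g ℓ c q s₀) H y e) e +
        g y e (fderivWithin ℝ (bumpField g ℓ c q s₀) H y e)) =
      expNegInvGlue (s₀ - bump ℓ c q y) * (2 * c * ‖e‖ ^ 2 -
        christoffelDiag (fderivWithin ℝ g H y) e (bumpGrad g ℓ c q y)) -
      deriv expNegInvGlue (s₀ - bump ℓ c q y) * bumpDeriv ℓ c q y e ^ 2 := by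
  have h1 := fderivWithin_bumpGrad_identity (ℓ := ℓ) (c := c) (q := q) hg hy hDH hu hgs e
  have hsymm := hg.symm y hy
  have h5 : g y (bumpGrad g ℓ c q y) e = bumpDeriv ℓ c q y e := by rw [apply_bumpGrad hg hy]
  rw [(hasFDerivWithinAt_bumpField hg hy hgs s₀).fderivWithin hu, hsymm e]
  unfold christoffelDiag bumpField
  generalize fderivWithin ℝ g H y = Dg at *
  generalize fderivWithin ℝ (bumpGrad g ℓ c q) H y = DV at *
  generalize bumpGrad g ℓ c q y = V at *
  generalize expNegInvGlue (s₀ - bump ℓ c q y) = a at *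
  generalize deriv expNegInvGlue (s₀ - bump ℓ c q y) = a' at *
  generalize bumpDeriv ℓ c q y = du at *
  generalize g y = G at *
  have h2 : Dg (a • V) e e = a * Dg V e e :=
    DFunLike.congr_fun (DFunLike.congr_fun (Dg.map_smul a V) e) e
  have h3 : G ((a • DV + (a' • -du).smulRight V) e) e = a * G (DV e) e - a' * du e * G V e := by
    have : (a • DV + (a' • -du).smulRight V) e = a • DV e - (a' * du e) • V := by
      simp [sub_eq_add_neg]
    rw [this, map_sub, map_smul, map_smul]
    rfl
  rw [h2, h3, h5]
  linear_combination a * h1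

end Field

end Coordinates

/-! ### The barrier field in coordinates -/

section Barrier

set_option maxSynthPendingDepth 3

variable {E : Type*} [NormedAddCommGroup E]

/-- The pointwise estimate behind the barrier: near `q`, the Hessian of the function `u = bump`,
penalized by a large multiple of `du²`, has trace less than `-η |∇u|` on all `m`-planes. -/
theorem exists_penalized_trace_lt [NormedSpace ℝ E] [FiniteDimensional ℝ E]
    {g : E → E →L[ℝ] E →L[ℝ] ℝ} {Dg : E → E →L[ℝ] E →L[ℝ] E →L[ℝ] ℝ}
    {V : E → E} {du : E → E →L[ℝ] ℝ} {N : Set E} (hN : IsCompact N) (hg : IsMetricOn g N)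
    (hgc : ContinuousOn g N) (hDg : ContinuousOn Dg N) (hV : ContinuousOn V N)
    (hdu : ContinuousOn du N) {q : E} (hq : q ∈ N) {m : ℕ} {η c : ℝ}
    (h : ∀ e : Fin m → E, IsOrthonormalFor (g q) e → (∀ i, du q (e i) = 0) →
      ∑ i, (2 * c * ‖e i‖ ^ 2 - christoffelDiag (Dg q) (e i) (V q)) + η * √(g q (V q) (V q)) < 0) :
    ∃ k : ℕ, ∃ r > 0, ∀ y ∈ N, ‖y - q‖ < r → ∀ e : Fin m → E, IsOrthonormalFor (g y) e →
      ∑ i, (2 * c * ‖e i‖ ^ 2 - christoffelDiag (Dg y) (e i) (V y)) + η * √(g y (V y) (V y)) -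
        k * ∑ i, du y (e i) ^ 2 < 0 := by
  set T : Set (E × (Fin m → E)) := {z | z.1 ∈ N ∧ IsOrthonormalFor (g z.1) z.2} with hT
  have hTc : IsCompact T := hg.isCompact_frames hgc hN subset_rfl m
  set Tq : Set (E × (Fin m → E)) :=
    {z | z.1 ∈ ({q} : Set E) ∧ IsOrthonormalFor (g z.1) z.2} with hTq
  have hTqc : IsCompact Tq :=
    hg.isCompact_frames hgc isCompact_singleton (singleton_subset_iff.2 hq) m
  have hTqT : Tq ⊆ T := fun z hz => ⟨hz.1.symm ▸ hq, hz.2⟩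
  have hfst : MapsTo (Prod.fst : E × (Fin m → E) → E) T N := fun z hz => hz.1
  have hg1 : ContinuousOn (fun z : E × (Fin m → E) => g z.1) T := hgc.comp continuousOn_fst hfst
  have hDg1 : ContinuousOn (fun z : E × (Fin m → E) => Dg z.1) T := hDg.comp continuousOn_fst hfst
  have hV1 : ContinuousOn (fun z : E × (Fin m → E) => V z.1) T := hV.comp continuousOn_fst hfst
  have hdu1 : ContinuousOn (fun z : E × (Fin m → E) => du z.1) T := hdu.comp continuousOn_fst hfst
  have he : ∀ i, ContinuousOn (fun z : E × (Fin m → E) => z.2 i) T := fun i => by fun_prop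
  have ha : ContinuousOn (fun z : E × (Fin m → E) =>
      ∑ i, (2 * c * ‖z.2 i‖ ^ 2 - christoffelDiag (Dg z.1) (z.2 i) (V z.1)) +
        η * √(g z.1 (V z.1) (V z.1))) T := by
    refine ContinuousOn.add (continuousOn_finsetSum _ fun i _ => ?_)
      (continuousOn_const.mul ((hg1.clm_apply hV1).clm_apply hV1).sqrt)
    refine (continuousOn_const.mul ((he i).norm.pow 2)).sub ?_
    unfold christoffelDiag
    exact (((hDg1.clm_apply (he i)).clm_apply hV1).clm_apply (he i)).sub
      (continuousOn_const.mul (((hDg1.clm_apply hV1).clm_apply (he i)).clm_apply (he i)))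
  have hb : ContinuousOn (fun z : E × (Fin m → E) => ∑ i, du z.1 (z.2 i) ^ 2) T :=
    continuousOn_finsetSum _ fun i _ => (hdu1.clm_apply (he i)).pow 2
  -- the penalty works for the frames at `q`, hence, by compactness, for those at nearby points
  obtain ⟨k, hk⟩ := exists_penalty hTqc (ha.mono hTqT) (hb.mono hTqT)
    (fun z _ => Finset.sum_nonneg fun i _ => sq_nonneg _) (fun z hz h0 => by
      have h1 : z.1 = q := hz.1
      have h2 := hz.2
      rw [h1] at h2 h0
      rw [h1]
      refine h z.2 h2 fun i => ?_
      have := (Finset.sum_eq_zero_iff_of_nonneg fun i _ => sq_nonneg _).1 h0 i (Finset.mem_univ i)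
      exact pow_eq_zero_iff two_ne_zero |>.1 this)
  have hf := ha.sub (continuousOn_const (c := (k : ℝ)).mul hb)
  have hS : IsCompact (T ∩ (fun z : E × (Fin m → E) =>
      ∑ i, (2 * c * ‖z.2 i‖ ^ 2 - christoffelDiag (Dg z.1) (z.2 i) (V z.1)) +
        η * √(g z.1 (V z.1) (V z.1)) - k * ∑ i, du z.1 (z.2 i) ^ 2) ⁻¹' Ici 0) :=
    hTc.of_isClosed_subset (hf.preimage_isClosed_of_isClosed hTc.isClosed isClosed_Ici)
      inter_subset_left
  obtain ⟨r, hr, hrle⟩ := hS.exists_forall_le' (f := fun z => ‖z.1 - q‖) (a := 0) (by fun_prop)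
    (fun z hz => by
      refine norm_pos_iff.2 (sub_ne_zero.2 fun h1 => ?_)
      have h2 := hk z ⟨h1, hz.1.2⟩
      exact absurd hz.2.out (not_le.2 h2))
  refine ⟨k, r, hr, fun y hy hyr e he => ?_⟩
  by_contra! hcon
  exact absurd (hrle (y, e) ⟨⟨hy, he⟩, hcon⟩) (not_le.2 hyr)

/-- The barrier field in coordinates.  If the Hessian of the boundary coordinate `ℓ` at `q` has
trace at most `-η' |∇ℓ|` on all `m`-planes tangent to the boundary, then for `η < η'` there is a
field `X`, supported in a given neighbourhood of `q` and a positive multiple of `∇ℓ` at `q`, such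
that half the Lie derivative of the metric along `X` has trace at most `-η |X|` on all
`m`-planes whatsoever. -/
theorem exists_barrierField [InnerProductSpace ℝ E] [FiniteDimensional ℝ E]
    {g : E → E →L[ℝ] E →L[ℝ] ℝ} {O : Set E} (hO : IsOpen O)
    (ℓ : E →L[ℝ] ℝ) {e₀ : E} (he₀ : ℓ e₀ = 1) (hg : IsMetricOn g ({y | 0 ≤ ℓ y} ∩ O))
    (hgs : ContDiffOn ℝ ∞ g ({y | 0 ≤ ℓ y} ∩ O)) {q : E} (hqO : q ∈ O) (hq : ℓ q = 0)
    {V₀ : E} (hV₀ : g q V₀ = ℓ) {m : ℕ} {η η' : ℝ} (hη : η < η')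
    (hcurv : ∀ e : Fin m → E, IsOrthonormalFor (g q) e → (∀ i, ℓ (e i) = 0) →
      η' * √(g q V₀ V₀) ≤
        ∑ i, christoffelDiag (fderivWithin ℝ g {y | 0 ≤ ℓ y} q) (e i) V₀) :
    ∃ (X : E → E) (K : Set E), ContDiffOn ℝ ∞ X {y | 0 ≤ ℓ y} ∧ IsCompact K ∧
      K ⊆ {y | 0 ≤ ℓ y} ∩ O ∧ (∀ y ∈ {y | 0 ≤ ℓ y} \ K, X y = 0) ∧
      (∀ y, ℓ y = 0 → 0 ≤ ℓ (X y)) ∧ (∃ a : ℝ, 0 < a ∧ X q = a • V₀) ∧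
      ∀ y ∈ K, ∀ e : Fin m → E, IsOrthonormalFor (g y) e →
        ∑ i, 1 / 2 * (fderivWithin ℝ g {y | 0 ≤ ℓ y} y (X y) (e i) (e i) +
          g y (fderivWithin ℝ X {y | 0 ≤ ℓ y} y (e i)) (e i) +
          g y (e i) (fderivWithin ℝ X {y | 0 ≤ ℓ y} y (e i))) ≤ -η * √(g y (X y) (X y)) := by
  set H : Set E := {y | 0 ≤ ℓ y} with hHdef
  have hH : Convex ℝ H := convex_halfSpace_ge ℓ.isLinear 0
  have hHcl : IsClosed H := isClosed_le continuous_const ℓ.continuous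
  have hu : UniqueDiffOn ℝ H := by
    refine uniqueDiffOn_convex hH ⟨e₀, mem_interior.2 ⟨{y | 0 < ℓ y},
      fun y hy => (show 0 ≤ ℓ y from hy.out.le), isOpen_lt continuous_const ℓ.continuous, ?_⟩⟩
    simp [he₀]
  have hDH : ∀ y ∈ H ∩ O, H ∩ O ∈ 𝓝[H] y := fun y hy =>
    inter_mem_nhdsWithin H (hO.mem_nhds hy.2)
  have hgs' : ∀ y ∈ H ∩ O, ContDiffWithinAt ℝ ∞ g H y := fun y hy =>
    (hgs y hy).mono_of_mem_nhdsWithin (hDH y hy)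
  have hqD : q ∈ H ∩ O := ⟨hq.ge, hqO⟩
  obtain ⟨r, hr, hrO⟩ := Metric.nhds_basis_closedBall.mem_iff.1 (hO.mem_nhds hqO)
  set N : Set E := Metric.closedBall q r ∩ H with hNdef
  have hN : IsCompact N := (isCompact_closedBall q r).inter_right hHcl
  have hND : N ⊆ H ∩ O := fun y hy => ⟨hy.2, hrO hy.1⟩
  have hqN : q ∈ N := ⟨Metric.mem_closedBall_self hr.le, hqD.1⟩
  have hgN : IsMetricOn g N := ⟨fun y hy => hg.symm y (hND hy), fun y hy => hg.pos y (hND hy)⟩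
  obtain ⟨C, hC, hCle⟩ := hg.exists_sq_norm_le hgs.continuousOn hN hND
  have hV₀ne : V₀ ≠ 0 := by
    rintro rfl
    rw [map_zero] at hV₀
    rw [← hV₀] at he₀
    simp at he₀
  have hv₀ : 0 < √(g q V₀ V₀) := Real.sqrt_pos.2 (hg.pos q hqD V₀ hV₀ne)
  -- `c` is so small that the Hessian of `c |y - q|²` does not use up the gap between `η` and `η'`
  obtain ⟨c, hc, hcle⟩ : ∃ c > 0, 2 * c * (m * C) < (η' - η) * √(g q V₀ V₀) := by
    have h1 : 0 < (η' - η) * √(g q V₀ V₀) := mul_pos (by linarith) hv₀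
    refine ⟨(η' - η) * √(g q V₀ V₀) / (2 * (m * C + 1)), by positivity, ?_⟩
    rw [mul_div_assoc', div_mul_eq_mul_div, div_lt_iff₀ (by positivity)]
    nlinarith
  set V := bumpGrad g ℓ c q with hV
  have hduq : bumpDeriv ℓ c q q = ℓ := by simp [bumpDeriv]
  have hVq : V q = V₀ := by
    have h1 : g q (V q - V₀) = 0 := by
      rw [map_sub, hV₀, hV, apply_bumpGrad hg hqD, hduq, sub_self]
    by_contra hne
    have h2 := hg.pos q hqD (V q - V₀) (sub_ne_zero.2 hne)
    rw [h1] at h2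
    simp at h2
  have hVs : ∀ y ∈ H ∩ O, ContDiffWithinAt ℝ ∞ V H y := fun y hy =>
    contDiffWithinAt_bumpGrad hg hy (hgs' y hy)
  obtain ⟨k, r₁, hr₁, hk⟩ := exists_penalized_trace_lt (η := η) (c := c) (m := m) hN hgN
    (hgs.continuousOn.mono hND)
    (Dg := fderivWithin ℝ g H) (V := V) (du := bumpDeriv ℓ c q)
    (fun y hy => (((hgs' y (hND hy)).fderivWithin_right hu (m := 0) (by simp)
      (hND hy).1).continuousWithinAt).mono fun z (hz : z ∈ N) => hz.2)
    (fun y hy => (hVs y (hND hy)).continuousWithinAt.mono fun z (hz : z ∈ N) => hz.2)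
    (contDiff_bumpDeriv ℓ c q).continuous.continuousOn hqN
    (fun e he h0 => by
      rw [hVq, Finset.sum_sub_distrib]
      rw [hduq] at h0
      have h1 := hcurv e he h0
      have h2 : ∑ i, 2 * c * ‖e i‖ ^ 2 ≤ 2 * c * (m * C) := by
        rw [← Finset.mul_sum]
        refine mul_le_mul_of_nonneg_left ?_ (by positivity)
        refine (Finset.sum_le_card_nsmul _ _ C fun i _ => ?_).trans (by simp)
        have := hCle q hqN (e i)
        rwa [he i i, if_pos rfl, mul_one] at this
      linarith)
  -- the field points inwards near `q`
  obtain ⟨r₂, hr₂, hin⟩ : ∃ r₂ > 0, ∀ y ∈ H, ‖y - q‖ < r₂ → 0 < ℓ (V y) := by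
    have h1 : ContinuousWithinAt (fun y => ℓ (V y)) H q :=
      ℓ.continuous.continuousAt.comp_continuousWithinAt (hVs q hqD).continuousWithinAt
    have h2 : 0 < ℓ (V q) := by
      rw [hVq, ← hV₀]
      exact hg.pos q hqD V₀ hV₀ne
    obtain ⟨r₂, hr₂, h3⟩ := Metric.mem_nhdsWithin_iff.1 (h1.eventually (lt_mem_nhds h2))
    exact ⟨r₂, hr₂, fun y hy hyr => h3 ⟨by simpa [dist_eq_norm] using hyr, hy⟩⟩
  set R := min r (min r₁ r₂) with hR
  have hRpos : 0 < R := lt_min hr (lt_min hr₁ hr₂)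
  -- the support `{u ≤ s₀}` lies in the ball of radius `R`, and the cutoff absorbs the penalty
  -- `k du²`
  obtain ⟨s₀, hs₀, hs₀R, hs₀k⟩ : ∃ s₀ > 0, s₀ < c * R ^ 2 ∧ k * s₀ ^ 2 ≤ 1 := by
    have h1 : (0 : ℝ) < 1 / (k + 1) := by positivity
    have h2 : 0 < c * R ^ 2 / 2 := by positivity
    refine ⟨min (c * R ^ 2 / 2) (1 / (k + 1)), lt_min h2 h1,
      (min_le_left _ _).trans_lt (by linarith), ?_⟩
    set s := min (c * R ^ 2 / 2) (1 / (k + 1 : ℝ)) with hs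
    have h3 : s ≤ 1 / (k + 1) := min_le_right _ _
    have h4 : 0 < s := lt_min h2 h1
    rw [le_div_iff₀ (by positivity)] at h3
    have h5 : (0 : ℝ) ≤ k := by positivity
    have h6 : s ≤ 1 := by nlinarith
    nlinarith
  have hbump : ∀ y ∈ H, bump ℓ c q y ≤ s₀ → ‖y - q‖ < R := by
    intro y hy hle
    have h1 : 0 ≤ ℓ y := hy
    unfold bump at hle
    have h2 : c * ‖y - q‖ ^ 2 < c * R ^ 2 := by linarith
    exact lt_of_pow_lt_pow_left₀ 2 hRpos.le (lt_of_mul_lt_mul_left h2 hc.le)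
  have hbc : Continuous (bump ℓ c q) := (contDiff_bump (ℓ := ℓ) (c := c) (q := q)).continuous
  set K : Set E := {y | y ∈ H ∧ bump ℓ c q y ≤ s₀} with hK
  have hKN : K ⊆ N := fun y hy => ⟨by
    rw [Metric.mem_closedBall, dist_eq_norm]
    exact (hbump y hy.1 hy.2).le.trans (min_le_left _ _), hy.1⟩
  have hKc : IsCompact K :=
    hN.of_isClosed_subset (hHcl.inter (isClosed_le hbc continuous_const)) hKN
  have hzero : ∀ y, s₀ ≤ bump ℓ c q y → bumpField g ℓ c q s₀ y = 0 := fun y hy => by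
    rw [bumpField, expNegInvGlue.zero_of_nonpos (by linarith), zero_smul]
  refine ⟨bumpField g ℓ c q s₀, K, fun y hy => ?_, hKc, hKN.trans hND,
    fun y hy => hzero y ?_, fun y hy => ?_, ⟨expNegInvGlue s₀, expNegInvGlue.pos_of_pos hs₀, ?_⟩,
    fun y hy e he => ?_⟩
  · by_cases hyO : y ∈ O
    · refine ContDiffWithinAt.smul ?_ (hVs y ⟨hy, hyO⟩)
      exact (expNegInvGlue.contDiff.comp (contDiff_const.sub
        contDiff_bump)).contDiffAt.contDiffWithinAt
    · have h1 : s₀ < bump ℓ c q y := by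
        by_contra! hle
        exact hyO (hND (hKN ⟨hy, hle⟩)).2
      have h2 : bumpField g ℓ c q s₀ =ᶠ[𝓝 y] fun _ => 0 := by
        filter_upwards [hbc.continuousAt.eventually (lt_mem_nhds h1)] with z hz
        exact hzero z hz.le
      exact (contDiffAt_const.congr_of_eventuallyEq h2).contDiffWithinAt
  · by_contra! hle
    exact hy.2 ⟨hy.1, hle.le⟩
  · rcases le_total s₀ (bump ℓ c q y) with h1 | h1
    · rw [hzero y h1, map_zero]
    · have hyH : y ∈ H := hy.ge
      rw [bumpField, map_smul, smul_eq_mul]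
      exact mul_nonneg (expNegInvGlue.nonneg _) (hin y hyH ((hbump y hyH h1).trans_le
        ((min_le_right _ _).trans (min_le_right _ _)))).le
  · rw [bumpField, ← hV, hVq]
    simp [bump, hq]
  · have hyD : y ∈ H ∩ O := hND (hKN hy)
    have h1 := hk y (hKN hy) ((hbump y hy.1 hy.2).trans_le
        ((min_le_right _ _).trans (min_le_left _ _))) e he
    rw [Finset.sum_congr rfl fun i _ => lieDeriv_bumpField hg hyD (hDH y hyD) (hu y hyD.1)
      (hgs' y hyD) s₀ (e i), Finset.sum_sub_distrib, ← Finset.mul_sum, ← Finset.mul_sum]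
    set s := s₀ - bump ℓ c q y with hs
    have hsle : s ≤ s₀ := by
      have h2 : 0 ≤ ℓ y := hyD.1
      have h3 : 0 ≤ c * ‖y - q‖ ^ 2 := by positivity
      simp only [hs, bump]
      linarith
    have h2 := le_deriv_expNegInvGlue hsle (by positivity) hs₀k
    have h3 : 0 ≤ expNegInvGlue s := expNegInvGlue.nonneg s
    have h4 : √(g y (bumpField g ℓ c q s₀ y) (bumpField g ℓ c q s₀ y)) =
        expNegInvGlue s * √(g y (V y) (V y)) := by
      have h5 : g y (bumpField g ℓ c q s₀ y) (bumpField g ℓ c q s₀ y) =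
          expNegInvGlue s ^ 2 * g y (V y) (V y) := by
        have h6 : g y (expNegInvGlue s • V y) (expNegInvGlue s • V y) =
          expNegInvGlue s * (expNegInvGlue s * g y (V y) (V y)) := by
          rw [(g y).map_smul, (_ • g y (V y)).map_smul]
          rfl
        rw [bumpField, h6]
        ring
      rw [h5, Real.sqrt_mul (sq_nonneg _), Real.sqrt_sq h3]
    rw [h4]
    set B := ∑ i, bumpDeriv ℓ c q y (e i) ^ 2 with hB
    have hB0 : 0 ≤ B := Finset.sum_nonneg fun i _ => sq_nonneg _
    nlinarith [mul_le_mul_of_nonneg_right h2 hB0, mul_le_mul_of_nonneg_left h1.le h3]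

end Barrier

/-! ### Rate of change of area in coordinates -/

section CoordinateJacobian

set_option maxSynthPendingDepth 3

variable {E : Type*} [NormedAddCommGroup E] [NormedSpace ℝ E]
  {g : E → E →L[ℝ] E →L[ℝ] ℝ} {X : E → E} {H K : Set E} {T C : ℝ} {Φ : ℝ → E → E}
  {A : ℝ → E → E →L[ℝ] E} {m : ℕ}

/-- The Gram matrix, for the metric `g` at the point `z`, of the images of a family of vectors under
a linear map. -/
def imageGram (g : E → E →L[ℝ] E →L[ℝ] ℝ) (z : E) (L : E →L[ℝ] E) (e : Fin m → E) :
    Fin m → Fin m → ℝ := fun i j => g z (L (e i)) (L (e j))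

/-- The initial rate of change of the volume factor of a flow on a plane is half the trace on the
plane of the Lie derivative of the metric. -/
theorem IsDifferentiableFlow.hasDerivWithinAt_sqrt_det_imageGram
    (h : IsDifferentiableFlow X H K T C Φ A) {y : E} (hy : y ∈ H)
    (hg : DifferentiableWithinAt ℝ g H y) {e : Fin m → E} (he : IsOrthonormalFor (g y) e) :
    HasDerivWithinAt (fun t => √(Matrix.of (imageGram g (Φ t y) (A t y) e)).det)
      (∑ i, 1 / 2 * (fderivWithin ℝ g H y (X y) (e i) (e i) +
          g y (fderivWithin ℝ X H y (e i)) (e i) + g y (e i) (fderivWithin ℝ X H y (e i))))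
      (Ici 0) 0 := by
  have hΦ : HasDerivWithinAt (fun t => Φ t y) (X y) (Ici 0) 0 := by
    have := (h.hasDerivAt y hy 0 le_rfl).hasDerivWithinAt (s := Ici 0)
    rwa [h.zero] at this
  have hgΦ : HasDerivWithinAt (fun t => g (Φ t y)) (fderivWithin ℝ g H y (X y)) (Ici 0) 0 := by
    have h1 : HasFDerivWithinAt g (fderivWithin ℝ g H y) H (Φ 0 y) := by
      rw [h.zero]
      exact hg.hasFDerivWithinAt
    exact h1.comp_hasDerivWithinAt 0 hΦ fun t ht => h.mem y hy t ht
  have hA : ∀ i, HasDerivWithinAt (fun t => A t y (e i)) (fderivWithin ℝ X H y (e i))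
      (Ici 0) 0 := by
    intro i
    have := (h.hasDerivWithinAt_fderiv y hy).clm_apply
      (hasDerivWithinAt_const (0 : ℝ) (Ici 0) (e i))
    simpa using this
  have h0 : imageGram g (Φ 0 y) (A 0 y) e = fun i j => if i = j then 1 else 0 := by
    funext i j
    rw [h.zero, h.fderiv_zero y hy, ← he i j]
    rfl
  refine (hasDerivWithinAt_sqrt_det (N := fun i j => fderivWithin ℝ g H y (X y) (e i) (e j) +
    g y (fderivWithin ℝ X H y (e i)) (e j) + g y (e i) (fderivWithin ℝ X H y (e j))) h0
      fun i j => ?_).congr_deriv (Finset.mul_sum _ _ _)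
  refine ((hgΦ.clm_apply (hA i)).clm_apply (hA j)).congr_deriv ?_
  simp only [h.zero, h.fderiv_zero y hy, _root_.add_apply]
  rfl

/-- The volume factors of a flow on all planes over a compact set are Lipschitz at time `0`,
uniformly. -/
theorem IsDifferentiableFlow.exists_abs_sqrt_det_imageGram_sub_one_le [FiniteDimensional ℝ E]
    (h : IsDifferentiableFlow X H K T C Φ A) (hK : IsCompact K) (hu : UniqueDiffOn ℝ H)
    {D : Set E} (hDH : ∀ y ∈ D, D ∈ 𝓝[H] y) (hKD : K ⊆ D) (hD : D ⊆ H)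
    (hg : IsMetricOn g D) (hgs : ContDiffOn ℝ ∞ g D) (hX : ContinuousOn X H) (m : ℕ) :
    ∃ T' > 0, T' ≤ T ∧ ∃ c : ℝ, ∀ t ∈ Icc 0 T', ∀ y ∈ K, ∀ e : Fin m → E,
      IsOrthonormalFor (g y) e →
        |√(Matrix.of (imageGram g (Φ t y) (A t y) e)).det - 1| ≤ c * t := by
  have hgs' : ∀ y ∈ D, ContDiffWithinAt ℝ ∞ g H y := fun y hy =>
    (hgs y hy).mono_of_mem_nhdsWithin (hDH y hy)
  obtain ⟨G, hG⟩ := hK.exists_bound_of_continuousOn (hgs.continuousOn.mono hKD)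
  obtain ⟨B, hB, hBle⟩ := hg.exists_sq_norm_le hgs.continuousOn hK hKD
  have hDg : ContinuousOn (fun y => fderivWithin ℝ g H y (X y)) K := by
    refine ContinuousOn.clm_apply (fun y hy => ?_) (hX.mono (hKD.trans hD))
    exact (((hgs' y (hKD hy)).fderivWithin_right hu (m := 0) (by simp)
      (hD (hKD hy))).continuousWithinAt).mono (hKD.trans hD)
  obtain ⟨G', hG'⟩ := hK.exists_bound_of_continuousOn hDg
  obtain ⟨ρ, hρ, c, hc⟩ := exists_abs_sqrt_det_sub_one_le (Fin m)
  -- `a` bounds the derivative of the flow, and `L t` the distance of the Gram matrix at time `t`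
  -- from the identity
  set a : ℝ := 1 + |C| * T with ha
  have hT := h.pos
  have ha1 : 1 ≤ a := by
    rw [ha]
    have : 0 ≤ |C| * T := by positivity
    linarith
  set L : ℝ := |G'| * a * a * B + 2 * (|G| * a * |C| * B) with hL
  have hL0 : 0 ≤ L := by positivity
  refine ⟨min T (ρ / (L + 1) / 2), by positivity, min_le_left _ _, c * L,
    fun t ht y hy e he => ?_⟩
  have htT : t ∈ Icc 0 T := ⟨ht.1, ht.2.trans (min_le_left _ _)⟩
  have hyH : y ∈ H := hD (hKD hy)
  have ht0 : 0 ≤ t := ht.1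
  rw [mul_assoc]
  refine hc _ (by positivity) ?_ _ fun i j => ?_
  · have h1 : t < ρ / (L + 1) := (ht.2.trans (min_le_right _ _)).trans_lt
      (by have : 0 < ρ / (L + 1) := by positivity
          linarith)
    rw [lt_div_iff₀ (by positivity)] at h1
    nlinarith
  have hen : ∀ i, ‖e i‖ ≤ √B := by
    intro i
    refine Real.le_sqrt_of_sq_le ?_
    have := hBle y hy (e i)
    rwa [he i i, if_pos rfl, mul_one] at this
  have hA1 : ‖A t y - 1‖ ≤ |C| * t := (h.norm_fderiv_sub_le t htT y hyH).trans
    (by gcongr; exact le_abs_self C)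
  have hAn : ‖A t y‖ ≤ a := by
    have h1 : ‖A t y‖ ≤ ‖A t y - 1‖ + ‖(1 : E →L[ℝ] E)‖ := by
      simpa using norm_add_le (A t y - 1) 1
    have h2 : ‖(1 : E →L[ℝ] E)‖ ≤ 1 := ContinuousLinearMap.norm_id_le
    have h3 : |C| * t ≤ |C| * T := by gcongr; exact htT.2
    rw [ha]
    linarith
  have hgt : ‖g (Φ t y) - g y‖ ≤ |G'| * t := by
    have h1 := norm_image_sub_le_of_norm_deriv_le_segment' (f := fun t => g (Φ t y)) (a := 0)
      (b := T) (C := |G'|) (f' := fun s => fderivWithin ℝ g H (Φ s y) (X (Φ s y)))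
      (fun s hs => by
        have h2 := h.mem_support y hy s hs.1
        have h3 : HasFDerivWithinAt g (fderivWithin ℝ g H (Φ s y)) H (Φ s y) :=
          ((hgs' _ (hKD h2)).differentiableWithinAt (by simp)).hasFDerivWithinAt
        exact h3.comp_hasDerivWithinAt s (h.hasDerivAt y hyH s hs.1).hasDerivWithinAt
          fun r hr => h.mem y hyH r hr.1)
      (fun s hs => (hG' _ (h.mem_support y hy s hs.1)).trans (le_abs_self _)) t htT
    simpa [h.zero] using h1
  have hgy : ‖g y‖ ≤ |G| := (hG y hy).trans (le_abs_self _)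
  have hAe : ∀ i, ‖A t y (e i)‖ ≤ a * √B := fun i =>
    (A t y).le_of_opNorm_le_of_le hAn (hen i)
  have hAe1 : ∀ i, ‖(A t y - 1) (e i)‖ ≤ |C| * t * √B := fun i =>
    (A t y - 1).le_of_opNorm_le_of_le hA1 (hen i)
  have hsplit : imageGram g (Φ t y) (A t y) e i j - (if i = j then 1 else 0) =
      (g (Φ t y) - g y) (A t y (e i)) (A t y (e j)) +
        (g y ((A t y - 1) (e i)) (A t y (e j)) + g y (e i) ((A t y - 1) (e j))) := by
    rw [← he i j, imageGram]
    simp only [_root_.sub_apply, map_sub, one_apply_eq_self]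
    ring
  have hBB : √B * √B = B := Real.mul_self_sqrt hB.le
  rw [hsplit, ← Real.norm_eq_abs]
  have hb1 : ‖(g (Φ t y) - g y) (A t y (e i)) (A t y (e j))‖ ≤
      |G'| * t * (a * √B) * (a * √B) :=
    (ContinuousLinearMap.le_opNorm₂ _ _ _).trans (by gcongr <;> apply hAe)
  have hb2 : ‖g y ((A t y - 1) (e i)) (A t y (e j))‖ ≤ |G| * (|C| * t * √B) * (a * √B) :=
    (ContinuousLinearMap.le_opNorm₂ _ _ _).trans
      (by gcongr <;> first | apply hAe | apply hAe1)
  have hb3 : ‖g y (e i) ((A t y - 1) (e j))‖ ≤ |G| * (a * √B) * (|C| * t * √B) := by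
    refine (ContinuousLinearMap.le_opNorm₂ _ _ _).trans ?_
    have : ‖e i‖ ≤ a * √B := (hen i).trans (le_mul_of_one_le_left (Real.sqrt_nonneg _) ha1)
    gcongr
    apply hAe1
  refine (norm_add_le _ _).trans ((add_le_add hb1 ((norm_add_le _ _).trans
    (add_le_add hb2 hb3))).trans (le_of_eq ?_))
  rw [hL]
  linear_combination (|G'| * t * a * a + 2 * |G| * |C| * t * a) * hBB

end CoordinateJacobian

/-! ### The metric in the preferred chart -/

section ChartMetric

set_option maxSynthPendingDepth 3

variable {n : ℕ} {N : Type*} [TopologicalSpace N]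
  [ChartedSpace (EuclideanHalfSpace (n + 1)) N]

/-- The zeroth coordinate, whose sign defines the model half-space. -/
def coordZero (n : ℕ) : EuclideanSpace ℝ (Fin (n + 1)) →L[ℝ] ℝ := EuclideanSpace.proj 0

theorem range_eq_nonneg : range (𝓡∂ (n + 1)) = {y | 0 ≤ coordZero n y} :=
  range_modelWithCornersEuclideanHalfSpace (n + 1)

theorem coordZero_extChartAt {p : N} (hp : p ∈ (𝓡∂ (n + 1)).boundary N) :
    coordZero n (extChartAt (𝓡∂ (n + 1)) p p) = 0 := by
  have h1 : extChartAt (𝓡∂ (n + 1)) p p ∈ frontier (range (𝓡∂ (n + 1))) := hp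
  rw [frontier_range_modelWithCornersEuclideanHalfSpace] at h1
  exact h1.symm

theorem exists_isOpen_target (p : N) : ∃ O, IsOpen O ∧
    (extChartAt (𝓡∂ (n + 1)) p).target = {y | 0 ≤ coordZero n y} ∩ O :=
  ⟨(𝓡∂ (n + 1)).symm ⁻¹' (chartAt (EuclideanHalfSpace (n + 1)) p).target,
    (chartAt _ p).open_target.preimage (𝓡∂ (n + 1)).continuous_symm, by
      rw [extChartAt_target, range_eq_nonneg, inter_comm]⟩

theorem mem_nonneg_extChartAt (p : N) :
    extChartAt (𝓡∂ (n + 1)) p p ∈ {y | 0 ≤ coordZero n y} := by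
  rw [← range_eq_nonneg]
  exact mem_range_self _

theorem uniqueDiffOn_nonneg : UniqueDiffOn ℝ {y | 0 ≤ coordZero n y} := by
  rw [← range_eq_nonneg]
  exact (𝓡∂ (n + 1)).uniqueDiffOn

theorem target_mem_nhdsWithin {p : N} {y : EuclideanSpace ℝ (Fin (n + 1))}
    (hy : y ∈ (extChartAt (𝓡∂ (n + 1)) p).target) :
    (extChartAt (𝓡∂ (n + 1)) p).target ∈ 𝓝[{y | 0 ≤ coordZero n y}] y := by
  rw [← range_eq_nonneg]
  exact extChartAt_target_mem_nhdsWithin_of_mem hy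

variable [IsManifold (𝓡∂ (n + 1)) ∞ N]

/-- The trivialization of the tangent bundle given by the preferred chart at `p`. -/
abbrev chartTriv (p : N) := trivializationAt (EuclideanSpace ℝ (Fin (n + 1)))
  (fun x : N => TangentSpace (𝓡∂ (n + 1)) x) p

theorem mem_baseSet_iff {p x : N} :
    x ∈ (chartTriv (n := n) p).baseSet ↔ x ∈ (extChartAt (𝓡∂ (n + 1)) p).source := by
  rw [extChartAt_source]
  exact Iff.rfl

theorem symmL_of_notMem {p x : N} (hx : x ∉ (extChartAt (𝓡∂ (n + 1)) p).source)
    (v : EuclideanSpace ℝ (Fin (n + 1))) : (chartTriv (n := n) p).symmL ℝ x v = 0 :=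
  (chartTriv (n := n) p).symmL_apply_of_notMem (fun h => hx (mem_baseSet_iff.1 h)) v

theorem symmL_self (p : N) (v : EuclideanSpace ℝ (Fin (n + 1))) :
    (chartTriv (n := n) p).symmL ℝ p v = v := by
  have : IsManifold (𝓡∂ (n + 1)) 1 N := IsManifold.of_le (n := ∞) (by simp)
  rw [TangentBundle.symmL_trivializationAt (mem_chart_source _ p),
    mfderivWithin_range_extChartAt_symm]
  rfl

theorem continuousLinearMapAt_symmL {p x : N} (hx : x ∈ (extChartAt (𝓡∂ (n + 1)) p).source)
    (v : EuclideanSpace ℝ (Fin (n + 1))) :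
    (chartTriv (n := n) p).continuousLinearMapAt ℝ x ((chartTriv (n := n) p).symmL ℝ x v) = v :=
  (chartTriv (n := n) p).continuousLinearMapAt_symmL (mem_baseSet_iff.2 hx) v

theorem symmL_continuousLinearMapAt {p x : N} (hx : x ∈ (extChartAt (𝓡∂ (n + 1)) p).source)
    (v : TangentSpace (𝓡∂ (n + 1)) x) :
    (chartTriv (n := n) p).symmL ℝ x ((chartTriv (n := n) p).continuousLinearMapAt ℝ x v) = v :=
  (chartTriv (n := n) p).symmL_continuousLinearMapAt (mem_baseSet_iff.2 hx) v

variable [RiemannianBundle (fun x : N => TangentSpace (𝓡∂ (n + 1)) x)]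

/-- The metric read in the preferred chart at `p`, as a field of bilinear forms. -/
def pullbackMetric (p : N) (y : EuclideanSpace ℝ (Fin (n + 1))) :
    EuclideanSpace ℝ (Fin (n + 1)) →L[ℝ] EuclideanSpace ℝ (Fin (n + 1)) →L[ℝ] ℝ :=
  (innerSL ℝ (E := TangentSpace (𝓡∂ (n + 1))
    ((extChartAt (𝓡∂ (n + 1)) p).symm y))).bilinearComp
      ((chartTriv (n := n) p).symmL ℝ _) ((chartTriv (n := n) p).symmL ℝ _)

theorem pullbackMetric_apply (p : N) (y u v : EuclideanSpace ℝ (Fin (n + 1))) :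
    pullbackMetric p y u v = chartMetric p u v y := rfl

theorem pullbackMetric_extChartAt {p x : N} (hx : x ∈ (extChartAt (𝓡∂ (n + 1)) p).source)
    (u v : EuclideanSpace ℝ (Fin (n + 1))) :
    pullbackMetric p (extChartAt (𝓡∂ (n + 1)) p x) u v =
      inner ℝ ((chartTriv (n := n) p).symmL ℝ x u) ((chartTriv (n := n) p).symmL ℝ x v) := by
  rw [pullbackMetric_apply, chartMetric, (extChartAt (𝓡∂ (n + 1)) p).left_inv hx]

theorem isMetricOn_pullbackMetric (p : N) :
    IsMetricOn (pullbackMetric (n := n) p) (extChartAt (𝓡∂ (n + 1)) p).target := by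
  refine ⟨fun y _ u v => by
    simp only [pullbackMetric_apply, chartMetric]
    exact real_inner_comm _ _, fun y hy v hv => ?_⟩
  rw [pullbackMetric_apply, chartMetric]
  refine real_inner_self_pos.2 fun h0 => hv ?_
  have h1 := (extChartAt (𝓡∂ (n + 1)) p).map_target hy
  rw [← continuousLinearMapAt_symmL h1 v, h0, map_zero]

theorem pullbackMetric_self (p : N) (u v : TangentSpace (𝓡∂ (n + 1)) p) :
    pullbackMetric p (extChartAt (𝓡∂ (n + 1)) p p) u v = inner ℝ u v := by
  refine (pullbackMetric_extChartAt (mem_extChartAt_source p) u v).trans ?_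
  exact congrArg₂ (fun a b : TangentSpace (𝓡∂ (n + 1)) p => inner ℝ a b)
    (symmL_self (n := n) p u) (symmL_self (n := n) p v)

/-- The gradient of the boundary coordinate is a positive multiple of the inward unit normal. -/
theorem eq_smul_inwardNormal {p : N} {V : EuclideanSpace ℝ (Fin (n + 1))}
    (hV : pullbackMetric p (extChartAt (𝓡∂ (n + 1)) p p) V = coordZero n) :
    V = √(pullbackMetric p (extChartAt (𝓡∂ (n + 1)) p p) V V) •
      (inwardNormal p : EuclideanSpace ℝ (Fin (n + 1))) := by
  set W : TangentSpace (𝓡∂ (n + 1)) p := V with hW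
  have hinner : ∀ v : TangentSpace (𝓡∂ (n + 1)) p, inner ℝ W v = boundaryCoord p v := fun v => by
    have h1 := pullbackMetric_self p W v
    rw [hW, hV] at h1
    exact h1.symm
  have hnorm : √(pullbackMetric p (extChartAt (𝓡∂ (n + 1)) p p) V V) = ‖W‖ := by
    rw [norm_eq_sqrt_real_inner]
    exact congrArg _ (pullbackMetric_self p W W)
  have hne : W ≠ 0 := by
    intro h0
    obtain ⟨w, hw⟩ := boundaryCoord_surjective (n := n) p 1
    have h1 := hinner w
    rw [h0, inner_zero_left, hw] at h1
    exact zero_ne_one h1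
  have hpos : 0 < ‖W‖ := norm_pos_iff.2 hne
  have hunit : IsInwardUnitNormal p (‖W‖⁻¹ • W) := by
    refine ⟨by rw [norm_smul, norm_inv, norm_norm, inv_mul_cancel₀ hpos.ne'], fun v hv => ?_, ?_⟩
    · rw [real_inner_smul_left, hinner v, LinearMap.mem_ker.1 hv, mul_zero]
    · rw [map_smul, ← hinner W, real_inner_self_eq_norm_sq, smul_eq_mul]
      positivity
  have h2 : ‖W‖⁻¹ • W = inwardNormal p :=
    (existsUnique_isInwardUnitNormal p).unique hunit (isInwardUnitNormal_inwardNormal p)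
  have h3 : W = ‖W‖ • inwardNormal p := by rw [← h2, smul_inv_smul₀ hpos.ne']
  rw [hnorm]
  exact h3

variable [IsContMDiffRiemannianBundle (𝓡∂ (n + 1)) ∞ (EuclideanSpace ℝ (Fin (n + 1)))
      (fun x : N => TangentSpace (𝓡∂ (n + 1)) x)]

theorem contDiffOn_pullbackMetric (p : N) :
    ContDiffOn ℝ ∞ (pullbackMetric (n := n) p) (extChartAt (𝓡∂ (n + 1)) p).target := by
  refine contDiffOn_clm_apply.2 fun u => contDiffOn_clm_apply.2 fun v => ?_
  have hsec : ∀ u : EuclideanSpace ℝ (Fin (n + 1)), ContMDiffOn (𝓡∂ (n + 1))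
      ((𝓡∂ (n + 1)).prod 𝓘(ℝ, EuclideanSpace ℝ (Fin (n + 1)))) ∞
      (fun x : N => (⟨x, (chartTriv (n := n) p).symmL ℝ x u⟩ :
        TotalSpace (EuclideanSpace ℝ (Fin (n + 1))) fun x : N => TangentSpace (𝓡∂ (n + 1)) x))
      (chartTriv (n := n) p).baseSet := by
    intro u
    rw [(chartTriv (n := n) p).contMDiffOn_section_baseSet_iff]
    refine (contMDiffOn_const (c := u)).congr fun x hx => ?_
    have := continuousLinearMapAt_symmL (mem_baseSet_iff.1 hx) u
    rwa [Trivialization.continuousLinearMapAt_apply,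
      (chartTriv (n := n) p).coe_linearMapAt_of_mem hx] at this
  have h1 := (hsec u).inner_bundle (hsec v)
  have h2 := h1.comp (contMDiffOn_extChartAt_symm (I := 𝓡∂ (n + 1)) (n := ∞) p) fun y hy =>
    mem_baseSet_iff.2 ((extChartAt (𝓡∂ (n + 1)) p).map_target hy)
  exact contMDiffOn_iff_contDiffOn.1 h2

/-! ### The curvature of the boundary in the chart -/

/-- The derivative of the metric at `p` in the preferred chart. -/
def pullbackMetricDeriv (p : N) : EuclideanSpace ℝ (Fin (n + 1)) →L[ℝ]
    EuclideanSpace ℝ (Fin (n + 1)) →L[ℝ] EuclideanSpace ℝ (Fin (n + 1)) →L[ℝ] ℝ :=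
  fderivWithin ℝ (pullbackMetric p) {y | 0 ≤ coordZero n y} (extChartAt (𝓡∂ (n + 1)) p p)

theorem chartMetricDeriv_eq (p : N) (w u v : EuclideanSpace ℝ (Fin (n + 1))) :
    chartMetricDeriv p w u v = pullbackMetricDeriv p w u v := by
  have hq := mem_extChartAt_target (I := 𝓡∂ (n + 1)) p
  have h0 : ContDiffWithinAt ℝ ∞ (pullbackMetric (n := n) p) {y | 0 ≤ coordZero n y}
      (extChartAt (𝓡∂ (n + 1)) p p) :=
    (contDiffOn_pullbackMetric p _ hq).mono_of_mem_nhdsWithin (target_mem_nhdsWithin hq)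
  have h1 := (h0.differentiableWithinAt (by simp)).hasFDerivWithinAt
  have h2 := (h1.clm_apply (hasFDerivWithinAt_const u _ _)).clm_apply
    (hasFDerivWithinAt_const v _ _)
  rw [chartMetricDeriv, range_eq_nonneg]
  have h3 := h2.fderivWithin (uniqueDiffOn_nonneg _ (mem_nonneg_extChartAt p))
  refine (DFunLike.congr_fun h3 w).trans ?_
  simp [pullbackMetricDeriv]

theorem christoffel_eq (p : N) (u v w : EuclideanSpace ℝ (Fin (n + 1))) :
    christoffel p u v w = (pullbackMetricDeriv p u v w + pullbackMetricDeriv p v u w -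
      pullbackMetricDeriv p w u v) / 2 := by
  simp only [christoffel, chartMetricDeriv_eq]

theorem christoffelDiag_eq_christoffel (p : N) (e w : EuclideanSpace ℝ (Fin (n + 1))) :
    christoffelDiag (pullbackMetricDeriv p) e w = christoffel p e e w := by
  have h1 : chartMetric (n := n) p e w = chartMetric p w e := by
    funext y
    exact real_inner_comm _ _
  have h2 : chartMetricDeriv (n := n) p e e w = chartMetricDeriv p e w e := by
    rw [chartMetricDeriv, chartMetricDeriv, h1]
  rw [christoffel, h2, christoffelDiag, ← chartMetricDeriv_eq, ← chartMetricDeriv_eq]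
  ring

/-- The form `⟪∇_u v, w⟫` as a bilinear form in `u` and `v`. -/
def christoffelForm (p : N) (w : EuclideanSpace ℝ (Fin (n + 1))) :
    EuclideanSpace ℝ (Fin (n + 1)) →ₗ[ℝ] EuclideanSpace ℝ (Fin (n + 1)) →ₗ[ℝ] ℝ :=
  LinearMap.mk₂ ℝ (fun u v => christoffel p u v w)
    (fun u u' v => by
      simp only [christoffel_eq, map_add, _root_.add_apply]
      ring)
    (fun a u v => by
      simp only [christoffel_eq, map_smul, _root_.smul_apply, smul_eq_mul]
      ring)
    (fun u v v' => by
      simp only [christoffel_eq, map_add, _root_.add_apply]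
      ring)
    (fun a u v => by
      simp only [christoffel_eq, map_smul, _root_.smul_apply, smul_eq_mul]
      ring)

theorem christoffel_smul (p : N) (a : ℝ) (u v w : EuclideanSpace ℝ (Fin (n + 1))) :
    christoffel p u v (a • w) = a * christoffel p u v w := by
  simp only [christoffel_eq, map_smul, _root_.smul_apply, smul_eq_mul]
  ring

/-- The Hessian of the boundary coordinate, restricted to the tangent space of the boundary, is
minus the second fundamental form times the length of the gradient; its traces are estimated by
Ky Fan's inequality. -/
theorem sum_principalCurvature_mul_le {p : N} {m : ℕ} (hm : m ≤ n)
    {V : EuclideanSpace ℝ (Fin (n + 1))}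
    (hV : pullbackMetric p (extChartAt (𝓡∂ (n + 1)) p p) V = coordZero n)
    {e : Fin m → EuclideanSpace ℝ (Fin (n + 1))}
    (he : IsOrthonormalFor (pullbackMetric p (extChartAt (𝓡∂ (n + 1)) p p)) e)
    (h0 : ∀ i, coordZero n (e i) = 0) :
    (∑ i : Fin m, principalCurvature p (Fin.castLE hm i)) *
        √(pullbackMetric p (extChartAt (𝓡∂ (n + 1)) p p) V V) ≤
      ∑ i, christoffelDiag (pullbackMetricDeriv p) (e i) V := by
  set a := √(pullbackMetric p (extChartAt (𝓡∂ (n + 1)) p p) V V) with ha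
  have hVν := eq_smul_inwardNormal hV
  rw [← ha] at hVν
  have hsum : ∀ i, christoffelDiag (pullbackMetricDeriv p) (e i) V =
      a * christoffel p (e i) (e i) (inwardNormal p) := by
    intro i
    rw [christoffelDiag_eq_christoffel]
    conv_lhs => rw [hVν]
    exact christoffel_smul p a _ _ _
  rw [Finset.sum_congr rfl fun i _ => hsum i, ← Finset.mul_sum, mul_comm]
  refine mul_le_mul_of_nonneg_left ?_ (Real.sqrt_nonneg _)
  let v : Fin m → boundaryTangent (n := n) p := fun i => ⟨e i, LinearMap.mem_ker.2 (h0 i)⟩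
  have hv : Orthonormal ℝ v := by
    refine orthonormal_iff_ite.2 fun i j => ?_
    rw [← he i j]
    exact (pullbackMetric_self p (v i).1 (v j).1).symm
  let sub : boundaryTangent (n := n) p →ₗ[ℝ] EuclideanSpace ℝ (Fin (n + 1)) :=
    (boundaryTangent (n := n) p).subtype
  have key := sum_eigenvalues_le_sum_apply hm
    ((stdOrthonormalBasis ℝ (boundaryTangent (n := n) p)).reindex
      (finCongr (finrank_boundaryTangent p)))
    ((christoffelForm p (inwardNormal p)).compl₁₂ sub sub)
    (S := secondFundamentalMatrix p)
    (secondFundamentalMatrix_isHermitian p) (fun i j => by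
      rw [secondFundamentalMatrix]
      rfl) hv
  have h1 : ∀ i, ((christoffelForm p (inwardNormal p)).compl₁₂ sub sub) (v i) (v i) =
      christoffel p (e i) (e i) (inwardNormal p) := fun i => rfl
  simp only [h1] at key
  simp only [principalCurvature]
  exact key

end ChartMetric

/-! ### Vector fields and flows supported in a chart -/

section ChartFlow

set_option maxSynthPendingDepth 3

variable {n : ℕ} {N : Type*} [TopologicalSpace N]
  [ChartedSpace (EuclideanHalfSpace (n + 1)) N] [IsManifold (𝓡∂ (n + 1)) ∞ N]

theorem isManifold_one : IsManifold (𝓡∂ (n + 1)) 1 N := IsManifold.of_le (n := ∞) (by simp)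

/-- The inverse of the preferred chart at `p` has one-sided derivative
`(chartTriv p).symmL`. -/
theorem hasMFDerivWithinAt_extChartAt_symm {p x : N}
    (hx : x ∈ (extChartAt (𝓡∂ (n + 1)) p).source) :
    HasMFDerivWithinAt 𝓘(ℝ, EuclideanSpace ℝ (Fin (n + 1))) (𝓡∂ (n + 1))
      (extChartAt (𝓡∂ (n + 1)) p).symm {y | 0 ≤ coordZero n y} (extChartAt (𝓡∂ (n + 1)) p x)
      (mfderivWithin 𝓘(ℝ, EuclideanSpace ℝ (Fin (n + 1))) (𝓡∂ (n + 1))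
        (extChartAt (𝓡∂ (n + 1)) p).symm (range (𝓡∂ (n + 1))) (extChartAt (𝓡∂ (n + 1)) p x)) := by
  have := isManifold_one (n := n) (N := N)
  rw [← range_eq_nonneg]
  exact (mdifferentiableWithinAt_extChartAt_symm
    ((extChartAt (𝓡∂ (n + 1)) p).map_source hx)).hasMFDerivWithinAt

theorem symmL_eq_mfderivWithin {p x : N} (hx : x ∈ (extChartAt (𝓡∂ (n + 1)) p).source) :
    (chartTriv (n := n) p).symmL ℝ x =
      mfderivWithin 𝓘(ℝ, EuclideanSpace ℝ (Fin (n + 1))) (𝓡∂ (n + 1))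
        (extChartAt (𝓡∂ (n + 1)) p).symm (range (𝓡∂ (n + 1)))
        (extChartAt (𝓡∂ (n + 1)) p x) := by
  have := isManifold_one (n := n) (N := N)
  exact TangentBundle.symmL_trivializationAt (by rwa [extChartAt_source] at hx)

/-- The vector field on `N` which is `Y` in the preferred chart at `p`, and zero outside the domain
of this chart, where `Trivialization.symmL` is zero by convention. -/
def chartField (p : N) (Y : EuclideanSpace ℝ (Fin (n + 1)) → EuclideanSpace ℝ (Fin (n + 1)))
    (x : N) : TangentSpace (𝓡∂ (n + 1)) x :=
  (chartTriv (n := n) p).symmL ℝ x (Y (extChartAt (𝓡∂ (n + 1)) p x))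

variable {p : N} {Y : EuclideanSpace ℝ (Fin (n + 1)) → EuclideanSpace ℝ (Fin (n + 1))}
  {K : Set (EuclideanSpace ℝ (Fin (n + 1)))}

omit [IsManifold (𝓡∂ (n + 1)) ∞ N] in
theorem isCompact_image_extChartAt_symm (hK : IsCompact K)
    (hKt : K ⊆ (extChartAt (𝓡∂ (n + 1)) p).target) :
    IsCompact ((extChartAt (𝓡∂ (n + 1)) p).symm '' K) :=
  hK.image_of_continuousOn ((continuousOn_extChartAt_symm p).mono hKt)

theorem chartField_eq_zero (h0 : ∀ y ∈ {y | 0 ≤ coordZero n y} \ K, Y y = 0) {x : N}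
    (hx : x ∉ (extChartAt (𝓡∂ (n + 1)) p).symm '' K) : chartField p Y x = 0 := by
  by_cases hxs : x ∈ (extChartAt (𝓡∂ (n + 1)) p).source
  · rw [chartField, h0 _ ⟨?_, fun hK => hx ⟨_, hK, (extChartAt (𝓡∂ (n + 1)) p).left_inv hxs⟩⟩,
      map_zero]
    rw [← range_eq_nonneg]
    exact mem_range_self _
  · exact symmL_of_notMem hxs _

theorem contMDiff_chartField [T2Space N] (hY : ContDiffOn ℝ ∞ Y {y | 0 ≤ coordZero n y})
    (hK : IsCompact K) (hKt : K ⊆ (extChartAt (𝓡∂ (n + 1)) p).target)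
    (h0 : ∀ y ∈ {y | 0 ≤ coordZero n y} \ K, Y y = 0) :
    ContMDiff (𝓡∂ (n + 1)) (𝓡∂ (n + 1)).tangent ∞
      (fun x => (⟨x, chartField p Y x⟩ : TangentBundle (𝓡∂ (n + 1)) N)) := by
  intro x
  by_cases hx : x ∈ (extChartAt (𝓡∂ (n + 1)) p).source
  · refine ((chartTriv (n := n) p).contMDiffAt_section_iff (mem_baseSet_iff.2 hx)).2 ?_
    have hs : (extChartAt (𝓡∂ (n + 1)) p).source ∈ 𝓝 x :=
      (isOpen_extChartAt_source p).mem_nhds hx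
    have h1 : ContMDiffAt (𝓡∂ (n + 1)) 𝓘(ℝ, EuclideanSpace ℝ (Fin (n + 1))) ∞
        (fun z => Y (extChartAt (𝓡∂ (n + 1)) p z)) x := by
      have h2 := hY.contMDiffOn.comp (contMDiffOn_extChartAt (I := 𝓡∂ (n + 1)) (n := ∞) (x := p))
        (fun z _ => by
          change extChartAt (𝓡∂ (n + 1)) p z ∈ {y | 0 ≤ coordZero n y}
          rw [← range_eq_nonneg]
          exact mem_range_self _)
      exact h2.contMDiffAt (by rwa [extChartAt_source] at hs)
    refine h1.congr_of_eventuallyEq ?_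
    filter_upwards [hs] with z hz
    have := continuousLinearMapAt_symmL hz (Y (extChartAt (𝓡∂ (n + 1)) p z))
    rwa [Trivialization.continuousLinearMapAt_apply,
      (chartTriv (n := n) p).coe_linearMapAt_of_mem (mem_baseSet_iff.2 hz)] at this
  · have hclosed := (isCompact_image_extChartAt_symm hK hKt).isClosed
    have hxK : x ∉ (extChartAt (𝓡∂ (n + 1)) p).symm '' K := by
      rintro ⟨y, hy, rfl⟩
      exact hx ((extChartAt (𝓡∂ (n + 1)) p).map_target (hKt hy))
    refine (contMDiff_zeroSection ℝ
      (fun x : N => TangentSpace (𝓡∂ (n + 1)) x) x).congr_of_eventuallyEq ?_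
    filter_upwards [hclosed.isOpen_compl.mem_nhds hxK] with z hz
    rw [chartField_eq_zero h0 hz]
    rfl

theorem fieldSupport_chartField_subset [T2Space N]
    (hK : IsCompact K) (hKt : K ⊆ (extChartAt (𝓡∂ (n + 1)) p).target)
    (h0 : ∀ y ∈ {y | 0 ≤ coordZero n y} \ K, Y y = 0) :
    fieldSupport (chartField p Y) ⊆ (extChartAt (𝓡∂ (n + 1)) p).symm '' K := by
  refine closure_minimal (fun x hx => ?_) (isCompact_image_extChartAt_symm hK hKt).isClosed
  by_contra h
  exact hx (chartField_eq_zero h0 h)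

open Classical in
/-- The flow on `N` which is `Φ` in the preferred chart at `p`, and stationary outside the domain
of this chart. -/
def chartFlow (p : N)
    (Φ : ℝ → EuclideanSpace ℝ (Fin (n + 1)) → EuclideanSpace ℝ (Fin (n + 1))) (t : ℝ) (x : N) : N :=
  if x ∈ (extChartAt (𝓡∂ (n + 1)) p).source then
    (extChartAt (𝓡∂ (n + 1)) p).symm (Φ t (extChartAt (𝓡∂ (n + 1)) p x)) else x

variable {T C : ℝ} {Φ : ℝ → EuclideanSpace ℝ (Fin (n + 1)) → EuclideanSpace ℝ (Fin (n + 1))}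
  {A : ℝ → EuclideanSpace ℝ (Fin (n + 1)) →
    EuclideanSpace ℝ (Fin (n + 1)) →L[ℝ] EuclideanSpace ℝ (Fin (n + 1))}

omit [IsManifold (𝓡∂ (n + 1)) ∞ N] in
theorem chartFlow_of_mem {x : N} (hx : x ∈ (extChartAt (𝓡∂ (n + 1)) p).source) (t : ℝ) :
    chartFlow p Φ t x = (extChartAt (𝓡∂ (n + 1)) p).symm (Φ t (extChartAt (𝓡∂ (n + 1)) p x)) :=
  if_pos hx

omit [IsManifold (𝓡∂ (n + 1)) ∞ N] in
theorem chartFlow_of_notMem {x : N} (hx : x ∉ (extChartAt (𝓡∂ (n + 1)) p).source) (t : ℝ) :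
    chartFlow p Φ t x = x :=
  if_neg hx

omit [IsManifold (𝓡∂ (n + 1)) ∞ N] in
theorem target_subset_nonneg :
    (extChartAt (𝓡∂ (n + 1)) p).target ⊆ {y | 0 ≤ coordZero n y} := by
  rw [← range_eq_nonneg]
  exact extChartAt_target_subset_range p

omit [IsManifold (𝓡∂ (n + 1)) ∞ N] in
theorem IsDifferentiableFlow.mem_target
    (h : IsDifferentiableFlow Y {y | 0 ≤ coordZero n y} K T C Φ A)
    (hKt : K ⊆ (extChartAt (𝓡∂ (n + 1)) p).target)
    (h0 : ∀ y ∈ {y | 0 ≤ coordZero n y} \ K, Y y = 0) {y : EuclideanSpace ℝ (Fin (n + 1))}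
    (hy : y ∈ (extChartAt (𝓡∂ (n + 1)) p).target) {t : ℝ} (ht : 0 ≤ t) :
    Φ t y ∈ (extChartAt (𝓡∂ (n + 1)) p).target := by
  by_cases hyK : y ∈ K
  · exact hKt (h.mem_support y hyK t ht)
  · rwa [h.fixed y (target_subset_nonneg hy) (h0 y ⟨target_subset_nonneg hy, hyK⟩)]

/-- A flow in the chart which preserves the compact support of its field gives a flow of `N`. -/
theorem isForwardFlow_chartFlow
    (h : IsDifferentiableFlow Y {y | 0 ≤ coordZero n y} K T C Φ A)
    (hKt : K ⊆ (extChartAt (𝓡∂ (n + 1)) p).target)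
    (h0 : ∀ y ∈ {y | 0 ≤ coordZero n y} \ K, Y y = 0) :
    IsForwardFlow (chartField p Y) (chartFlow p Φ) := by
  refine ⟨?_, fun x t ht => ?_⟩
  · funext x
    by_cases hx : x ∈ (extChartAt (𝓡∂ (n + 1)) p).source
    · rw [chartFlow_of_mem hx, h.zero, (extChartAt (𝓡∂ (n + 1)) p).left_inv hx, id]
    · rw [chartFlow_of_notMem hx, id]
  by_cases hx : x ∈ (extChartAt (𝓡∂ (n + 1)) p).source
  · have hyt := (extChartAt (𝓡∂ (n + 1)) p).map_source hx
    have hzt := h.mem_target hKt h0 hyt ht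
    have hyH := target_subset_nonneg hyt
    have hcurve : HasMFDerivWithinAt 𝓘(ℝ, ℝ) 𝓘(ℝ, EuclideanSpace ℝ (Fin (n + 1)))
        (fun s => Φ s (extChartAt (𝓡∂ (n + 1)) p x)) (Ici 0) t
        ((1 : ℝ →L[ℝ] ℝ).smulRight (Y (Φ t (extChartAt (𝓡∂ (n + 1)) p x)))) :=
      hasMFDerivWithinAt_iff_hasFDerivWithinAt.2
        (h.hasDerivAt _ hyH t ht).hasDerivWithinAt.hasFDerivWithinAt
    have hz := (extChartAt (𝓡∂ (n + 1)) p).map_target hzt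
    have hsymm := hasMFDerivWithinAt_extChartAt_symm hz
    rw [(extChartAt (𝓡∂ (n + 1)) p).right_inv hzt] at hsymm
    have hsub : Ici (0 : ℝ) ⊆ (fun s => Φ s (extChartAt (𝓡∂ (n + 1)) p x)) ⁻¹'
        {y | 0 ≤ coordZero n y} := fun s hs => h.mem _ hyH s hs
    have hcomp := hsymm.comp t hcurve hsub
    have hfun : (fun s => chartFlow p Φ s x) = (extChartAt (𝓡∂ (n + 1)) p).symm ∘
        fun s => Φ s (extChartAt (𝓡∂ (n + 1)) p x) := funext fun s => chartFlow_of_mem hx s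
    have hval : chartField p Y ((extChartAt (𝓡∂ (n + 1)) p).symm
        (Φ t (extChartAt (𝓡∂ (n + 1)) p x))) =
        mfderivWithin 𝓘(ℝ, EuclideanSpace ℝ (Fin (n + 1))) (𝓡∂ (n + 1))
        (extChartAt (𝓡∂ (n + 1)) p).symm (range (𝓡∂ (n + 1)))
        (Φ t (extChartAt (𝓡∂ (n + 1)) p x)) (Y (Φ t (extChartAt (𝓡∂ (n + 1)) p x))) := by
      rw [chartField, symmL_eq_mfderivWithin hz, (extChartAt (𝓡∂ (n + 1)) p).right_inv hzt]
      rfl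
    rw [hfun]
    refine hcomp.congr_mfderiv (ContinuousLinearMap.ext fun r : ℝ => ?_)
    change mfderivWithin 𝓘(ℝ, EuclideanSpace ℝ (Fin (n + 1))) (𝓡∂ (n + 1))
        (extChartAt (𝓡∂ (n + 1)) p).symm (range (𝓡∂ (n + 1)))
        (Φ t (extChartAt (𝓡∂ (n + 1)) p x)) (r • Y (Φ t (extChartAt (𝓡∂ (n + 1)) p x))) =
      r • chartField p Y ((extChartAt (𝓡∂ (n + 1)) p).symm
        (Φ t (extChartAt (𝓡∂ (n + 1)) p x)))
    rw [hval]
    exact map_smul (mfderivWithin 𝓘(ℝ, EuclideanSpace ℝ (Fin (n + 1))) (𝓡∂ (n + 1))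
      (extChartAt (𝓡∂ (n + 1)) p).symm (range (𝓡∂ (n + 1)))
      (Φ t (extChartAt (𝓡∂ (n + 1)) p x))) r _
  · have hfun : (fun s => chartFlow p Φ s x) = fun _ => x :=
      funext fun s => chartFlow_of_notMem hx s
    have hval : chartField p Y (chartFlow p Φ t x) = 0 := by
      rw [chartFlow_of_notMem hx]
      exact symmL_of_notMem hx _
    rw [hval, hfun]
    refine (hasMFDerivWithinAt_const x (Ici (0 : ℝ)) t).congr_mfderiv
      (ContinuousLinearMap.ext fun r : ℝ => ?_)
    exact (smul_zero (A := TangentSpace (𝓡∂ (n + 1)) x) r).symm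

/-- A vector field which generates a forward flow of `N` into itself does not point out of `N` at
the boundary: the boundary coordinate is nonnegative along the integral curve, and zero at its
starting point. -/
theorem boundaryCoord_nonneg_of_isForwardFlow {X : (x : N) → TangentSpace (𝓡∂ (n + 1)) x}
    {φ : ℝ → N → N} (h : IsForwardFlow X φ) {q : N} (hq : q ∈ (𝓡∂ (n + 1)).boundary N) :
    0 ≤ boundaryCoord q (X q) := by
  have := isManifold_one (n := n) (N := N)
  have h1 := h.integralCurve q 0 self_mem_Ici
  have hφ : φ 0 q = q := congrFun h.zero q
  have h2 : HasMFDerivAt (𝓡∂ (n + 1)) 𝓘(ℝ, EuclideanSpace ℝ (Fin (n + 1)))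
      (extChartAt (𝓡∂ (n + 1)) q) (φ 0 q)
      (mfderiv (𝓡∂ (n + 1)) 𝓘(ℝ, EuclideanSpace ℝ (Fin (n + 1))) (extChartAt (𝓡∂ (n + 1)) q)
        (φ 0 q)) := by
    refine (mdifferentiableAt_extChartAt ?_).hasMFDerivAt
    rw [hφ]
    exact mem_chart_source _ q
  have hval : mfderiv (𝓡∂ (n + 1)) 𝓘(ℝ, EuclideanSpace ℝ (Fin (n + 1)))
      (extChartAt (𝓡∂ (n + 1)) q) (φ 0 q) (X (φ 0 q)) = X q := by
    rw [hφ, mfderiv_extChartAt_self]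
    rfl
  have h3 : HasFDerivWithinAt (fun s => extChartAt (𝓡∂ (n + 1)) q (φ s q))
      ((1 : ℝ →L[ℝ] ℝ).smulRight (X q : EuclideanSpace ℝ (Fin (n + 1)))) (Ici 0) 0 := by
    refine hasMFDerivWithinAt_iff_hasFDerivWithinAt.1
      ((h2.comp_hasMFDerivWithinAt 0 h1).congr_mfderiv (ContinuousLinearMap.ext fun r : ℝ => ?_))
    change mfderiv (𝓡∂ (n + 1)) 𝓘(ℝ, EuclideanSpace ℝ (Fin (n + 1)))
      (extChartAt (𝓡∂ (n + 1)) q) (φ 0 q) (r • X (φ 0 q)) = r • X q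
    rw [map_smul, hval]
    rfl
  have h4 : HasDerivWithinAt (fun s => coordZero n (extChartAt (𝓡∂ (n + 1)) q (φ s q)))
      (coordZero n (X q)) (Ici 0) 0 := by
    have h5 := ((coordZero n).hasFDerivAt.comp_hasFDerivWithinAt (0 : ℝ) h3).hasDerivWithinAt
    refine h5.congr_deriv ?_
    change coordZero n ((1 : ℝ) • (X q : EuclideanSpace ℝ (Fin (n + 1)))) = coordZero n (X q)
    rw [one_smul]
  have h5 := (hasDerivWithinAt_iff_tendsto_slope' self_notMem_Ioi).1
    (h4.mono (Ioi_subset_Ici_self (a := (0 : ℝ))))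
  refine ge_of_tendsto h5 ?_
  filter_upwards [self_mem_nhdsWithin] with t ht
  have h6 : (0 : ℝ) ≤ coordZero n (extChartAt (𝓡∂ (n + 1)) q (φ t q)) := by
    have : extChartAt (𝓡∂ (n + 1)) q (φ t q) ∈ range (𝓡∂ (n + 1)) := mem_range_self _
    rwa [range_eq_nonneg] at this
  rw [slope_def_field, hφ, coordZero_extChartAt hq, sub_zero, sub_zero]
  exact div_nonneg h6 (le_of_lt ht)

end ChartFlow

/-! ### The Jacobian of the flow on a plane -/

section FlowJacobian

set_option maxSynthPendingDepth 3

variable {n : ℕ} {N : Type*} [TopologicalSpace N]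
  [ChartedSpace (EuclideanHalfSpace (n + 1)) N] [IsManifold (𝓡∂ (n + 1)) ∞ N]
  {p : N} {Y : EuclideanSpace ℝ (Fin (n + 1)) → EuclideanSpace ℝ (Fin (n + 1))}
  {K : Set (EuclideanSpace ℝ (Fin (n + 1)))}
  {T C : ℝ} {Φ : ℝ → EuclideanSpace ℝ (Fin (n + 1)) → EuclideanSpace ℝ (Fin (n + 1))}
  {A : ℝ → EuclideanSpace ℝ (Fin (n + 1)) →
    EuclideanSpace ℝ (Fin (n + 1)) →L[ℝ] EuclideanSpace ℝ (Fin (n + 1))}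

/-- Up to the time `T`, the derivative of the flow of `N` is that of the flow in the chart. -/
theorem mfderiv_chartFlow
    (h : IsDifferentiableFlow Y {y | 0 ≤ coordZero n y} K T C Φ A)
    (hKt : K ⊆ (extChartAt (𝓡∂ (n + 1)) p).target)
    (h0 : ∀ y ∈ {y | 0 ≤ coordZero n y} \ K, Y y = 0) {x : N}
    (hx : x ∈ (extChartAt (𝓡∂ (n + 1)) p).source) {t : ℝ} (ht : t ∈ Icc 0 T)
    (v : TangentSpace (𝓡∂ (n + 1)) x) :
    mfderiv (𝓡∂ (n + 1)) (𝓡∂ (n + 1)) (chartFlow p Φ t) x v =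
      (chartTriv (n := n) p).symmL ℝ (chartFlow p Φ t x)
        (A t (extChartAt (𝓡∂ (n + 1)) p x)
          ((chartTriv (n := n) p).continuousLinearMapAt ℝ x v)) := by
  have := isManifold_one (n := n) (N := N)
  have hyt := (extChartAt (𝓡∂ (n + 1)) p).map_source hx
  have hzt := h.mem_target hKt h0 hyt ht.1
  have hyH := target_subset_nonneg hyt
  have hz := (extChartAt (𝓡∂ (n + 1)) p).map_target hzt
  have hsymm := hasMFDerivWithinAt_extChartAt_symm hz
  rw [(extChartAt (𝓡∂ (n + 1)) p).right_inv hzt] at hsymm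
  have hΦ := (h.hasFDerivWithinAt t ht _ hyH).hasMFDerivWithinAt
  have hsub : {y | 0 ≤ coordZero n y} ⊆ Φ t ⁻¹' {y | 0 ≤ coordZero n y} :=
    fun y hy => h.mem y hy t ht.1
  have hc : HasMFDerivWithinAt (𝓡∂ (n + 1)) 𝓘(ℝ, EuclideanSpace ℝ (Fin (n + 1)))
      (extChartAt (𝓡∂ (n + 1)) p) univ x
      (mfderiv (𝓡∂ (n + 1)) 𝓘(ℝ, EuclideanSpace ℝ (Fin (n + 1))) (extChartAt (𝓡∂ (n + 1)) p)
        x) :=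
    (mdifferentiableAt_extChartAt
      (by rwa [extChartAt_source] at hx)).hasMFDerivAt.hasMFDerivWithinAt
  have hsub2 : univ ⊆ extChartAt (𝓡∂ (n + 1)) p ⁻¹' {y | 0 ≤ coordZero n y} := fun z _ => by
    rw [← range_eq_nonneg]
    exact mem_range_self _
  have hcomp := (hsymm.comp _ hΦ hsub).comp x hc hsub2
  have hmain := hcomp.hasMFDerivAt Filter.univ_mem
  have hcongr : chartFlow p Φ t =ᶠ[𝓝 x]
      ((extChartAt (𝓡∂ (n + 1)) p).symm ∘ Φ t) ∘ extChartAt (𝓡∂ (n + 1)) p := by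
    filter_upwards [(isOpen_extChartAt_source p).mem_nhds hx] with z hz
    exact chartFlow_of_mem hz t
  have hfinal := (hmain.congr_of_eventuallyEq hcongr).mfderiv
  have hval : chartFlow p Φ t x =
      (extChartAt (𝓡∂ (n + 1)) p).symm (Φ t (extChartAt (𝓡∂ (n + 1)) p x)) :=
    chartFlow_of_mem hx t
  have h1 : (chartTriv (n := n) p).symmL ℝ (chartFlow p Φ t x) =
      mfderivWithin 𝓘(ℝ, EuclideanSpace ℝ (Fin (n + 1))) (𝓡∂ (n + 1))
        (extChartAt (𝓡∂ (n + 1)) p).symm (range (𝓡∂ (n + 1)))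
        (Φ t (extChartAt (𝓡∂ (n + 1)) p x)) := by
    rw [hval, symmL_eq_mfderivWithin hz, (extChartAt (𝓡∂ (n + 1)) p).right_inv hzt]
  have h2 : (chartTriv (n := n) p).continuousLinearMapAt ℝ x =
      mfderiv (𝓡∂ (n + 1)) 𝓘(ℝ, EuclideanSpace ℝ (Fin (n + 1)))
        (extChartAt (𝓡∂ (n + 1)) p) x :=
    TangentBundle.continuousLinearMapAt_trivializationAt (by rwa [extChartAt_source] at hx)
  rw [h1, h2, hfinal]
  rfl

theorem chartFlow_eq_self (h : IsDifferentiableFlow Y {y | 0 ≤ coordZero n y} K T C Φ A) {x : N}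
    (hx : chartField p Y x = 0) (t : ℝ) : chartFlow p Φ t x = x := by
  by_cases hxs : x ∈ (extChartAt (𝓡∂ (n + 1)) p).source
  · have hY : Y (extChartAt (𝓡∂ (n + 1)) p x) = 0 := by
      rw [← continuousLinearMapAt_symmL hxs (Y (extChartAt (𝓡∂ (n + 1)) p x))]
      exact (congrArg _ hx).trans (map_zero _)
    rw [chartFlow_of_mem hxs,
      h.fixed _ (target_subset_nonneg ((extChartAt (𝓡∂ (n + 1)) p).map_source hxs)) hY,
      (extChartAt (𝓡∂ (n + 1)) p).left_inv hxs]
  · exact chartFlow_of_notMem hxs t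

variable [RiemannianBundle (fun x : N => TangentSpace (𝓡∂ (n + 1)) x)]

theorem inner_mfderiv_chartFlow
    (h : IsDifferentiableFlow Y {y | 0 ≤ coordZero n y} K T C Φ A)
    (hKt : K ⊆ (extChartAt (𝓡∂ (n + 1)) p).target)
    (h0 : ∀ y ∈ {y | 0 ≤ coordZero n y} \ K, Y y = 0) {x : N}
    (hx : x ∈ (extChartAt (𝓡∂ (n + 1)) p).source) {t : ℝ} (ht : t ∈ Icc 0 T)
    (v w : TangentSpace (𝓡∂ (n + 1)) x) :
    inner ℝ (mfderiv (𝓡∂ (n + 1)) (𝓡∂ (n + 1)) (chartFlow p Φ t) x v)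
        (mfderiv (𝓡∂ (n + 1)) (𝓡∂ (n + 1)) (chartFlow p Φ t) x w) =
      pullbackMetric p (Φ t (extChartAt (𝓡∂ (n + 1)) p x))
        (A t (extChartAt (𝓡∂ (n + 1)) p x) ((chartTriv (n := n) p).continuousLinearMapAt ℝ x v))
        (A t (extChartAt (𝓡∂ (n + 1)) p x)
          ((chartTriv (n := n) p).continuousLinearMapAt ℝ x w)) := by
  rw [mfderiv_chartFlow h hKt h0 hx ht, mfderiv_chartFlow h hKt h0 hx ht, pullbackMetric_apply,
    chartMetric, chartFlow_of_mem hx]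

theorem inner_mfderiv_chartFlow_of_notMem
    (h : IsDifferentiableFlow Y {y | 0 ≤ coordZero n y} K T C Φ A) {x : N}
    (hx : x ∉ fieldSupport (chartField p Y)) (t : ℝ) (v w : TangentSpace (𝓡∂ (n + 1)) x) :
    inner ℝ (mfderiv (𝓡∂ (n + 1)) (𝓡∂ (n + 1)) (chartFlow p Φ t) x v)
        (mfderiv (𝓡∂ (n + 1)) (𝓡∂ (n + 1)) (chartFlow p Φ t) x w) = inner ℝ v w := by
  have hev : chartFlow p Φ t =ᶠ[𝓝 x] id := by
    filter_upwards [isClosed_closure.isOpen_compl.mem_nhds hx] with z hz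
    refine chartFlow_eq_self h ?_ t
    by_contra hne
    exact hz (subset_closure hne)
  have hd := ((hasMFDerivAt_id (I := 𝓡∂ (n + 1)) x).congr_of_eventuallyEq hev).mfderiv
  have hgen : ∀ z : N, z = x → (inner ℝ (show TangentSpace (𝓡∂ (n + 1)) z from v)
      (show TangentSpace (𝓡∂ (n + 1)) z from w) : ℝ) = inner ℝ v w := by
    rintro z rfl
    rfl
  rw [hd]
  exact hgen _ hev.eq_of_nhds

variable {m : ℕ}

omit [IsManifold (𝓡∂ (n + 1)) ∞ N] in
theorem jacobian_nonneg (S : GrassmannBundle n N m) {y : N}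
    (L : TangentSpace (𝓡∂ (n + 1)) S.base →L[ℝ] TangentSpace (𝓡∂ (n + 1)) y) :
    0 ≤ jacobian S L := Real.sqrt_nonneg _

omit [IsManifold (𝓡∂ (n + 1)) ∞ N] in
/-- The Jacobian multiplies the `m`-dimensional volume of any family of vectors of the plane. -/
theorem det_gram_eq_mul_jacobian_sq (S : GrassmannBundle n N m) {y : N}
    (L : TangentSpace (𝓡∂ (n + 1)) S.base →L[ℝ] TangentSpace (𝓡∂ (n + 1)) y)
    (f : Fin m → S.plane) :
    (Matrix.gram ℝ fun i => L (f i)).det = (Matrix.gram ℝ f).det * jacobian S L ^ 2 := by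
  have hsq : jacobian S L ^ 2 =
      (Matrix.gram ℝ fun i => L (stdOrthonormalBasis ℝ S.plane i)).det :=
    Real.sq_sqrt (Matrix.posSemidef_gram ℝ _).det_nonneg
  have hre : ∀ {F : Type _} [NormedAddCommGroup F] [InnerProductSpace ℝ F] (u : Fin m → F),
      (Matrix.gram ℝ fun i => u (finCongr S.finrank_plane i)).det = (Matrix.gram ℝ u).det :=
    fun u => Matrix.det_submatrix_equiv_self (finCongr S.finrank_plane) (Matrix.gram ℝ u)
  rw [hsq, ← hre, ← hre f]
  exact det_gram_map (stdOrthonormalBasis ℝ S.plane) L.toLinearMap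
    fun i => f (finCongr S.finrank_plane i)

omit [IsManifold (𝓡∂ (n + 1)) ∞ N] in
theorem jacobian_eq_sqrt (S : GrassmannBundle n N m) {y : N}
    (L : TangentSpace (𝓡∂ (n + 1)) S.base →L[ℝ] TangentSpace (𝓡∂ (n + 1)) y)
    {f : Fin m → S.plane} (hf : Orthonormal ℝ f) :
    jacobian S L = √(Matrix.gram ℝ fun i => L (f i)).det := by
  have h1 : (Matrix.gram ℝ f).det = 1 := by
    have : Matrix.gram ℝ f = 1 := by
      ext i j
      rw [Matrix.gram_apply, orthonormal_iff_ite.1 hf, Matrix.one_apply]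
    rw [this, Matrix.det_one]
  rw [det_gram_eq_mul_jacobian_sq, h1, one_mul, Real.sqrt_sq (jacobian_nonneg S L)]

omit [IsManifold (𝓡∂ (n + 1)) ∞ N] in
theorem GrassmannBundle.exists_orthonormal (S : GrassmannBundle n N m) :
    ∃ f : Fin m → S.plane, Orthonormal ℝ f :=
  ⟨_, ((stdOrthonormalBasis ℝ S.plane).reindex (finCongr S.finrank_plane)).orthonormal⟩

theorem jacobian_chartFlow_of_notMem
    (h : IsDifferentiableFlow Y {y | 0 ≤ coordZero n y} K T C Φ A)
    {S : GrassmannBundle n N m} (hS : S.base ∉ fieldSupport (chartField p Y)) (t : ℝ) :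
    jacobian S (mfderiv (𝓡∂ (n + 1)) (𝓡∂ (n + 1)) (chartFlow p Φ t) S.base) = 1 := by
  obtain ⟨f, hf⟩ := S.exists_orthonormal
  rw [jacobian_eq_sqrt S _ hf]
  have : (Matrix.gram ℝ fun i =>
      mfderiv (𝓡∂ (n + 1)) (𝓡∂ (n + 1)) (chartFlow p Φ t) S.base (f i)) = 1 := by
    ext i j
    rw [Matrix.gram_apply, inner_mfderiv_chartFlow_of_notMem h hS, Matrix.one_apply,
      ← orthonormal_iff_ite.1 hf]
    rfl
  rw [this, Matrix.det_one, Real.sqrt_one]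

/-- An orthonormal basis of a plane at a point of the chart is, read in the chart, orthonormal for
the metric of the chart, and computes the Jacobian of the flow. -/
theorem exists_jacobian_chartFlow_eq
    (h : IsDifferentiableFlow Y {y | 0 ≤ coordZero n y} K T C Φ A)
    (hKt : K ⊆ (extChartAt (𝓡∂ (n + 1)) p).target)
    (h0 : ∀ y ∈ {y | 0 ≤ coordZero n y} \ K, Y y = 0) {S : GrassmannBundle n N m}
    (hS : S.base ∈ (extChartAt (𝓡∂ (n + 1)) p).source) :
    ∃ e : Fin m → EuclideanSpace ℝ (Fin (n + 1)),
      IsOrthonormalFor (pullbackMetric p (extChartAt (𝓡∂ (n + 1)) p S.base)) e ∧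
      ∀ t ∈ Icc 0 T,
        jacobian S (mfderiv (𝓡∂ (n + 1)) (𝓡∂ (n + 1)) (chartFlow p Φ t) S.base) =
          √(Matrix.of (imageGram (pullbackMetric p) (Φ t (extChartAt (𝓡∂ (n + 1)) p S.base))
            (A t (extChartAt (𝓡∂ (n + 1)) p S.base)) e)).det := by
  obtain ⟨f, hf⟩ := S.exists_orthonormal
  refine ⟨fun i => (chartTriv (n := n) p).continuousLinearMapAt ℝ S.base (f i), fun i j => ?_,
    fun t ht => ?_⟩
  · rw [pullbackMetric_extChartAt hS, symmL_continuousLinearMapAt hS,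
      symmL_continuousLinearMapAt hS, ← orthonormal_iff_ite.1 hf]
    rfl
  · rw [jacobian_eq_sqrt S _ hf]
    congr 2
    ext i j
    rw [Matrix.gram_apply, inner_mfderiv_chartFlow h hKt h0 hS ht]
    rfl

end FlowJacobian

/-! ### Continuity of the Jacobian on the Grassmann bundle -/

section JacobianContinuity

set_option maxSynthPendingDepth 3

variable {n m : ℕ} {N : Type*} [TopologicalSpace N]
  [ChartedSpace (EuclideanHalfSpace (n + 1)) N] [IsManifold (𝓡∂ (n + 1)) ∞ N]
  [RiemannianBundle (fun x : N => TangentSpace (𝓡∂ (n + 1)) x)]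
  {p : N} {Y : EuclideanSpace ℝ (Fin (n + 1)) → EuclideanSpace ℝ (Fin (n + 1))}
  {K : Set (EuclideanSpace ℝ (Fin (n + 1)))}
  {T C : ℝ} {Φ : ℝ → EuclideanSpace ℝ (Fin (n + 1)) → EuclideanSpace ℝ (Fin (n + 1))}
  {A : ℝ → EuclideanSpace ℝ (Fin (n + 1)) →
    EuclideanSpace ℝ (Fin (n + 1)) →L[ℝ] EuclideanSpace ℝ (Fin (n + 1))}

/-- The orthogonal projection onto a plane, read in the preferred chart at `p`. -/
def chartProjection (p : N) (S : GrassmannBundle n N m) :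
    EuclideanSpace ℝ (Fin (n + 1)) →L[ℝ] EuclideanSpace ℝ (Fin (n + 1)) :=
  (chartTriv (n := n) p).continuousLinearMapAt ℝ S.base ∘L S.plane.starProjection ∘L
    (chartTriv (n := n) p).symmL ℝ S.base

theorem continuousOn_chartProjection (p : N) :
    ContinuousOn (chartProjection (n := n) (m := m) p)
      (GrassmannBundle.base ⁻¹' (extChartAt (𝓡∂ (n + 1)) p).source) := by
  set e := trivializationAt
    (EuclideanSpace ℝ (Fin (n + 1)) →L[ℝ] EuclideanSpace ℝ (Fin (n + 1)))
    (fun x : N => TangentSpace (𝓡∂ (n + 1)) x →L[ℝ] TangentSpace (𝓡∂ (n + 1)) x) p with he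
  have h1 : ContinuousOn (fun S : GrassmannBundle n N m => e S.toHom)
      (GrassmannBundle.base ⁻¹' (extChartAt (𝓡∂ (n + 1)) p).source) := by
    refine e.continuousOn.comp continuous_induced_dom.continuousOn fun S hS => ?_
    rw [he, hom_trivializationAt_source]
    exact ⟨mem_baseSet_iff.2 hS, mem_baseSet_iff.2 hS⟩
  exact continuous_snd.comp_continuousOn h1

theorem continuousOn_det_imageGram {α E : Type*} [TopologicalSpace α] [NormedAddCommGroup E]
    [NormedSpace ℝ E] {s : Set α} {g : E → E →L[ℝ] E →L[ℝ] ℝ} {z : α → E} {L : α → E →L[ℝ] E}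
    {e : Fin m → α → E} (hg : ContinuousOn (fun a => g (z a)) s) (hL : ContinuousOn L s)
    (he : ∀ i, ContinuousOn (e i) s) :
    ContinuousOn (fun a => (Matrix.of (imageGram g (z a) (L a) fun i => e i a)).det) s := by
  have h1 : ContinuousOn (fun a => Matrix.of (imageGram g (z a) (L a) fun i => e i a)) s :=
    continuousOn_pi.2 fun i => continuousOn_pi.2 fun j =>
      (hg.clm_apply (hL.clm_apply (he i))).clm_apply (hL.clm_apply (he j))
  exact continuous_id.matrix_det.comp_continuousOn h1

/-- Any frame of the model space, projected to a plane, computes the Jacobian of the flow on this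
plane. -/
theorem det_imageGram_chartProjection
    (h : IsDifferentiableFlow Y {y | 0 ≤ coordZero n y} K T C Φ A)
    (hKt : K ⊆ (extChartAt (𝓡∂ (n + 1)) p).target)
    (h0 : ∀ y ∈ {y | 0 ≤ coordZero n y} \ K, Y y = 0) {S : GrassmannBundle n N m}
    (hS : S.base ∈ (extChartAt (𝓡∂ (n + 1)) p).source) {t : ℝ} (ht : t ∈ Icc 0 T)
    (a : Fin m → EuclideanSpace ℝ (Fin (n + 1))) :
    (Matrix.of (imageGram (pullbackMetric p) (Φ t (extChartAt (𝓡∂ (n + 1)) p S.base))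
        (A t (extChartAt (𝓡∂ (n + 1)) p S.base)) fun i => chartProjection p S (a i))).det =
      (Matrix.of (imageGram (pullbackMetric p) (extChartAt (𝓡∂ (n + 1)) p S.base) 1
          fun i => chartProjection p S (a i))).det *
        jacobian S (mfderiv (𝓡∂ (n + 1)) (𝓡∂ (n + 1)) (chartFlow p Φ t) S.base) ^ 2 := by
  have h1 := det_gram_eq_mul_jacobian_sq S
    (mfderiv (𝓡∂ (n + 1)) (𝓡∂ (n + 1)) (chartFlow p Φ t) S.base)
    fun i => S.plane.orthogonalProjectionOnto ((chartTriv (n := n) p).symmL ℝ S.base (a i))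
  convert h1 using 2
  · ext i j
    rw [Matrix.gram_apply, inner_mfderiv_chartFlow h hKt h0 hS ht]
    rfl
  · congr 1
    ext i j
    refine (pullbackMetric_extChartAt hS _ _).trans ?_
    exact congrArg₂ (fun u v : TangentSpace (𝓡∂ (n + 1)) S.base => inner ℝ u v)
      (symmL_continuousLinearMapAt hS _) (symmL_continuousLinearMapAt hS _)

variable [IsContMDiffRiemannianBundle (𝓡∂ (n + 1)) ∞ (EuclideanSpace ℝ (Fin (n + 1)))
      (fun x : N => TangentSpace (𝓡∂ (n + 1)) x)]

/-- The Jacobian depends continuously on the plane.  An orthonormal frame of the plane `S₀`, taken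
with constant coordinates and projected to the nearby planes, remains a frame there, and the
Jacobian is the square root of a quotient of two Gram determinants in this continuous frame. -/
theorem continuousAt_jacobian_chartFlow
    (h : IsDifferentiableFlow Y {y | 0 ≤ coordZero n y} K T C Φ A)
    (hKt : K ⊆ (extChartAt (𝓡∂ (n + 1)) p).target)
    (h0 : ∀ y ∈ {y | 0 ≤ coordZero n y} \ K, Y y = 0) {t : ℝ} (ht : t ∈ Icc 0 T)
    {S₀ : GrassmannBundle n N m} (hS₀ : S₀.base ∈ (extChartAt (𝓡∂ (n + 1)) p).source) :
    ContinuousAt (fun S : GrassmannBundle n N m =>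
      jacobian S (mfderiv (𝓡∂ (n + 1)) (𝓡∂ (n + 1)) (chartFlow p Φ t) S.base)) S₀ := by
  obtain ⟨f, hf⟩ := S₀.exists_orthonormal
  set a : Fin m → EuclideanSpace ℝ (Fin (n + 1)) :=
    fun i => (chartTriv (n := n) p).continuousLinearMapAt ℝ S₀.base (f i) with ha
  set s : Set (GrassmannBundle n N m) :=
    GrassmannBundle.base ⁻¹' (extChartAt (𝓡∂ (n + 1)) p).source with hs
  have hsnhds : s ∈ 𝓝 S₀ := GrassmannBundle.continuous_base.continuousAt.preimage_mem_nhds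
    ((isOpen_extChartAt_source p).mem_nhds hS₀)
  have hproj : ∀ i, ContinuousOn (fun S => chartProjection p S (a i)) s := fun i =>
    (continuousOn_chartProjection p).clm_apply continuousOn_const
  have hc : ContinuousOn (fun S : GrassmannBundle n N m => extChartAt (𝓡∂ (n + 1)) p S.base) s :=
    (continuousOn_extChartAt p).comp GrassmannBundle.continuous_base.continuousOn fun S hS => hS
  have hct : MapsTo (fun S : GrassmannBundle n N m => extChartAt (𝓡∂ (n + 1)) p S.base) s
      (extChartAt (𝓡∂ (n + 1)) p).target := fun S hS => (extChartAt (𝓡∂ (n + 1)) p).map_source hS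
  have hg := (contDiffOn_pullbackMetric (n := n) p).continuousOn
  have hΦ : ContinuousOn (Φ t) (extChartAt (𝓡∂ (n + 1)) p).target := fun y hy =>
    ((h.hasFDerivWithinAt t ht y (target_subset_nonneg hy)).continuousWithinAt).mono
      target_subset_nonneg
  have hD := continuousOn_det_imageGram (g := pullbackMetric p)
    (z := fun S : GrassmannBundle n N m => Φ t (extChartAt (𝓡∂ (n + 1)) p S.base))
    (L := fun S : GrassmannBundle n N m => A t (extChartAt (𝓡∂ (n + 1)) p S.base))
    (hg.comp (hΦ.comp hc hct) fun S hS => h.mem_target hKt h0 (hct hS) ht.1)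
    (((h.continuousOn_fderiv t ht).mono target_subset_nonneg).comp hc hct) hproj
  have hD' := continuousOn_det_imageGram (g := pullbackMetric p)
    (z := fun S : GrassmannBundle n N m => extChartAt (𝓡∂ (n + 1)) p S.base)
    (L := fun S : GrassmannBundle n N m => 1) (hg.comp hc hct) continuousOn_const hproj
  have hone : (Matrix.of (imageGram (pullbackMetric p) (extChartAt (𝓡∂ (n + 1)) p S₀.base) 1
      fun i => chartProjection p S₀ (a i))).det = 1 := by
    have hfix : ∀ i, chartProjection p S₀ (a i) = a i := by
      intro i
      change (chartTriv (n := n) p).continuousLinearMapAt ℝ S₀.base (S₀.plane.starProjection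
        ((chartTriv (n := n) p).symmL ℝ S₀.base _)) = _
      rw [ha, symmL_continuousLinearMapAt hS₀,
        Submodule.starProjection_eq_self_iff.2 (f i).2]
    have : Matrix.of (imageGram (pullbackMetric p) (extChartAt (𝓡∂ (n + 1)) p S₀.base) 1
        fun i => chartProjection p S₀ (a i)) = 1 := by
      ext i j
      have hij : pullbackMetric p (extChartAt (𝓡∂ (n + 1)) p S₀.base) (a i) (a j) =
          if i = j then 1 else 0 := by
        rw [ha, pullbackMetric_extChartAt hS₀, symmL_continuousLinearMapAt hS₀,
          symmL_continuousLinearMapAt hS₀, ← orthonormal_iff_ite.1 hf]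
        rfl
      rw [Matrix.one_apply, ← hij]
      simp only [Matrix.of_apply, imageGram, hfix, one_apply_eq_self]
    rw [this, Matrix.det_one]
  have hD'c := hD'.continuousAt hsnhds
  have hquot := ((hD.continuousAt hsnhds).div hD'c (by rw [hone]; exact one_ne_zero)).sqrt
  refine hquot.congr ?_
  filter_upwards [hsnhds, hD'c.eventually_ne (by rw [hone]; exact one_ne_zero)] with S hS hne
  simp only [Pi.div_apply]
  rw [det_imageGram_chartProjection h hKt h0 hS ht, mul_div_cancel_left₀ _ hne,
    Real.sqrt_sq (jacobian_nonneg _ _)]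

theorem continuous_jacobian_chartFlow
    (h : IsDifferentiableFlow Y {y | 0 ≤ coordZero n y} K T C Φ A)
    (hKt : K ⊆ (extChartAt (𝓡∂ (n + 1)) p).target)
    (h0 : ∀ y ∈ {y | 0 ≤ coordZero n y} \ K, Y y = 0)
    (hsupp : fieldSupport (chartField p Y) ⊆ (extChartAt (𝓡∂ (n + 1)) p).source)
    {t : ℝ} (ht : t ∈ Icc 0 T) :
    Continuous (fun S : GrassmannBundle n N m =>
      jacobian S (mfderiv (𝓡∂ (n + 1)) (𝓡∂ (n + 1)) (chartFlow p Φ t) S.base)) := by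
  refine continuous_iff_continuousAt.2 fun S₀ => ?_
  by_cases hS₀ : S₀.base ∈ fieldSupport (chartField p Y)
  · exact continuousAt_jacobian_chartFlow h hKt h0 ht (hsupp hS₀)
  · refine continuousAt_const.congr (f := fun _ => (1 : ℝ)) ?_
    filter_upwards [GrassmannBundle.continuous_base.continuousAt.preimage_mem_nhds
      (isClosed_closure.isOpen_compl.mem_nhds hS₀)] with S hS
    exact (jacobian_chartFlow_of_notMem h hS t).symm

end JacobianContinuity

/-! ### The first variation as an integral -/

section DifferentiationUnderIntegral

variable {α : Type*} {J : ℝ → α → ℝ} {j : α → ℝ} {T c : ℝ}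

theorem abs_slope_le (hb : ∀ t ∈ Icc 0 T, ∀ a, |J t a - 1| ≤ c * t) {t : ℝ} (ht : t ∈ Ioc 0 T)
    (a : α) : |slope (fun s => J s a) 0 t| ≤ c := by
  have h0 : J 0 a = 1 := by
    have h := hb 0 ⟨le_rfl, ht.1.le.trans ht.2⟩ a
    rw [mul_zero] at h
    linarith [abs_nonpos_iff.1 h]
  rw [slope_def_field, h0, sub_zero, abs_div, abs_of_pos ht.1, div_le_iff₀ ht.1]
  exact hb t ⟨ht.1.le, ht.2⟩ a

theorem tendsto_slope_nhdsGT (hj : ∀ a, HasDerivWithinAt (fun t => J t a) (j a) (Ici 0) 0)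
    (a : α) :
    Filter.Tendsto (slope (fun s => J s a) 0) (𝓝[>] 0) (𝓝 (j a)) :=
  (hasDerivWithinAt_iff_tendsto_slope' self_notMem_Ioi).1 (hj a).Ioi_of_Ici

theorem eventually_mem_Ioc (hT : 0 < T) : ∀ᶠ t in 𝓝[>] (0 : ℝ), t ∈ Ioc 0 T :=
  Ioc_mem_nhdsGT hT

theorem abs_deriv_le (hT : 0 < T) (hb : ∀ t ∈ Icc 0 T, ∀ a, |J t a - 1| ≤ c * t)
    (hj : ∀ a, HasDerivWithinAt (fun t => J t a) (j a) (Ici 0) 0) (a : α) : |j a| ≤ c :=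
  le_of_tendsto (tendsto_slope_nhdsGT hj a).abs
    ((eventually_mem_Ioc hT).mono fun _ ht => abs_slope_le hb ht a)

variable [MeasurableSpace α]

theorem measurable_deriv (hT : 0 < T) (hJ : ∀ t ∈ Icc 0 T, Measurable (J t))
    (hj : ∀ a, HasDerivWithinAt (fun t => J t a) (j a) (Ici 0) 0) : Measurable j := by
  obtain ⟨u, -, hu, hlim⟩ := exists_seq_strictAnti_tendsto' hT
  have hlim' : Filter.Tendsto u Filter.atTop (𝓝[>] 0) :=
    tendsto_nhdsWithin_iff.2 ⟨hlim, Filter.Eventually.of_forall fun k => (hu k).1⟩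
  refine measurable_of_tendsto_metrizable (f := fun k a => slope (fun s => J s a) 0 (u k))
    (fun k => ?_) (tendsto_pi_nhds.2 fun a => (tendsto_slope_nhdsGT hj a).comp hlim')
  simp only [slope_def_field]
  exact ((hJ _ ⟨(hu k).1.le, (hu k).2.le⟩).sub (hJ 0 ⟨le_rfl, hT.le⟩)).div_const _

theorem hasDerivWithinAt_integral {μ : Measure α} [IsFiniteMeasure μ] (hT : 0 < T)
    (hJ : ∀ t ∈ Icc 0 T, Measurable (J t)) (hb : ∀ t ∈ Icc 0 T, ∀ a, |J t a - 1| ≤ c * t)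
    (hj : ∀ a, HasDerivWithinAt (fun t => J t a) (j a) (Ici 0) 0) :
    HasDerivWithinAt (fun t => ∫ a, J t a ∂μ) (∫ a, j a ∂μ) (Ici 0) 0 := by
  have hint : ∀ t ∈ Icc 0 T, Integrable (J t) μ := fun t ht => by
    refine Integrable.of_bound (hJ t ht).aestronglyMeasurable (1 + c * t)
      (Filter.Eventually.of_forall fun a => ?_)
    have h1 := hb t ht a
    have h2 := abs_sub_abs_le_abs_sub (J t a) 1
    rw [abs_one] at h2
    rw [Real.norm_eq_abs]
    linarith
  refine HasDerivWithinAt.Ici_of_Ioi ((hasDerivWithinAt_iff_tendsto_slope' self_notMem_Ioi).2 ?_)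
  have hlim : Filter.Tendsto (fun t => ∫ a, slope (fun s => J s a) 0 t ∂μ) (𝓝[>] 0)
      (𝓝 (∫ a, j a ∂μ)) := by
    refine tendsto_integral_filter_of_dominated_convergence (fun _ => c) ?_ ?_
      (integrable_const c) (Filter.Eventually.of_forall fun a => tendsto_slope_nhdsGT hj a)
    · filter_upwards [eventually_mem_Ioc hT] with t ht
      simp only [slope_def_field]
      exact (((hJ t ⟨ht.1.le, ht.2⟩).sub (hJ 0 ⟨le_rfl, hT.le⟩)).div_const _).aestronglyMeasurable
    · filter_upwards [eventually_mem_Ioc hT] with t ht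
      exact Filter.Eventually.of_forall fun a => abs_slope_le hb ht a
  refine hlim.congr' ?_
  filter_upwards [eventually_mem_Ioc hT] with t ht
  simp only [slope_def_field]
  rw [integral_div, integral_sub (hint t ⟨ht.1.le, ht.2⟩) (hint 0 ⟨le_rfl, hT.le⟩)]

end DifferentiationUnderIntegral

section FirstVariation

set_option maxSynthPendingDepth 3

variable {n m : ℕ} {N : Type*} [TopologicalSpace N]
  [ChartedSpace (EuclideanHalfSpace (n + 1)) N] [IsManifold (𝓡∂ (n + 1)) ∞ N]
  [RiemannianBundle (fun x : N => TangentSpace (𝓡∂ (n + 1)) x)]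

/-- Differentiation under the integral sign: if the Jacobians of the flow are differentiable at
time zero, uniformly Lipschitz there, and constant off the support of the field, then the first
variation is the integral of their derivatives. -/
theorem hasFirstVariation_integral {X : (x : N) → TangentSpace (𝓡∂ (n + 1)) x} {φ : ℝ → N → N}
    (hφ : IsForwardFlow X φ) (V : Varifold n N m) {T c : ℝ} (hT : 0 < T)
    {j : GrassmannBundle n N m → ℝ}
    (hJ : ∀ t ∈ Icc 0 T, Continuous fun S : GrassmannBundle n N m =>
      jacobian S (mfderiv (𝓡∂ (n + 1)) (𝓡∂ (n + 1)) (φ t) S.base))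
    (hb : ∀ t ∈ Icc 0 T, ∀ S : GrassmannBundle n N m,
      |jacobian S (mfderiv (𝓡∂ (n + 1)) (𝓡∂ (n + 1)) (φ t) S.base) - 1| ≤ c * t)
    (hj : ∀ S : GrassmannBundle n N m, HasDerivWithinAt (fun t =>
      jacobian S (mfderiv (𝓡∂ (n + 1)) (𝓡∂ (n + 1)) (φ t) S.base)) (j S) (Ici 0) 0)
    (hj0 : ∀ S : GrassmannBundle n N m, S.base ∉ fieldSupport X → j S = 0) :
    HasFirstVariation V X (∫ S, j S ∂V.measure) := by
  refine ⟨φ, hφ, fun W hW hWc hXW => ?_⟩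
  have hfin : IsFiniteMeasure (V.measure.restrict (GrassmannBundle.base ⁻¹' W)) :=
    isFiniteMeasure_restrict.2
      ((measure_mono (preimage_mono subset_closure)).trans_lt (V.finite_of_isCompact _ hWc)).ne
  have h1 := hasDerivWithinAt_integral (μ := V.measure.restrict (GrassmannBundle.base ⁻¹' W)) hT
    (fun t ht => (hJ t ht).measurable) hb hj
  rw [setIntegral_eq_integral_of_forall_compl_eq_zero (μ := V.measure)
    (s := GrassmannBundle.base ⁻¹' W) fun S hS => hj0 S fun h => hS (hXW h)] at h1
  have h2 : ∀ t ∈ Icc 0 T, (imageArea (φ t) V W).toReal = ∫ S in GrassmannBundle.base ⁻¹' W,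
      jacobian S (mfderiv (𝓡∂ (n + 1)) (𝓡∂ (n + 1)) (φ t) S.base) ∂V.measure := fun t ht =>
    (integral_eq_lintegral_of_nonneg_ae (Filter.Eventually.of_forall fun S => jacobian_nonneg _ _)
      (hJ t ht).measurable.aestronglyMeasurable).symm
  refine h1.congr_of_eventuallyEq ?_ (h2 0 ⟨le_rfl, hT.le⟩)
  filter_upwards [Icc_mem_nhdsGE hT] with t ht using h2 t ht

/-- A pointwise bound for the rate of change of the Jacobian integrates to a bound for the first
variation. -/
theorem integral_le_neg_mul_integral_norm [T2Space N] [SecondCountableTopology N]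
    [MeasurableSpace N] [BorelSpace N]
    {X : (x : N) → TangentSpace (𝓡∂ (n + 1)) x} (hX : Continuous fun x => ‖X x‖)
    (hXc : IsCompact (fieldSupport X)) (V : Varifold n N m) {j : GrassmannBundle n N m → ℝ}
    {c η : ℝ}
    (hjm : Measurable j) (hjc : ∀ S, |j S| ≤ c)
    (hj0 : ∀ S : GrassmannBundle n N m, S.base ∉ fieldSupport X → j S = 0)
    (hj : ∀ S : GrassmannBundle n N m, j S ≤ -η * ‖X S.base‖) :
    ∫ S, j S ∂V.measure ≤ -η * ∫ x, ‖X x‖ ∂V.weight := by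
  have hbase : Measurable (GrassmannBundle.base : GrassmannBundle n N m → N) :=
    GrassmannBundle.continuous_base.measurable
  have hmeas : MeasurableSet
      (GrassmannBundle.base ⁻¹' fieldSupport X : Set (GrassmannBundle n N m)) :=
    hbase isClosed_closure.measurableSet
  rw [Varifold.weight, integral_map hbase.aemeasurable hX.aestronglyMeasurable,
    ← integral_const_mul]
  have hfin : IsFiniteMeasure (V.measure.restrict (GrassmannBundle.base ⁻¹' fieldSupport X)) :=
    isFiniteMeasure_restrict.2 (V.finite_of_isCompact _ hXc).ne
  obtain ⟨B, hB⟩ := hXc.exists_bound_of_continuousOn hX.continuousOn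
  refine integral_mono ?_ ?_ hj
  · refine (integrableOn_iff_integrable_of_support_subset
      (s := GrassmannBundle.base ⁻¹' fieldSupport X)
      fun S hS => ?_).1 (Integrable.of_bound hjm.aestronglyMeasurable c
        (Filter.Eventually.of_forall hjc))
    by_contra h
    exact hS (hj0 S h)
  · refine Integrable.const_mul ?_ _
    refine (integrableOn_iff_integrable_of_support_subset
      (s := GrassmannBundle.base ⁻¹' fieldSupport X)
      fun S hS => ?_).1 (Integrable.of_bound
        (hX.comp GrassmannBundle.continuous_base).measurable.aestronglyMeasurable B ?_)
    · refine subset_closure fun h => hS ?_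
      simp only [h, norm_zero]
    · exact ae_restrict_of_forall_mem hmeas fun S hS => hB _ hS

theorem continuous_norm_of_contMDiff [IsContMDiffRiemannianBundle (𝓡∂ (n + 1)) ∞
      (EuclideanSpace ℝ (Fin (n + 1))) (fun x : N => TangentSpace (𝓡∂ (n + 1)) x)]
    {X : (x : N) → TangentSpace (𝓡∂ (n + 1)) x}
    (hX : ContMDiff (𝓡∂ (n + 1)) (𝓡∂ (n + 1)).tangent ∞
      (fun x => (⟨x, X x⟩ : TangentBundle (𝓡∂ (n + 1)) N))) :
    Continuous fun x => ‖X x‖ := by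
  have h1 : Continuous fun x => (inner ℝ (X x) (X x) : ℝ) :=
    (ContMDiff.inner_bundle (IB := 𝓡∂ (n + 1)) (n := ∞) (F := EuclideanSpace ℝ (Fin (n + 1)))
      (E := fun x : N => TangentSpace (𝓡∂ (n + 1)) x) (b := fun x : N => x) hX hX).continuous
  simpa only [norm_eq_sqrt_real_inner] using h1.sqrt

end FirstVariation

/-! ### Area estimates for the flow of a field in a chart -/

section BarrierField

set_option maxSynthPendingDepth 3

variable {n m : ℕ} {N : Type*} [TopologicalSpace N]
  [ChartedSpace (EuclideanHalfSpace (n + 1)) N] [IsManifold (𝓡∂ (n + 1)) ∞ N]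
  [RiemannianBundle (fun x : N => TangentSpace (𝓡∂ (n + 1)) x)]

omit [IsManifold (𝓡∂ (n + 1)) ∞ N] in
/-- A vector which is not directed outwards has nonnegative product with the inward normal. -/
theorem inner_inwardNormal_nonneg {q : N} {v : TangentSpace (𝓡∂ (n + 1)) q}
    (hv : 0 ≤ boundaryCoord q v) : 0 ≤ inner ℝ v (inwardNormal (n := n) q) := by
  obtain ⟨h1, h2, h3⟩ := isInwardUnitNormal_inwardNormal (n := n) q
  have h4 : v - (boundaryCoord q v / boundaryCoord q (inwardNormal (n := n) q)) •
      inwardNormal (n := n) q ∈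
      boundaryTangent (n := n) q := by
    refine LinearMap.mem_ker.2 ?_
    rw [map_sub, map_smul, smul_eq_mul, div_mul_cancel₀ _ h3.ne', sub_self]
  have h5 := h2 _ h4
  rw [inner_sub_right, real_inner_smul_right, real_inner_self_eq_norm_sq, h1, sub_eq_zero] at h5
  rw [real_inner_comm, h5]
  positivity

variable [IsContMDiffRiemannianBundle (𝓡∂ (n + 1)) ∞ (EuclideanSpace ℝ (Fin (n + 1)))
      (fun x : N => TangentSpace (𝓡∂ (n + 1)) x)]
  {p : N} {Y : EuclideanSpace ℝ (Fin (n + 1)) → EuclideanSpace ℝ (Fin (n + 1))}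
  {K : Set (EuclideanSpace ℝ (Fin (n + 1)))}
  {T C : ℝ} {Φ : ℝ → EuclideanSpace ℝ (Fin (n + 1)) → EuclideanSpace ℝ (Fin (n + 1))}
  {A : ℝ → EuclideanSpace ℝ (Fin (n + 1)) →
    EuclideanSpace ℝ (Fin (n + 1)) →L[ℝ] EuclideanSpace ℝ (Fin (n + 1))}

omit [IsContMDiffRiemannianBundle (𝓡∂ (n + 1)) ∞ (EuclideanSpace ℝ (Fin (n + 1)))
      (fun x : N => TangentSpace (𝓡∂ (n + 1)) x)] in
theorem sqrt_pullbackMetric_eq_norm {x : N} (hx : x ∈ (extChartAt (𝓡∂ (n + 1)) p).source) :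
    √(pullbackMetric p (extChartAt (𝓡∂ (n + 1)) p x) (Y (extChartAt (𝓡∂ (n + 1)) p x))
      (Y (extChartAt (𝓡∂ (n + 1)) p x))) = ‖chartField p Y x‖ := by
  rw [pullbackMetric_extChartAt hx, norm_eq_sqrt_real_inner]
  rfl

/-- The Jacobian of the flow on each plane is differentiable at time zero, with derivative at most
`-η |X|`. -/
theorem exists_hasDerivWithinAt_jacobian_le {η : ℝ}
    (h : IsDifferentiableFlow Y {y | 0 ≤ coordZero n y} K T C Φ A)
    (hKt : K ⊆ (extChartAt (𝓡∂ (n + 1)) p).target)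
    (h0 : ∀ y ∈ {y | 0 ≤ coordZero n y} \ K, Y y = 0)
    (hsupp : fieldSupport (chartField p Y) ⊆ (extChartAt (𝓡∂ (n + 1)) p).symm '' K)
    (hvar : ∀ y ∈ K, ∀ e : Fin m → EuclideanSpace ℝ (Fin (n + 1)),
      IsOrthonormalFor (pullbackMetric p y) e →
        ∑ i, 1 / 2 * (fderivWithin ℝ (pullbackMetric p) {y | 0 ≤ coordZero n y} y (Y y)
            (e i) (e i) +
          pullbackMetric p y (fderivWithin ℝ Y {y | 0 ≤ coordZero n y} y (e i)) (e i) +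
          pullbackMetric p y (e i) (fderivWithin ℝ Y {y | 0 ≤ coordZero n y} y (e i))) ≤
        -η * √(pullbackMetric p y (Y y) (Y y)))
    (S : GrassmannBundle n N m) :
    ∃ r : ℝ, HasDerivWithinAt (fun t =>
        jacobian S (mfderiv (𝓡∂ (n + 1)) (𝓡∂ (n + 1)) (chartFlow p Φ t) S.base)) r (Ici 0) 0 ∧
      (S.base ∉ fieldSupport (chartField p Y) → r = 0) ∧ r ≤ -η * ‖chartField p Y S.base‖ := by
  by_cases hS : S.base ∈ fieldSupport (chartField p Y)
  · obtain ⟨y, hyK, hy⟩ := hsupp hS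
    have hyx : extChartAt (𝓡∂ (n + 1)) p S.base = y := by
      rw [← hy, (extChartAt (𝓡∂ (n + 1)) p).right_inv (hKt hyK)]
    have hx : S.base ∈ (extChartAt (𝓡∂ (n + 1)) p).source := by
      rw [← hy]
      exact (extChartAt (𝓡∂ (n + 1)) p).map_target (hKt hyK)
    obtain ⟨e, he, heJ⟩ := exists_jacobian_chartFlow_eq h hKt h0 hx
    rw [hyx] at he
    have hg : DifferentiableWithinAt ℝ (pullbackMetric (n := n) p) {y | 0 ≤ coordZero n y} y :=
      ((contDiffOn_pullbackMetric (n := n) p y (hKt hyK)).mono_of_mem_nhdsWithin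
        (target_mem_nhdsWithin (hKt hyK))).differentiableWithinAt (by simp)
    have hd := h.hasDerivWithinAt_sqrt_det_imageGram (target_subset_nonneg (hKt hyK)) hg he
    refine ⟨_, hd.congr_of_eventuallyEq ?_ ?_, fun hn => absurd hS hn, ?_⟩
    · filter_upwards [Icc_mem_nhdsGE h.pos] with t ht
      rw [heJ t ht, hyx]
    · rw [heJ 0 ⟨le_rfl, h.pos.le⟩, hyx]
    · refine (hvar y hyK e he).trans_eq ?_
      rw [← sqrt_pullbackMetric_eq_norm hx, hyx]
  · have hx0 : chartField p Y S.base = 0 := by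
      by_contra hne
      exact hS (subset_closure hne)
    refine ⟨0, ?_, fun _ => rfl, by rw [hx0, norm_zero, mul_zero]⟩
    simp only [jacobian_chartFlow_of_notMem h hS]
    exact hasDerivWithinAt_const _ _ _

/-- The Jacobians of the flow are Lipschitz at time zero, uniformly over all planes. -/
theorem exists_abs_jacobian_chartFlow_sub_one_le
    (h : IsDifferentiableFlow Y {y | 0 ≤ coordZero n y} K T C Φ A) (hK : IsCompact K)
    (hY : ContinuousOn Y {y | 0 ≤ coordZero n y})
    (hKt : K ⊆ (extChartAt (𝓡∂ (n + 1)) p).target)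
    (h0 : ∀ y ∈ {y | 0 ≤ coordZero n y} \ K, Y y = 0)
    (hsupp : fieldSupport (chartField p Y) ⊆ (extChartAt (𝓡∂ (n + 1)) p).symm '' K) (m : ℕ) :
    ∃ T' > 0, T' ≤ T ∧ ∃ c : ℝ, ∀ t ∈ Icc 0 T', ∀ S : GrassmannBundle n N m,
      |jacobian S (mfderiv (𝓡∂ (n + 1)) (𝓡∂ (n + 1)) (chartFlow p Φ t) S.base) - 1| ≤ c * t := by
  obtain ⟨T', hT', hT'T, c, hc⟩ := h.exists_abs_sqrt_det_imageGram_sub_one_le hK uniqueDiffOn_nonneg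
    (fun y hy => target_mem_nhdsWithin hy) hKt target_subset_nonneg (isMetricOn_pullbackMetric p)
    (contDiffOn_pullbackMetric p) hY m
  refine ⟨T', hT', hT'T, max c 0, fun t ht S => ?_⟩
  by_cases hS : S.base ∈ fieldSupport (chartField p Y)
  · obtain ⟨y, hyK, hy⟩ := hsupp hS
    have hyx : extChartAt (𝓡∂ (n + 1)) p S.base = y := by
      rw [← hy, (extChartAt (𝓡∂ (n + 1)) p).right_inv (hKt hyK)]
    have hx : S.base ∈ (extChartAt (𝓡∂ (n + 1)) p).source := by
      rw [← hy]
      exact (extChartAt (𝓡∂ (n + 1)) p).map_target (hKt hyK)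
    obtain ⟨e, he, heJ⟩ := exists_jacobian_chartFlow_eq h hKt h0 hx
    rw [hyx] at he heJ
    rw [heJ t ⟨ht.1, ht.2.trans hT'T⟩]
    exact (hc t ht y hyK e he).trans (mul_le_mul_of_nonneg_right (le_max_left _ _) ht.1)
  · rw [jacobian_chartFlow_of_notMem h hS, sub_self, abs_zero]
    exact mul_nonneg (le_max_right _ _) ht.1

end BarrierField

end RiemannianBoundary

end

theorem theorem2 (n : ℕ) (N : Type*) [TopologicalSpace N] [T2Space N] [SecondCountableTopology N]
    [ChartedSpace (EuclideanHalfSpace (n + 1)) N] [IsManifold (𝓡∂ (n + 1)) ∞ N]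
    [RiemannianBundle (fun x : N => TangentSpace (𝓡∂ (n + 1)) x)]
    [IsContMDiffRiemannianBundle (𝓡∂ (n + 1)) ∞ (EuclideanSpace ℝ (Fin (n + 1)))
      (fun x : N => TangentSpace (𝓡∂ (n + 1)) x)]
    [MeasurableSpace N] [BorelSpace N]
    (m : ℕ) (hm : m ≤ n) (p : N) (hp : p ∈ (𝓡∂ (n + 1)).boundary N)
    (η : ℝ) (hη : η < ∑ i : Fin m, principalCurvature p (Fin.castLE hm i)) :
    ∃ X : (x : N) → TangentSpace (𝓡∂ (n + 1)) x,
      ContMDiff (𝓡∂ (n + 1)) (𝓡∂ (n + 1)).tangent ∞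
        (fun x => (⟨x, X x⟩ : TangentBundle (𝓡∂ (n + 1)) N)) ∧
      IsCompact (fieldSupport X) ∧
      X p ≠ 0 ∧
      (∀ v ∈ boundaryTangent p, inner ℝ (X p) v = 0) ∧
      (∀ q ∈ (𝓡∂ (n + 1)).boundary N, 0 ≤ inner ℝ (X q) (inwardNormal q)) ∧
      ∀ V : Varifold n N m,
        ∃ δ : ℝ, HasFirstVariation V X δ ∧ δ ≤ -η * ∫ x, ‖X x‖ ∂V.weight := by
  obtain ⟨O, hO, hOt⟩ := exists_isOpen_target (n := n) p
  have hqt := mem_extChartAt_target (I := 𝓡∂ (n + 1)) p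
  have hg := isMetricOn_pullbackMetric (n := n) p
  -- the gradient of the boundary coordinate, for the metric read in the chart
  obtain ⟨V₀, hV₀⟩ : ∃ V₀, pullbackMetric p (extChartAt (𝓡∂ (n + 1)) p p) V₀ = coordZero n := by
    obtain ⟨L, hL⟩ := hg.isInvertible hqt
    exact ⟨L.symm (coordZero n), by rw [← hL]; exact L.apply_symm_apply _⟩
  -- the barrier field `Y` of the chart, supported in `K`
  obtain ⟨Y, K, hY, hK, hKt, h0, hin, ⟨a, ha, hYp⟩, hvar⟩ :=
    exists_barrierField (m := m) hO (coordZero n) (e₀ := EuclideanSpace.single 0 1)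
      (by simp [coordZero]) (hOt ▸ hg) (hOt ▸ contDiffOn_pullbackMetric (n := n) p)
      (hOt ▸ hqt : _ ∈ {y | 0 ≤ coordZero n y} ∩ O).2 (coordZero_extChartAt hp) hV₀ hη
      fun e he he0 => sum_principalCurvature_mul_le hm hV₀ he he0
  rw [← hOt] at hKt
  obtain ⟨T, C, Φ, A, hΦ⟩ := exists_isDifferentiableFlow (coordZero n)
    (e := EuclideanSpace.single 0 1) (by simp [coordZero]) hK (hKt.trans target_subset_nonneg)
    (hY.of_le (WithTop.coe_le_coe.2 le_top)) h0 hin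
  have hsupp := fieldSupport_chartField_subset (p := p) hK hKt h0
  have hcompact : IsCompact (fieldSupport (chartField p Y)) :=
    (isCompact_image_extChartAt_symm hK hKt).of_isClosed_subset isClosed_closure hsupp
  have hsmooth := contMDiff_chartField (p := p) hY hK hKt h0
  have hflow := isForwardFlow_chartFlow (p := p) hΦ hKt h0
  have hXp : chartField p Y p = a • V₀ := by
    rw [chartField, hYp]
    exact symmL_self (n := n) p _
  have hinner : ∀ v : TangentSpace (𝓡∂ (n + 1)) p,
      inner ℝ (chartField p Y p) v = a * boundaryCoord p v := by
    intro v
    rw [← pullbackMetric_self, hXp]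
    refine (congrArg (fun L : EuclideanSpace ℝ (Fin (n + 1)) →L[ℝ] ℝ => L v)
      ((map_smul _ a V₀).trans (congrArg (a • ·) hV₀))).trans ?_
    rfl
  refine ⟨chartField p Y, hsmooth, hcompact, fun hzero => ?_, fun v hv => ?_, fun q hq => ?_,
    fun V => ?_⟩
  · obtain ⟨w, hw⟩ := boundaryCoord_surjective (n := n) p 1
    have h1 := hinner w
    rw [hzero, inner_zero_left, hw, mul_one] at h1
    exact ha.ne h1
  · rw [hinner, LinearMap.mem_ker.1 hv, mul_zero]
  · exact inner_inwardNormal_nonneg (boundaryCoord_nonneg_of_isForwardFlow hflow hq)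
  · choose j hj hj0 hjle using
      exists_hasDerivWithinAt_jacobian_le (m := m) (p := p) hΦ hKt h0 hsupp hvar
    obtain ⟨T', hT', hT'T, c, hc⟩ := exists_abs_jacobian_chartFlow_sub_one_le (p := p) hΦ hK
      hY.continuousOn hKt h0 hsupp m
    have hcont : ∀ t ∈ Icc 0 T', Continuous fun S : GrassmannBundle n N m =>
        jacobian S (mfderiv (𝓡∂ (n + 1)) (𝓡∂ (n + 1)) (chartFlow p Φ t) S.base) := fun t ht =>
      continuous_jacobian_chartFlow hΦ hKt h0
        (hsupp.trans fun x ⟨y, hy, hyx⟩ => hyx ▸ (extChartAt _ p).map_target (hKt hy))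
        ⟨ht.1, ht.2.trans hT'T⟩
    exact ⟨_, hasFirstVariation_integral hflow V hT' hcont hc hj hj0,
      integral_le_neg_mul_integral_norm (continuous_norm_of_contMDiff hsmooth) hcompact V
        (measurable_deriv hT' (fun t ht => (hcont t ht).measurable) hj)
        (abs_deriv_le hT' hc hj) hj0 hjle⟩
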